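/- **Symbols.** Write $\langle x\rangle=\sqrt{x^2+1}$. A smooth function $\sigma:\mathbb R_{\ge0}\to\mathbb C$ belongs to $\mathcal S^r$ ($r\in\mathbb R$) if for every $k\ge 0$ there is $D_k>0$ with $|\partial_x^k\sigma(x)|\le D_k\langle x\rangle^{r-k}$ for all $x\ge0$. An excision function is a smooth $\chi:\mathbb R_{\ge0}\to\mathbb R$ which vanishes near $0$ and equals $1$ outside some interval containing $[0,1]$. For $\alpha\in\mathbb C$ write $\sigma\sim\sum_{j\ge0}a_jx^{\alpha-j}$ if $\sigma\in\mathcal S^{\mathrm{Re}\,\alpha}$ and, for some excision function $\chi$ and all $N\ge1$, the remainder $\sigma^\chi_{(N)}=\sigma-\sum_{j<N}\chi\,a_jx^{\alpha-j}$ lies in $\mathcal S^{\mathrm{Re}\,\alpha-N}$. The functions with such an expansion form the space $\mathcal S^\alpha_{\rm ph}$, the linear span of the polyhomogeneous symbols of order $\alpha$ (those with $a_0\ne0$). **Families.** Let $U\subset\mathbb C^k$ be a domain, $L$ a linear form on $\mathbb C^k$ with real coefficients, $c\in\mathbb R$ and $\alpha(z)=L(z)+c$. A simple holomorphic family of symbols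 on $U$ of affine order $\alpha$ is a family $(\sigma(z))_{z\in U}$ with $\sigma(z)\sim\sum_j a_j(z)x^{\alpha(z)-j}$ for all $z\in U$ such that, for all $N\ge1$, all excision functions $\chi$, all $m\ge0$ and all $x\ge0$, the function $z\mapsto\partial_x^m\sigma(z)^\chi_{(N)}(x)$ is holomorphic on $U$ and, for all compact $K\subset U$, all $n\ge0$ and all $\epsilon>0$, its partial derivatives of total order $n$ in $z$ are bounded on $K$ by $C\,\langle x\rangle^{\mathrm{Re}\,\alpha(z)-N-m+\epsilon}$, with $C$ independent of $z\in K$ and of $x\ge 0$. **Germs.** A simple meromorphic germ of symbols at $0\in\mathbb C^k$ of affine order $\alpha$ is the germ at $0$ of a family $\sigma$ defined on $U\setminus X$, where $U\ni0$ is a domain, $X=\bigcup_i\{L_i=0\}$ for finitely many nonzero linear forms $L_i$ with real coefficients, and $\prod_iL_i^{s_i}\sigma$ is the restriction to $U\setminus X$ of a simple holomorphic family on $U$ of affine order $\alpha$, for some $s_i\in\mathbb Z_{\ge0}$; families are identified if they agree near $0$ off the union of their pole sets. Let $\mathcal M\mathcal S(\mathbb C^k)$ be the complex linear span of these germs, and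 let $\mathcal M(\mathbb C^k)$ be the space of germs $h/\prod_iL_i^{s_i}$ with $h$ a holomorphic function near $0$ and $L_i,s_i$ as above. Let $\mathcal L=\bigoplus_{i\ge1}\mathbb R z_i$ be the space of linear forms with real coefficients in the variables $z_1,z_2,\dots$, and let $Q$ be an inner product on $\mathcal L$. Germs on $\mathbb C^k$ are viewed as germs on $\mathbb C^{k+1}$ that do not depend on $z_{k+1}$. Let $\mathcal M\mathcal S(\mathbb C^\infty)=\bigcup_k\mathcal M\mathcal S(\mathbb C^k)$ and $\mathcal M(\mathbb C^\infty)=\bigcup_k\mathcal M(\mathbb C^k)$. The space $\Omega$ of admissible meromorphic germs of symbols is the complex linear span of the simple meromorphic germs of symbols of nonconstant affine order (that is, $L\neq0$) and of the products $f\cdot p$ with $f\in\mathcal M(\mathbb C^\infty)$ and $p\in\mathbb R[x]$. **Independence.** A germ $\sigma$ depends on a finite-dimensional subspace $W\subset\mathcal L$ if $\sigma(z)=\tau(L_1(z),\dots,L_k(z))$ for a basis $L_1,\dots,L_k$ of $W$ and some $\tau\in\mathcal M\mathcal S(\mathbb C^k)$. The dependence subspace $\mathrm{Dep}(\sigma)$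 is the smallest subspace on which $\sigma$ depends. For $\sigma_1,\sigma_2\in\Omega$ put $\sigma_1\perp^Q\sigma_2$ if $\mathrm{Dep}(\sigma_1)$ and $\mathrm{Dep}(\sigma_2)$ are $Q$-orthogonal. **Locality algebras.** For a symmetric relation $\top$ on a set $A$ and $U\subset A$ let $U^\top=\{x\in A: x\top u\ \forall u\in U\}$. A commutative unital locality algebra over $\mathbb C$ is a complex vector space $A$ with a symmetric relation $\top$, a map $m:\{(x,y)\in A\times A: x\top y\}\to A$ and an element $1_A\in A$ such that: $U^\top$ is a linear subspace for each $U\subset A$; $m$ is additive and homogeneous in each argument whenever all the pairs involved lie in $\top$; $m(x,y)\in U^\top$ whenever $U\subset A$, $x,y\in U^\top$ and $x\top y$; $m(m(x,y),z)=m(x,m(y,z))$ (both sides being defined) for pairwise independent $x,y,z$; $m(x,y)=m(y,x)$ for $x\top y$; $\{1_A\}^\top=A$, and $m(x,1_A)=m(1_A,x)=x$ for all $x\in A$. **Proposition.** Every $\sigma\in\Omega$ has a dependence subspace. If $\sigma_1,\sigma_2\in\Omega$ and $\sigma_1\perp^Q\sigma_2$, then the pointwise product $\sigma_1\sigma_2$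 lies in $\Omega$; and $(\Omega,\perp^Q,m_\Omega)$, with $m_\Omega$ the restriction of the pointwise multiplication to the graph $\perp^Q\subset\Omega\times\Omega$, is a commutative and unital locality algebra over $\mathbb C$ whose unit is the constant function $1$. -/

import Mathlib

open scoped NNReal ContDiff Topology

noncomputable section

namespace LocalitySymbols

/-! ### Locality structures -/

/-- The polar set `U^⊤` of `U`: all elements independent of every element of `U`. -/
def polar {A : Type*} (T : A → A → Prop) (U : Set A) : Set A :=
  {x | ∀ u ∈ U, T x u}

/-- `(A, T, m, e)` is a commutative, associative and unital locality algebra over `𝕜`; the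
product `m` is only defined on the graph of the independence relation `T`. -/
structure IsCommUnitalLocalityAlgebra (𝕜 : Type*) {A : Type*} [Field 𝕜] [AddCommGroup A]
    [Module 𝕜 A] (T : A → A → Prop) (m : {p : A × A // T p.1 p.2} → A) (e : A) : Prop where
  /-- locality set: the independence relation is symmetric -/
  symm : ∀ x y, T x y → T y x
  /-- locality vector space: all polar sets are linear subspaces -/
  polar_subspace : ∀ X : Set A, ∃ W : Submodule 𝕜 A, (W : Set A) = polar T X
  /-- locality bilinearity of the product -/
  add_left : ∀ v₁ v₂ w (h₁ : T v₁ w) (h₂ : T v₂ w) (h : T (v₁ + v₂) w),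
    m ⟨(v₁ + v₂, w), h⟩ = m ⟨(v₁, w), h₁⟩ + m ⟨(v₂, w), h₂⟩
  add_right : ∀ v w₁ w₂ (h₁ : T v w₁) (h₂ : T v w₂) (h : T v (w₁ + w₂)),
    m ⟨(v, w₁ + w₂), h⟩ = m ⟨(v, w₁), h₁⟩ + m ⟨(v, w₂), h₂⟩
  smul_left : ∀ (c : 𝕜) v w (h₁ : T v w) (h : T (c • v) w),
    m ⟨(c • v, w), h⟩ = c • m ⟨(v, w), h₁⟩
  smul_right : ∀ (c : 𝕜) v w (h₁ : T v w) (h : T v (c • w)),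
    m ⟨(v, c • w), h⟩ = c • m ⟨(v, w), h₁⟩
  /-- locality magma: the product of two independent elements of `U^⊤` lies in `U^⊤` -/
  mul_mem_polar : ∀ (U : Set A) x y (h : T x y), x ∈ polar T U → y ∈ polar T U →
    m ⟨(x, y), h⟩ ∈ polar T U
  /-- associativity on triples of pairwise independent elements, both sides being defined -/
  assoc : ∀ x y z (hxy : T x y) (hyz : T y z), T x z →
    ∃ (h₁ : T (m ⟨(x, y), hxy⟩) z) (h₂ : T x (m ⟨(y, z), hyz⟩)),
      m ⟨(m ⟨(x, y), hxy⟩, z), h₁⟩ = m ⟨(x, m ⟨(y, z), hyz⟩), h₂⟩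
  comm : ∀ x y (h : T x y) (h' : T y x), m ⟨(x, y), h⟩ = m ⟨(y, x), h'⟩
  /-- the unit is independent of everything and neutral for the product -/
  polar_unit : polar T {e} = Set.univ
  mul_unit : ∀ x (h : T x e), m ⟨(x, e), h⟩ = x
  unit_mul : ∀ x (h : T e x), m ⟨(e, x), h⟩ = x

/-! ### Symbols on the half line `[0, ∞)` -/

/-- A function on `[0, ∞)` seen as a function on `ℝ`. Only its restriction to `[0, ∞)`, and
derivatives within `[0, ∞)`, are ever used. -/
def extend {F : Type*} (σ : ℝ≥0 → F) : ℝ → F := fun t => σ t.toNNReal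

/-- The `k`-th derivative `∂ₓᵏ σ (x)`, one-sided at `x = 0`. -/
def xDeriv (k : ℕ) (σ : ℝ≥0 → ℂ) (x : ℝ≥0) : ℂ :=
  iteratedDerivWithin k (extend σ) (Set.Ici 0) (x : ℝ)

/-- The Japanese bracket `⟨x⟩ = √(x² + 1)`. -/
def bracket (x : ℝ≥0) : ℝ := Real.sqrt ((x : ℝ) ^ 2 + 1)

/-- `σ ∈ 𝒮^r(ℝ_{≥0})`. -/
def IsSymbol (r : ℝ) (σ : ℝ≥0 → ℂ) : Prop :=
  ContDiffOn ℝ ∞ (extend σ) (Set.Ici 0) ∧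
    ∀ k : ℕ, ∃ D : ℝ, 0 < D ∧ ∀ x : ℝ≥0, ‖xDeriv k σ x‖ ≤ D * bracket x ^ (r - k)

/-- Excision functions around zero. -/
def IsExcision (χ : ℝ≥0 → ℝ) : Prop :=
  ContDiffOn ℝ ∞ (extend χ) (Set.Ici 0) ∧ (∃ δ > 0, ∀ x < δ, χ x = 0) ∧
    ∃ R : ℝ≥0, 1 ≤ R ∧ ∀ x > R, χ x = 1

/-- The remainder `σ_{(N)}^χ (x) = σ(x) - ∑_{j<N} χ(x) a_j x^{α-j}`. -/
def remainder (σ : ℝ≥0 → ℂ) (α : ℂ) (a : ℕ → ℂ) (χ : ℝ≥0 → ℝ) (N : ℕ) : ℝ≥0 → ℂ :=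
  fun x => σ x - ∑ j ∈ Finset.range N, (χ x : ℂ) * a j * (((x : ℝ) : ℂ) ^ (α - j))

/-- `σ ∼ ∑_j a_j x^{α-j}`. Here `a 0 = 0` is allowed, so for fixed `α` the `σ` that have such an
expansion form the linear span `𝒮_ph^α(ℝ_{≥0})` of the polyhomogeneous symbols of order exactly
`α` (those with `a 0 ≠ 0`): if `a 0 = 0`, write `σ = (σ + χ x^α) - χ x^α`. -/
def HasExpansion (σ : ℝ≥0 → ℂ) (α : ℂ) (a : ℕ → ℂ) : Prop :=
  IsSymbol α.re σ ∧ ∃ χ, IsExcision χ ∧ ∀ N : ℕ, 1 ≤ N →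
    IsSymbol (α.re - N) (remainder σ α a χ N)

/-! ### Real linear forms, and germs at zero off real hyperplanes -/

/-- The value at `z` of the linear form `∑ᵢ vᵢ zᵢ` with real coefficients `vᵢ`, almost all
zero. -/
def realForm {ι : Type*} (v : ι →₀ ℝ) (z : ι → ℂ) : ℂ := v.sum fun i r => (r : ℂ) * z i

/-- The filter generated by the sets `W \ X` with `W` a neighbourhood of `0` and `X` a finite
union of hyperplanes `{L = 0}`, for nonzero real linear forms `L` in finitely many variables.
For infinite `ι` the topology of `ι → ℂ` is the product topology, so that `W` may be taken to
restrict finitely many variables only. -/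
def germFilter (ι : Type*) : Filter (ι → ℂ) :=
  𝓝 0 ⊓ ⨅ v : {v : ι →₀ ℝ // v ≠ 0}, Filter.principal {z | realForm v.1 z ≠ 0}

/-- Germs at zero, defined off finitely many real hyperplanes, of functions of `z` with values in
the functions on `[0, ∞)`. This is a commutative ring under the pointwise operations. -/
abbrev SGerm (ι : Type*) := (germFilter ι).Germ (ℝ≥0 → ℂ)

/-- The germ of a function. -/
def toGerm {ι : Type*} (f : (ι → ℂ) → ℝ≥0 → ℂ) : SGerm ι := (f : (germFilter ι).Germ (ℝ≥0 → ℂ))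

/-! ### Families of symbols on `ℂ^k` -/

/-- The affine order `α(z) = L(z) + c` with real coefficients. -/
def affine {k : ℕ} (L : Fin k →₀ ℝ) (c : ℝ) (z : Fin k → ℂ) : ℂ := realForm L z + c

/-- `(σ(z))_{z ∈ U}` is a simple holomorphic family of symbols of affine order `L + c` on the
domain `U` of `ℂ^k`. The `n`-th `z`-derivative is measured by the norm of the `n`-th complex
Fréchet derivative, i.e. all partial derivatives of total degree `n` are bounded. -/
def IsSimpleHolomorphicFamily {k : ℕ} (U : Set (Fin k → ℂ)) (L : Fin k →₀ ℝ) (c : ℝ)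
    (σ : (Fin k → ℂ) → ℝ≥0 → ℂ) : Prop :=
  IsOpen U ∧ IsConnected U ∧
  ∃ a : ℕ → (Fin k → ℂ) → ℂ,
    (∀ z ∈ U, HasExpansion (σ z) (affine L c z) (fun j => a j z)) ∧
    ∀ (N : ℕ) (χ : ℝ≥0 → ℝ), 1 ≤ N → IsExcision χ → ∀ m : ℕ,
      (∀ x : ℝ≥0, DifferentiableOn ℂ
        (fun z => xDeriv m (remainder (σ z) (affine L c z) (fun j => a j z) χ N) x) U) ∧
      ∀ K ⊆ U, IsCompact K → ∀ (n : ℕ) (ε : ℝ), 0 < ε → ∃ C : ℝ, 0 < C ∧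
        ∀ z ∈ K, ∀ x : ℝ≥0,
          ‖iteratedFDeriv ℂ n
            (fun w => xDeriv m (remainder (σ w) (affine L c w) (fun j => a j w) χ N) x) z‖
            ≤ C * bracket x ^ ((affine L c z).re - N - m + ε)

/-- The product `L₁(z)^{s₁} ⋯ L_n(z)^{s_n}`. -/
def formProd {k n : ℕ} (ℓ : Fin n → (Fin k →₀ ℝ)) (s : Fin n → ℕ) (z : Fin k → ℂ) : ℂ :=
  ∏ i, realForm (ℓ i) z ^ s i

/-- `σ` represents a simple meromorphic germ of symbols at `0 ∈ ℂ^k` with linear poles and affine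
order `L + c`: for some domain `U` containing `0`, the product `L₁^{s₁} ⋯ L_n^{s_n} σ` agrees off
`X = ⋃ {Lᵢ = 0}` with a simple holomorphic family of order `L + c` on `U`. (Then `σ` is itself a
simple holomorphic family near any point of `U \ X`, as the `Lᵢ` do not vanish there.) -/
def IsSimpleMeromorphic {k : ℕ} (L : Fin k →₀ ℝ) (c : ℝ) (σ : (Fin k → ℂ) → ℝ≥0 → ℂ) : Prop :=
  ∃ (U : Set (Fin k → ℂ)) (n : ℕ) (ℓ : Fin n → (Fin k →₀ ℝ)) (s : Fin n → ℕ)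
    (τ : (Fin k → ℂ) → ℝ≥0 → ℂ),
    0 ∈ U ∧ (∀ i, ℓ i ≠ 0) ∧ IsSimpleHolomorphicFamily U L c τ ∧
    ∀ z ∈ U, (∀ i, realForm (ℓ i) z ≠ 0) → ∀ x, formProd ℓ s z * σ z x = τ z x

/-- `ℳ𝒮(ℂ^k)`: the space of meromorphic germs of symbols at `0 ∈ ℂ^k` with linear poles. -/
def meromorphicGerms (k : ℕ) : Submodule ℂ (SGerm (Fin k)) :=
  Submodule.span ℂ {g | ∃ L c σ, IsSimpleMeromorphic L c σ ∧ g = toGerm σ}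

/-- `f` represents a germ at `0 ∈ ℂ^k` of meromorphic functions with linear poles with real
coefficients, i.e. an element of `ℳ(ℂ^k)`. -/
def IsMeromorphicFunction {k : ℕ} (f : (Fin k → ℂ) → ℂ) : Prop :=
  ∃ (U : Set (Fin k → ℂ)) (n : ℕ) (ℓ : Fin n → (Fin k →₀ ℝ)) (s : Fin n → ℕ)
    (h : (Fin k → ℂ) → ℂ),
    0 ∈ U ∧ IsOpen U ∧ IsConnected U ∧ (∀ i, ℓ i ≠ 0) ∧ DifferentiableOn ℂ h U ∧
    ∀ z ∈ U, (∀ i, realForm (ℓ i) z ≠ 0) → formProd ℓ s z * f z = h z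

/-! ### Countably many variables: admissible germs and independence -/

/-- The projection of `z = (z₀, z₁, …)` to its first `k` coordinates. Pulling back along it
embeds the germs on `ℂ^k` in the germs in countably many variables, and identifies a germ on
`ℂ^k` with its pull-back to `ℂ^{k+1}`, so that direct limits over `k` become unions. -/
def firstCoords (k : ℕ) (z : ℕ → ℂ) : Fin k → ℂ := fun i => z i

/-- The space `Ω` of admissible meromorphic germs of symbols: the complex linear span of the
simple meromorphic germs of symbols of nonconstant affine order and of the products of
meromorphic germs of functions in `z` with real polynomials in `x`. -/
def Omega : Submodule ℂ (SGerm ℕ) :=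
  Submodule.span ℂ
    ({g | ∃ (k : ℕ) (L : Fin k →₀ ℝ) (c : ℝ) (σ : (Fin k → ℂ) → ℝ≥0 → ℂ),
        L ≠ 0 ∧ IsSimpleMeromorphic L c σ ∧ g = toGerm fun z => σ (firstCoords k z)} ∪
     {g | ∃ (k : ℕ) (f : (Fin k → ℂ) → ℂ) (p : Polynomial ℝ),
        IsMeromorphicFunction f ∧
          g = toGerm fun z x => f (firstCoords k z) * ((p.eval (x : ℝ) : ℝ) : ℂ)})

/-- The germ `g` depends on the space `W` of real linear forms: `g` is the germ of
`z ↦ τ(L₁(z), …, L_k(z))` for linear forms `Lᵢ` spanning `W` and a meromorphic germ of symbols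
`τ` on `ℂ^k`. The `Lᵢ` are taken linearly independent, so that `(L₁, …, L_k)` is onto and does
not map into the poles of `τ`. -/
def DependsOn (g : SGerm ℕ) (W : Submodule ℝ (ℕ →₀ ℝ)) : Prop :=
  ∃ (k : ℕ) (L : Fin k → (ℕ →₀ ℝ)) (τ : (Fin k → ℂ) → ℝ≥0 → ℂ),
    LinearIndependent ℝ L ∧ Submodule.span ℝ (Set.range L) = W ∧
    toGerm τ ∈ meromorphicGerms k ∧ g = toGerm fun z => τ fun i => realForm (L i) z

/-- The dependence subspace of `g`. -/
def Dep (g : SGerm ℕ) : Submodule ℝ (ℕ →₀ ℝ) := sInf {W | DependsOn g W}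

/-- Independence `g₁ ⊥^Q g₂` of admissible germs, for an inner product `Q` on the space of real
linear forms in `z₀, z₁, …`: the dependence subspaces are `Q`-orthogonal. -/
def Indep (Q : LinearMap.BilinForm ℝ (ℕ →₀ ℝ)) (g₁ g₂ : Omega) : Prop :=
  ∀ u ∈ Dep g₁.1, ∀ v ∈ Dep g₂.1, Q u v = 0

end LocalitySymbols

end

/-!
# The locality algebra of admissible meromorphic germs of symbols

Write `V` for the space of real linear forms. All the assertions rest on two facts about a germ `g`:
the subspaces of `V` on which it depends have a least element, and if `g` is admissible, then it is
admissible "in the variables of `Dep g`". Given these, let `g₁ ⊥ g₂` be admissible. Positivity of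
`Q` makes `Dep g₁` and `Dep g₂` independent subspaces, so both factors are linear combinations of
simple germs and polynomial germs in disjoint sets of variables; the order of a product of simple
germs is the sum of the orders, hence again nonconstant, and `g₁ g₂` is admissible
(`mul_mem_Omega`). The axioms of a locality algebra follow from
`Dep (g₁ + g₂), Dep (g₁ g₂) ≤ Dep g₁ ⊔ Dep g₂`.

*Families.* By Cauchy's estimates (`norm_iteratedFDeriv_le_of_norm_le`) the bounds on the
derivatives with respect to the parameter follow from those on the family itself, so simple
holomorphic families are described by the simpler `FamExpansion`. These are closed under products
(`FamExpansion.mul`) and under affine changes of the parameters. The restriction of a meromorphic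
family to an affine subspace makes sense if the subspace is contained in no polar hyperplane;
`Mero.restrict` provides this for the images of `affineSubst T (t • b)`, with `b` generic and
`t ≠ 0` small.

*Dependence.* If `g` depends on `W₁` and on `W₂`, then the restriction of `g` to a generic slice,
given by prescribing the forms in `W₁ ⊓ W₂` and displaced by a generic functional `b` vanishing on
`W₁ ⊓ W₂`, determines `g`. For a point `z` there is a `y` at which the forms in `W₁` take the values
they have at `z`, and the forms in `W₂` the values they have at the projection of `z` to the slice.
So `g` depends on `W₁ ⊓ W₂` (`DependsOn.inf`), and a subspace of dependence of minimal dimension is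
the least one (`isLeast_Dep`).

*Admissibility in the variables of `Dep g`* (`exists_formPullback_of_mem_Omega`). The restriction of
`g` to a slice transversal to `W = Dep g` does not depend on the slice, whose displacement is `t b`.
A summand of `g` of nonconstant order `L + c` restricts to a germ of nonconstant order, or to one of
constant order `c + t b(L)` with `b(L) ≠ 0`. So, for two values `t₀` and `t₁`, the part of constant
orders at `t₀` is a sum of germs of nonconstant orders, of constant orders at `t₁`, and of a
polynomial part. For suitable `t₀` and `t₁`, and at generic complex parameters, the exponents of `x`
in the asymptotic expansions of the two sides are disjoint: those on the left are real, neither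
integers nor congruent modulo `ℤ` to the constant orders at `t₁`, and those of the nonconstant
orders are not real. By uniqueness of asymptotic expansions in complex powers
(`HasExponents.isRapid`) the part of constant orders decreases rapidly at a dense set of parameters,
so that its coefficients vanish identically and it is smoothing (`HasConstExponents.isSmoothing`).
A smoothing family has every affine order, in particular a nonconstant one.
-/

noncomputable section

namespace LocalitySymbols

/-! ### Derivatives on the half line -/

lemma uniqueDiffOn_halfLine : UniqueDiffOn ℝ (Set.Ici (0 : ℝ)) := uniqueDiffOn_Ici 0

/-- Smoothness on the closed half line. -/
def IsSmooth (σ : ℝ≥0 → ℂ) : Prop := ContDiffOn ℝ ∞ (extend σ) (Set.Ici 0)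

lemma extend_coe (σ : ℝ≥0 → ℂ) (x : ℝ≥0) : extend σ (x : ℝ) = σ x := by simp [extend]

lemma IsSmooth.at_nat {σ : ℝ≥0 → ℂ} (h : IsSmooth σ) (n : ℕ) (x : ℝ≥0) :
    ContDiffWithinAt ℝ n (extend σ) (Set.Ici 0) (x : ℝ) :=
  (h (x : ℝ) x.2).of_le (by exact_mod_cast le_top)

lemma IsSmooth.add {σ τ : ℝ≥0 → ℂ} (hσ : IsSmooth σ) (hτ : IsSmooth τ) : IsSmooth (σ + τ) :=
  ContDiffOn.add hσ hτ

lemma IsSmooth.mul {σ τ : ℝ≥0 → ℂ} (hσ : IsSmooth σ) (hτ : IsSmooth τ) : IsSmooth (σ * τ) :=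
  ContDiffOn.mul hσ hτ

lemma isSmooth_const (c : ℂ) : IsSmooth (fun _ => c) := contDiffOn_const

lemma IsSmooth.const_mul {σ : ℝ≥0 → ℂ} (hσ : IsSmooth σ) (c : ℂ) :
    IsSmooth (fun x => c * σ x) := (isSmooth_const c).mul hσ

lemma xDeriv_zero (σ : ℝ≥0 → ℂ) (x : ℝ≥0) : xDeriv 0 σ x = σ x := by
  simp [xDeriv, extend_coe]

lemma xDeriv_add {σ τ : ℝ≥0 → ℂ} (hσ : IsSmooth σ) (hτ : IsSmooth τ) (m : ℕ) (x : ℝ≥0) :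
    xDeriv m (σ + τ) x = xDeriv m σ x + xDeriv m τ x :=
  iteratedDerivWithin_add (x := (x : ℝ)) x.2 uniqueDiffOn_halfLine (hσ.at_nat m x) (hτ.at_nat m x)

lemma xDeriv_const_mul (c : ℂ) (σ : ℝ≥0 → ℂ) (m : ℕ) (x : ℝ≥0) :
    xDeriv m (fun y => c * σ y) x = c * xDeriv m σ x :=
  iteratedDerivWithin_const_mul_field (x := (x : ℝ)) (s := Set.Ici 0) (n := m) c (extend σ)

lemma xDeriv_mul {σ τ : ℝ≥0 → ℂ} (hσ : IsSmooth σ) (hτ : IsSmooth τ) (m : ℕ) (x : ℝ≥0) :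
    xDeriv m (σ * τ) x = ∑ i ∈ Finset.range (m + 1),
      (m.choose i : ℂ) * xDeriv i σ x * xDeriv (m - i) τ x :=
  iteratedDerivWithin_mul (x := (x : ℝ)) x.2 uniqueDiffOn_halfLine (hσ.at_nat m x) (hτ.at_nat m x)

lemma xDeriv_congr_of_extend {σ : ℝ≥0 → ℂ} {g : ℝ → ℂ} (h : Set.EqOn (extend σ) g (Set.Ici 0))
    (m : ℕ) (x : ℝ≥0) : xDeriv m σ x = iteratedDerivWithin m g (Set.Ici 0) (x : ℝ) :=
  iteratedDerivWithin_congr h x.2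

lemma extend_xDeriv_one (σ : ℝ≥0 → ℂ) :
    Set.EqOn (extend (xDeriv 1 σ)) (derivWithin (extend σ) (Set.Ici 0)) (Set.Ici 0) := by
  intro t ht
  simp [extend, xDeriv, iteratedDerivWithin_one, Real.coe_toNNReal t ht]

lemma xDeriv_succ (σ : ℝ≥0 → ℂ) (m : ℕ) (x : ℝ≥0) :
    xDeriv (m + 1) σ x = xDeriv m (xDeriv 1 σ) x := by
  rw [xDeriv_congr_of_extend (extend_xDeriv_one σ), xDeriv, iteratedDerivWithin_succ']

lemma IsSmooth.xDeriv_one {σ : ℝ≥0 → ℂ} (h : IsSmooth σ) : IsSmooth (xDeriv 1 σ) := by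
  have h1 : ContDiffOn ℝ ∞ (derivWithin (extend σ) (Set.Ici 0)) (Set.Ici 0) :=
    ContDiffOn.derivWithin h uniqueDiffOn_halfLine (by simp)
  exact h1.congr (extend_xDeriv_one σ)

lemma hasDerivWithinAt_extend {σ : ℝ≥0 → ℂ} (h : IsSmooth σ) (x : ℝ≥0) :
    HasDerivWithinAt (extend σ) (xDeriv 1 σ x) (Set.Ici 0) (x : ℝ) := by
  have h1 : DifferentiableWithinAt ℝ (extend σ) (Set.Ici 0) (x : ℝ) :=
    (h.at_nat 1 x).differentiableWithinAt (by simp)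
  have h2 : extend (xDeriv 1 σ) x = derivWithin (extend σ) (Set.Ici 0) x := extend_xDeriv_one σ x.2
  rw [← extend_coe (xDeriv 1 σ), h2]
  exact h1.hasDerivWithinAt

/-- The derivative of a function that vanishes near zero vanishes there. -/
lemma xDeriv_one_eq_zero {σ : ℝ≥0 → ℂ} {δ : ℝ≥0} (h : ∀ x < δ, σ x = 0) :
    ∀ x < δ, xDeriv 1 σ x = 0 := by
  intro x hx
  have h0 : extend σ =ᶠ[𝓝[Set.Ici 0] (x : ℝ)] fun _ => 0 := by
    have : Set.Iio (δ : ℝ) ∈ 𝓝[Set.Ici 0] (x : ℝ) :=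
      mem_nhdsWithin_of_mem_nhds (Iio_mem_nhds (by exact_mod_cast hx))
    filter_upwards [this, self_mem_nhdsWithin] with t ht ht0
    refine h _ ?_
    rw [← NNReal.coe_lt_coe, Real.coe_toNNReal t ht0]
    exact ht
  rw [xDeriv, iteratedDerivWithin_one, h0.derivWithin_eq (by simpa [extend] using h x hx)]
  simp

/-! ### The Japanese bracket -/

lemma one_le_bracket (x : ℝ≥0) : 1 ≤ bracket x := by
  rw [bracket, Real.one_le_sqrt]; nlinarith [sq_nonneg (x : ℝ)]

lemma bracket_pos (x : ℝ≥0) : 0 < bracket x := lt_of_lt_of_le one_pos (one_le_bracket x)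

lemma bracket_rpow_pos (x : ℝ≥0) (r : ℝ) : 0 < bracket x ^ r := Real.rpow_pos_of_pos (bracket_pos x) r

lemma bracket_rpow_mono (x : ℝ≥0) {r s : ℝ} (h : r ≤ s) : bracket x ^ r ≤ bracket x ^ s :=
  Real.rpow_le_rpow_of_exponent_le (one_le_bracket x) h

lemma coe_le_bracket (x : ℝ≥0) : (x : ℝ) ≤ bracket x :=
  Real.le_sqrt_of_sq_le (by linarith)

lemma continuous_bracket : Continuous bracket := by
  unfold bracket; fun_prop

/-- Away from zero, powers of `x` and of its Japanese bracket are comparable. -/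
lemma rpow_le_bracket_rpow {δ : ℝ≥0} (hδ : 0 < δ) : ∃ A : ℝ, 1 ≤ A ∧ ∀ x ≥ δ, ∀ ρ R : ℝ, |ρ| ≤ R →
    (x : ℝ) ^ ρ ≤ A ^ R * bracket x ^ ρ := by
  have hδ' : (0 : ℝ) < δ := hδ
  refine ⟨bracket δ / δ, (one_le_div hδ').2 (coe_le_bracket δ), fun x hx ρ R hR => ?_⟩
  have hx' : (δ : ℝ) ≤ x := hx
  have hx0 : (0 : ℝ) < x := hδ'.trans_le hx'
  have hA : 1 ≤ bracket δ / δ := (one_le_div hδ').2 (coe_le_bracket δ)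
  have hle : bracket x ≤ bracket δ / δ * x := by
    rw [bracket, Real.sqrt_le_left (by positivity)]
    rw [mul_pow, div_pow, bracket, Real.sq_sqrt (by positivity), div_mul_eq_mul_div,
      le_div_iff₀ (by positivity)]
    nlinarith [mul_le_mul hx' hx' hδ'.le hx0.le]
  have hRρ : (bracket δ / δ) ^ |ρ| ≤ (bracket δ / δ) ^ R := Real.rpow_le_rpow_of_exponent_le hA hR
  refine le_trans ?_ (mul_le_mul_of_nonneg_right hRρ (bracket_rpow_pos x ρ).le)
  rcases le_total 0 ρ with h | h
  · calc (x : ℝ) ^ ρ ≤ bracket x ^ ρ := Real.rpow_le_rpow hx0.le (coe_le_bracket x) h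
      _ ≤ _ := le_mul_of_one_le_left (bracket_rpow_pos x ρ).le (Real.one_le_rpow hA (abs_nonneg _))
  · rw [abs_of_nonpos h, Real.rpow_neg (by positivity), ← div_eq_inv_mul,
      le_div_iff₀ (by positivity), mul_comm, ← Real.mul_rpow (by positivity) hx0.le]
    exact Real.rpow_le_rpow_of_nonpos (bracket_pos x) hle h

/-! ### Holomorphic families of symbols of variable order -/

/-- The family `F` of functions on `[0, ∞)` is a holomorphic family on `U` of symbols of order
`r`, up to an arbitrarily small loss in the order. Only the `x`-derivatives are estimated: the
`z`-derivatives are controlled by Cauchy's estimates. -/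
structure FamSymbol {E : Type*} [NormedAddCommGroup E] [NormedSpace ℂ E] (U : Set E) (r : E → ℝ)
    (F : E → ℝ≥0 → ℂ) : Prop where
  smooth : ∀ z ∈ U, IsSmooth (F z)
  holo : ∀ m x, DifferentiableOn ℂ (fun z => xDeriv m (F z) x) U
  bound : ∀ m : ℕ, ∀ z₀ ∈ U, ∀ ε > (0 : ℝ), ∃ C, ∀ᶠ z in 𝓝[U] z₀, ∀ x,
    ‖xDeriv m (F z) x‖ ≤ C * bracket x ^ (r z₀ - m + ε)

namespace FamSymbol

variable {E : Type*} [NormedAddCommGroup E] [NormedSpace ℂ E] {U : Set E} {r r' : E → ℝ}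
  {F G : E → ℝ≥0 → ℂ}

lemma congr (h : FamSymbol U r F) (hFG : ∀ z ∈ U, F z = G z) : FamSymbol U r G where
  smooth z hz := hFG z hz ▸ h.smooth z hz
  holo m x := (h.holo m x).congr fun z hz => by rw [hFG z hz]
  bound m z₀ hz₀ ε hε := by
    obtain ⟨C, hC⟩ := h.bound m z₀ hz₀ ε hε
    refine ⟨C, ?_⟩
    filter_upwards [hC, self_mem_nhdsWithin] with z hz hzU
    rwa [← hFG z hzU]

lemma mono_set {V : Set E} (h : FamSymbol U r F) (hV : V ⊆ U) : FamSymbol V r F where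
  smooth z hz := h.smooth z (hV hz)
  holo m x := (h.holo m x).mono hV
  bound m z₀ hz₀ ε hε := by
    obtain ⟨C, hC⟩ := h.bound m z₀ (hV hz₀) ε hε
    exact ⟨C, hC.filter_mono (nhdsWithin_mono _ hV)⟩

lemma bound' (h : FamSymbol U r F) (m : ℕ) {z₀ : E} (hz₀ : z₀ ∈ U) {ε : ℝ} (hε : 0 < ε) :
    ∃ C, 0 < C ∧ ∀ᶠ z in 𝓝[U] z₀, ∀ x,
      ‖xDeriv m (F z) x‖ ≤ C * bracket x ^ (r z₀ - m + ε) := by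
  obtain ⟨C, hC⟩ := h.bound m z₀ hz₀ ε hε
  refine ⟨max C 1, by positivity, ?_⟩
  filter_upwards [hC] with z hz x
  exact (hz x).trans (mul_le_mul_of_nonneg_right (le_max_left _ _) (bracket_rpow_pos _ _).le)

lemma mono (h : FamSymbol U r F) (hr : ∀ z ∈ U, r z ≤ r' z) : FamSymbol U r' F where
  smooth := h.smooth
  holo := h.holo
  bound m z₀ hz₀ ε hε := by
    obtain ⟨C, hC0, hC⟩ := h.bound' m hz₀ hε
    refine ⟨C, ?_⟩
    filter_upwards [hC] with z hz x
    refine (hz x).trans (mul_le_mul_of_nonneg_left (bracket_rpow_mono x ?_) hC0.le)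
    have := hr z₀ hz₀
    linarith

lemma add (hF : FamSymbol U r F) (hG : FamSymbol U r G) : FamSymbol U r (F + G) where
  smooth z hz := (hF.smooth z hz).add (hG.smooth z hz)
  holo m x := ((hF.holo m x).add (hG.holo m x)).congr fun z hz =>
    xDeriv_add (hF.smooth z hz) (hG.smooth z hz) m x
  bound m z₀ hz₀ ε hε := by
    obtain ⟨C, hC⟩ := hF.bound m z₀ hz₀ ε hε
    obtain ⟨D, hD⟩ := hG.bound m z₀ hz₀ ε hε
    refine ⟨C + D, ?_⟩
    filter_upwards [hC, hD, self_mem_nhdsWithin] with z hz hz' hzU x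
    rw [Pi.add_apply, xDeriv_add (hF.smooth z hzU) (hG.smooth z hzU), add_mul]
    exact (norm_add_le _ _).trans (add_le_add (hz x) (hz' x))

lemma mul (hF : FamSymbol U r F) (hG : FamSymbol U r' G) : FamSymbol U (r + r') (F * G) where
  smooth z hz := (hF.smooth z hz).mul (hG.smooth z hz)
  holo m x := by
    have : DifferentiableOn ℂ (fun z => ∑ i ∈ Finset.range (m + 1),
        (m.choose i : ℂ) * xDeriv i (F z) x * xDeriv (m - i) (G z) x) U :=
      DifferentiableOn.fun_sum fun i _ =>
        ((hF.holo i x).const_mul _).mul (hG.holo (m - i) x)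
    exact this.congr fun z hz => xDeriv_mul (hF.smooth z hz) (hG.smooth z hz) m x
  bound m z₀ hz₀ ε hε := by
    choose C hC0 hC using fun i => hF.bound' i hz₀ (half_pos hε)
    choose D hD0 hD using fun i => hG.bound' i hz₀ (half_pos hε)
    refine ⟨∑ i ∈ Finset.range (m + 1), (m.choose i : ℝ) * C i * D (m - i), ?_⟩
    have hC' : ∀ᶠ z in 𝓝[U] z₀, ∀ i ∈ Finset.range (m + 1), ∀ x,
        ‖xDeriv i (F z) x‖ ≤ C i * bracket x ^ (r z₀ - i + ε / 2) :=
      (Filter.eventually_all_finset _).2 fun i _ => hC i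
    have hD' : ∀ᶠ z in 𝓝[U] z₀, ∀ i ∈ Finset.range (m + 1), ∀ x,
        ‖xDeriv (m - i) (G z) x‖ ≤ D (m - i) * bracket x ^ (r' z₀ - (m - i : ℕ) + ε / 2) :=
      (Filter.eventually_all_finset _).2 fun i _ => hD (m - i)
    filter_upwards [hC', hD', self_mem_nhdsWithin] with z hz hz' hzU x
    rw [Pi.mul_apply, xDeriv_mul (hF.smooth z hzU) (hG.smooth z hzU), Finset.sum_mul]
    refine (norm_sum_le _ _).trans (Finset.sum_le_sum fun i hi => ?_)
    have him : i ≤ m := Nat.lt_succ_iff.1 (Finset.mem_range.1 hi)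
    have hexp : bracket x ^ ((r + r') z₀ - m + ε) =
        bracket x ^ (r z₀ - i + ε / 2) * bracket x ^ (r' z₀ - (m - i : ℕ) + ε / 2) := by
      rw [← Real.rpow_add (bracket_pos x), Nat.cast_sub him, Pi.add_apply]
      congr 1; ring
    rw [norm_mul, norm_mul, Complex.norm_natCast, hexp]
    calc (m.choose i : ℝ) * ‖xDeriv i (F z) x‖ * ‖xDeriv (m - i) (G z) x‖
        ≤ (m.choose i : ℝ) * (C i * bracket x ^ (r z₀ - i + ε / 2)) *
          (D (m - i) * bracket x ^ (r' z₀ - (m - i : ℕ) + ε / 2)) :=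
          mul_le_mul (mul_le_mul_of_nonneg_left (hz i hi x) (by positivity)) (hz' i hi x)
            (norm_nonneg _) (mul_nonneg (by positivity)
              (mul_nonneg (hC0 i).le (bracket_rpow_pos _ _).le))
      _ = _ := by ring

/-- Multiplication by a holomorphic function of the parameter preserves the order. -/
lemma smul_holo (hF : FamSymbol U r F) {h : E → ℂ} (hh : DifferentiableOn ℂ h U) :
    FamSymbol U r (fun z x => h z * F z x) where
  smooth z hz := (hF.smooth z hz).const_mul _
  holo m x := (hh.mul (hF.holo m x)).congr fun z _ => xDeriv_const_mul (h z) (F z) m x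
  bound m z₀ hz₀ ε hε := by
    obtain ⟨C, hC0, hC⟩ := hF.bound' m hz₀ hε
    refine ⟨(‖h z₀‖ + 1) * C, ?_⟩
    have hb : ∀ᶠ z in 𝓝[U] z₀, ‖h z‖ < ‖h z₀‖ + 1 :=
      (hh z₀ hz₀).continuousWithinAt.norm.eventually (gt_mem_nhds (lt_add_one _))
    filter_upwards [hC, hb] with z hz hz' x
    rw [xDeriv_const_mul, norm_mul, mul_assoc]
    exact mul_le_mul hz'.le (hz x) (norm_nonneg _) (by positivity)

lemma neg (hF : FamSymbol U r F) : FamSymbol U r (-F) :=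
  (hF.smul_holo (h := fun _ => -1) (differentiableOn_const _)).congr fun z _ => by
    funext x; simp

lemma sub (hF : FamSymbol U r F) (hG : FamSymbol U r G) : FamSymbol U r (F - G) := by
  rw [sub_eq_add_neg]; exact hF.add hG.neg

lemma zero : FamSymbol U r (fun _ _ => 0) where
  smooth _ _ := isSmooth_const 0
  holo m x := differentiableOn_const _
  bound m z₀ hz₀ ε hε := by
    refine ⟨0, Filter.Eventually.of_forall fun z x => ?_⟩
    have := xDeriv_const_mul 0 (fun _ => 0) m x
    simp only [zero_mul] at this
    rw [this]; simp

lemma sum {ι : Type*} {s : Finset ι} {H : ι → E → ℝ≥0 → ℂ}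
    (h : ∀ i ∈ s, FamSymbol U r (H i)) : FamSymbol U r (fun z x => ∑ i ∈ s, H i z x) := by
  classical
  induction s using Finset.induction_on with
  | empty => simpa using zero
  | insert i s hi ih =>
    refine ((h i (Finset.mem_insert_self _ _)).add
      (ih fun j hj => h j (Finset.mem_insert_of_mem hj))).congr fun z _ => ?_
    funext x; simp [Finset.sum_insert hi]

/-- Each member of a family of order `r` is a symbol of every larger order. -/
lemma isSymbol (hF : FamSymbol U r F) {z : E} (hz : z ∈ U) {s : ℝ} (hs : r z < s) :
    IsSymbol s (F z) := by
  refine ⟨hF.smooth z hz, fun m => ?_⟩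
  obtain ⟨C, hC0, hC⟩ := hF.bound' m hz (sub_pos.2 hs)
  refine ⟨C, hC0, fun x => ?_⟩
  have := (mem_of_mem_nhdsWithin hz hC : _) x
  rwa [show r z - m + (s - r z) = s - m by ring] at this

/-- A single symbol is a constant family. -/
lemma of_isSymbol {s : ℝ} {η : ℝ≥0 → ℂ} (h : IsSymbol s η) :
    FamSymbol U (fun _ => s) (fun _ => η) where
  smooth _ _ := h.1
  holo _ _ := differentiableOn_const _
  bound m z₀ _ ε hε := by
    obtain ⟨D, hD0, hD⟩ := h.2 m
    refine ⟨D, Filter.Eventually.of_forall fun z x => (hD x).trans ?_⟩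
    exact mul_le_mul_of_nonneg_left (bracket_rpow_mono x (by linarith)) hD0.le

/-- Pull-back of families of symbols along holomorphic maps of the parameter. -/
lemma comp {E' : Type*} [NormedAddCommGroup E'] [NormedSpace ℂ E'] {V : Set E'} {φ : E' → E}
    (hF : FamSymbol U r F) (hφ : DifferentiableOn ℂ φ V) (hm : Set.MapsTo φ V U) :
    FamSymbol V (r ∘ φ) (F ∘ φ) where
  smooth z hz := hF.smooth _ (hm hz)
  holo m x := (hF.holo m x).comp hφ hm
  bound m z₀ hz₀ ε hε := by
    obtain ⟨C, hC⟩ := hF.bound m _ (hm hz₀) ε hε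
    exact ⟨C, ((hφ z₀ hz₀).continuousWithinAt.tendsto_nhdsWithin hm).eventually hC⟩

end FamSymbol

/-! ### Powers cut off at zero -/

lemma IsSymbol.xDeriv_one {s : ℝ} {η : ℝ≥0 → ℂ} (h : IsSymbol s η) :
    IsSymbol (s - 1) (xDeriv 1 η) := by
  refine ⟨IsSmooth.xDeriv_one h.1, fun m => ?_⟩
  obtain ⟨D, hD0, hD⟩ := h.2 (m + 1)
  refine ⟨D, hD0, fun x => ?_⟩
  rw [← xDeriv_succ]
  convert hD x using 3
  push_cast; ring

/-- The product of a cut-off `η` with the complex power `x ^ a`. -/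
def cutPow (η : ℝ≥0 → ℂ) (a : ℂ) : ℝ≥0 → ℂ := fun x => η x * ((x : ℝ) : ℂ) ^ a

section cutPow

variable {η : ℝ≥0 → ℂ} {δ : ℝ≥0}

lemma cutPow_eq_zero (hη : ∀ x < δ, η x = 0) (a : ℂ) : ∀ x < δ, cutPow η a x = 0 := by
  intro x hx; simp [cutPow, hη x hx]

lemma contDiffAt_ofReal_cpow (a : ℂ) {t : ℝ} (ht : 0 < t) :
    ContDiffAt ℝ ∞ (fun t : ℝ => (t : ℂ) ^ a) t := by
  have h1 : ContDiffAt ℝ ∞ (fun t : ℝ => Complex.exp ((Real.log t : ℂ) * a)) t := by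
    have h2 : ContDiffAt ℝ ∞ (fun t : ℝ => (Real.log t : ℂ)) t :=
      Complex.ofRealCLM.contDiff.contDiffAt.comp t (Real.contDiffAt_log.2 ht.ne')
    exact (h2.mul contDiffAt_const).cexp
  refine h1.congr_of_eventuallyEq ?_
  filter_upwards [lt_mem_nhds ht] with u hu
  rw [Complex.cpow_def_of_ne_zero (by exact_mod_cast hu.ne'), Complex.ofReal_log hu.le]

lemma extend_cutPow (η : ℝ≥0 → ℂ) (a : ℂ) {t : ℝ} (ht : 0 ≤ t) :
    extend (cutPow η a) t = extend η t * (t : ℂ) ^ a := by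
  simp [extend, cutPow, Real.coe_toNNReal t ht]

lemma isSmooth_cutPow (hs : IsSmooth η) (hδ : 0 < δ) (hη : ∀ x < δ, η x = 0) (a : ℂ) :
    IsSmooth (cutPow η a) := by
  intro t ht
  rcases (show (0 : ℝ) ≤ t from ht).eq_or_lt with rfl | ht0
  · have h0 : extend (cutPow η a) =ᶠ[𝓝[Set.Ici 0] (0 : ℝ)] fun _ => 0 := by
      have : Set.Iio (δ : ℝ) ∈ 𝓝[Set.Ici 0] (0 : ℝ) :=
        mem_nhdsWithin_of_mem_nhds (Iio_mem_nhds (by exact_mod_cast hδ))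
      filter_upwards [this, self_mem_nhdsWithin] with u hu hu0
      refine cutPow_eq_zero hη a _ ?_
      rw [← NNReal.coe_lt_coe, Real.coe_toNNReal u hu0]
      exact hu
    exact contDiffWithinAt_const.congr_of_eventuallyEq h0 (h0.self_of_nhdsWithin ht)
  · refine ((hs t ht).mul (contDiffAt_ofReal_cpow a ht0).contDiffWithinAt).congr
      (fun u hu => extend_cutPow η a hu) (extend_cutPow η a ht)

lemma xDeriv_one_cutPow (hs : IsSmooth η) (hδ : 0 < δ) (hη : ∀ x < δ, η x = 0) (a : ℂ) :
    xDeriv 1 (cutPow η a) =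
      fun x => cutPow (xDeriv 1 η) a x + a * cutPow η (a - 1) x := by
  funext x
  rcases lt_or_ge x δ with hx | hx
  · rw [xDeriv_one_eq_zero (cutPow_eq_zero hη a) x hx, cutPow_eq_zero (xDeriv_one_eq_zero hη) a x hx,
      cutPow_eq_zero hη (a - 1) x hx]
    simp
  · have hx0 : (0 : ℝ) < x := lt_of_lt_of_le (by exact_mod_cast hδ) (show (δ : ℝ) ≤ x from hx)
    have h1 := hasDerivWithinAt_extend (isSmooth_cutPow hs hδ hη a) x
    have h2 : HasDerivAt (fun t : ℝ => (t : ℂ) ^ a) (a * ((x : ℝ) : ℂ) ^ (a - 1)) (x : ℝ) := by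
      have h3 : HasDerivAt (fun t : ℂ => t ^ a) (a * ((x : ℝ) : ℂ) ^ (a - 1)) ((x : ℝ) : ℂ) := by
        simpa using (hasDerivAt_id ((x : ℝ) : ℂ)).cpow_const (c := a)
          (by simp [Complex.slitPlane, hx0])
      exact h3.comp_ofReal
    have h4 := ((hasDerivWithinAt_extend hs x).mul h2.hasDerivWithinAt).congr
      (fun u hu => extend_cutPow η a hu) (extend_cutPow η a x.2)
    rw [(uniqueDiffOn_halfLine (x : ℝ) x.2).eq_deriv _ h1 h4, extend_coe]
    simp only [cutPow]
    ring

variable {E : Type*} [NormedAddCommGroup E] [NormedSpace ℂ E] {U : Set E}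

lemma xDeriv_cutPow_succ (hs : IsSmooth η) (hδ : 0 < δ) (hη : ∀ x < δ, η x = 0) (a : ℂ) (m : ℕ)
    (x : ℝ≥0) : xDeriv (m + 1) (cutPow η a) x =
      xDeriv m (cutPow (xDeriv 1 η) a) x + a * xDeriv m (cutPow η (a - 1)) x := by
  rw [xDeriv_succ, xDeriv_one_cutPow hs hδ hη, ← xDeriv_const_mul]
  exact xDeriv_add (isSmooth_cutPow hs.xDeriv_one hδ (xDeriv_one_eq_zero hη) a)
    ((isSmooth_cutPow hs hδ hη (a - 1)).const_mul a) m x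

lemma differentiableOn_xDeriv_cutPow (hδ : 0 < δ) (m : ℕ) :
    ∀ {η : ℝ≥0 → ℂ} (_ : IsSmooth η) (_ : ∀ x < δ, η x = 0) {α : E → ℂ}
      (_ : DifferentiableOn ℂ α U) (x : ℝ≥0),
      DifferentiableOn ℂ (fun z => xDeriv m (cutPow η (α z)) x) U := by
  induction m with
  | zero =>
    intro η hs hη α hα x
    simp only [xDeriv_zero, cutPow]
    rcases lt_or_ge x δ with hx | hx
    · simp [hη x hx, differentiableOn_const]
    · have hx0 : ((x : ℝ) : ℂ) ≠ 0 := by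
        have : x ≠ 0 := (hδ.trans_le hx).ne'
        exact_mod_cast this
      exact (hα.const_cpow (Or.inl hx0)).const_mul _
  | succ m ih =>
    intro η hs hη α hα x
    simp only [xDeriv_cutPow_succ hs hδ hη]
    exact (ih hs.xDeriv_one (xDeriv_one_eq_zero hη) hα x).add
      (hα.mul (ih hs hη (hα.sub_const 1) x))

lemma bound_xDeriv_cutPow (hδ : 0 < δ) {z₀ : E} (hz₀ : z₀ ∈ U) {ε : ℝ} (m : ℕ) :
    ∀ {η : ℝ≥0 → ℂ} {s : ℝ} (_ : IsSymbol s η) (_ : ∀ x < δ, η x = 0) {α : E → ℂ}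
      (_ : DifferentiableOn ℂ α U) (_ : ∀ᶠ z in 𝓝[U] z₀, |(α z).re - (α z₀).re| ≤ ε),
      ∃ C, ∀ᶠ z in 𝓝[U] z₀, ∀ x,
        ‖xDeriv m (cutPow η (α z)) x‖ ≤ C * bracket x ^ (s + (α z₀).re - m + ε) := by
  induction m with
  | zero =>
    intro η s hs hη α hα hnear
    obtain ⟨D, hD0, hD⟩ := hs.2 0
    obtain ⟨A, hA1, hA⟩ := rpow_le_bracket_rpow hδ
    refine ⟨D * A ^ (|(α z₀).re| + ε), ?_⟩
    filter_upwards [hnear] with z hz x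
    rw [xDeriv_zero]
    rcases lt_or_ge x δ with hx | hx
    · rw [cutPow_eq_zero hη _ x hx, norm_zero]
      exact mul_nonneg (mul_nonneg hD0.le (Real.rpow_nonneg (by linarith) _))
        (bracket_rpow_pos _ _).le
    · have hx0 : (0 : ℝ) < x := lt_of_lt_of_le (by exact_mod_cast hδ) (show (δ : ℝ) ≤ x from hx)
      have h1 := hD x
      rw [xDeriv_zero] at h1
      have h2 := hA x hx (α z).re (|(α z₀).re| + ε) (by
        have := abs_sub_abs_le_abs_sub (α z).re (α z₀).re; linarith)
      rw [cutPow, norm_mul, Complex.norm_cpow_eq_rpow_re_of_pos hx0]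
      calc ‖η x‖ * (x : ℝ) ^ (α z).re
          ≤ (D * bracket x ^ (s - (0 : ℕ))) *
            (A ^ (|(α z₀).re| + ε) * bracket x ^ (α z).re) :=
            mul_le_mul h1 h2 (Real.rpow_nonneg hx0.le _)
              (mul_nonneg hD0.le (bracket_rpow_pos _ _).le)
        _ = D * A ^ (|(α z₀).re| + ε) * bracket x ^ (s + (α z).re) := by
            rw [Real.rpow_add (bracket_pos x)]; simp; ring
        _ ≤ _ := by
            refine mul_le_mul_of_nonneg_left (bracket_rpow_mono x ?_)
              (mul_nonneg hD0.le (Real.rpow_nonneg (by linarith) _))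
            have := (abs_le.1 hz).2
            simp; linarith
  | succ m ih =>
    intro η s hs hη α hα hnear
    obtain ⟨C, hC⟩ := ih hs.xDeriv_one (xDeriv_one_eq_zero hη) hα hnear
    obtain ⟨D, hD⟩ := ih hs hη (hα.sub_const 1) (by simpa using hnear)
    refine ⟨C + (‖α z₀‖ + 1) * D, ?_⟩
    have hb : ∀ᶠ z in 𝓝[U] z₀, ‖α z‖ < ‖α z₀‖ + 1 :=
      (hα z₀ hz₀).continuousWithinAt.norm.eventually (gt_mem_nhds (lt_add_one _))
    filter_upwards [hC, hD, hb] with z h1 h2 h3 x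
    rw [xDeriv_cutPow_succ hs.1 hδ hη, add_mul, mul_assoc]
    refine (norm_add_le _ _).trans (add_le_add ?_ ?_)
    · rw [show s + (α z₀).re - (m + 1 : ℕ) + ε = s - 1 + (α z₀).re - m + ε by push_cast; ring]
      exact h1 x
    · rw [norm_mul]
      refine mul_le_mul h3.le ?_ (norm_nonneg _) (by positivity)
      rw [show s + (α z₀).re - (m + 1 : ℕ) + ε = s + (α z₀ - 1).re - m + ε by
        push_cast; rw [Complex.sub_re, Complex.one_re]; ring]
      exact h2 x

/-- A cut-off symbol of order `s` times `x ^ α(z)` is a family of symbols of order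
`s + Re α(z)`. -/
lemma famSymbol_cutPow (hδ : 0 < δ) (hη : ∀ x < δ, η x = 0) {s : ℝ} (hs : IsSymbol s η)
    {α : E → ℂ} (hα : DifferentiableOn ℂ α U) :
    FamSymbol U (fun z => s + (α z).re) (fun z => cutPow η (α z)) where
  smooth _ _ := isSmooth_cutPow hs.1 hδ hη _
  holo m x := differentiableOn_xDeriv_cutPow hδ m hs.1 hη hα x
  bound m z₀ hz₀ ε hε := by
    have hcont : ContinuousWithinAt (fun z => (α z).re) U z₀ :=
      Complex.continuous_re.continuousAt.comp_continuousWithinAt (hα z₀ hz₀).continuousWithinAt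
    refine bound_xDeriv_cutPow hδ hz₀ m hs hη hα ?_
    filter_upwards [(Metric.tendsto_nhds.1 hcont) ε hε] with z hz using le_of_lt hz

/-- For a fixed exponent there is no loss in the order. -/
lemma isSymbol_cutPow (hδ : 0 < δ) (hη : ∀ x < δ, η x = 0) {s : ℝ} (hs : IsSymbol s η) (a : ℂ) :
    IsSymbol (s + a.re) (cutPow η a) := by
  refine ⟨isSmooth_cutPow hs.1 hδ hη _, fun m => ?_⟩
  obtain ⟨C, hC⟩ := bound_xDeriv_cutPow (E := ℂ) (U := Set.univ) (z₀ := 0) (ε := 0) hδ trivial m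
    hs hη (differentiableOn_const (c := a)) (by simp)
  rw [nhdsWithin_univ] at hC
  refine ⟨max C 1, by positivity, fun x => (hC.self_of_nhds x).trans ?_⟩
  rw [add_zero]
  exact mul_le_mul_of_nonneg_right (le_max_left _ _) (bracket_rpow_pos _ _).le

end cutPow

/-! ### Cauchy's estimates in several variables -/

section Cauchy

open Metric

variable {k : ℕ} {F : Type*} [NormedAddCommGroup F] [NormedSpace ℂ F]
  {U : Set (Fin k → ℂ)} {f : (Fin k → ℂ) → F}

/-- Cauchy's formula for a directional derivative. -/
lemma fderiv_apply_eq_circleIntegral [CompleteSpace F] (hf : DifferentiableOn ℂ f U)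
    (hU : IsOpen U)
    {z v : Fin k → ℂ} {r : ℝ} (hr : 0 < r) (hz : ∀ t : ℂ, ‖t‖ ≤ r → z + t • v ∈ U) :
    fderiv ℂ f z v = (2 * Real.pi * Complex.I : ℂ)⁻¹ •
      ∮ t in C(0, r), ((t - 0) ^ 2)⁻¹ • f (z + t • v) := by
  have hcont : Continuous fun t : ℂ => z + t • v := by fun_prop
  have hd : DifferentiableOn ℂ (fun t : ℂ => f (z + t • v)) ((fun t : ℂ => z + t • v) ⁻¹' U) := by
    refine hf.comp ?_ (Set.mapsTo_preimage _ _)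
    fun_prop
  rw [Complex.two_pi_I_inv_smul_circleIntegral_sub_sq_inv_smul_of_differentiable
    (hU.preimage hcont) (fun t ht => hz t (by simpa using ht)) hd (mem_ball_self hr)]
  have h0 : z ∈ U := by simpa using hz 0 (by simpa using hr.le)
  have h1 : HasFDerivAt f (fderiv ℂ f z) (z + (0 : ℂ) • v) := by
    simpa using (hf.differentiableAt (hU.mem_nhds h0)).hasFDerivAt
  have h2 : HasDerivAt (fun t : ℂ => z + t • v) v 0 := by
    simpa using ((hasDerivAt_id (0 : ℂ)).smul_const v).const_add z
  exact (h1.comp_hasDerivAt (0 : ℂ) h2).deriv.symm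

/-- Cauchy's estimate for the Fréchet derivative. -/
lemma norm_fderiv_le_of_norm_le {z : Fin k → ℂ} {δ M : ℝ} (hδ : 0 < δ)
    (hf : DifferentiableOn ℂ f (ball z δ)) (hM : ∀ w ∈ ball z δ, ‖f w‖ ≤ M) :
    ‖fderiv ℂ f z‖ ≤ 2 * M / δ := by
  refine Complex.norm_fderiv_le_div_of_mapsTo_ball hf (fun w hw => ?_) hδ
  rw [mem_closedBall, dist_eq_norm]
  refine (norm_sub_le _ _).trans ?_
  linarith [hM w hw, hM z (mem_ball_self hδ)]

/-- The Fréchet derivative of a holomorphic function of several variables is holomorphic: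
differentiate Cauchy's formula under the integral. -/
lemma differentiableOn_fderiv [FiniteDimensional ℂ F] (hU : IsOpen U)
    (hf : DifferentiableOn ℂ f U) :
    DifferentiableOn ℂ (fderiv ℂ f) U := by
  have : CompleteSpace F := FiniteDimensional.complete ℂ F
  have : ProperSpace ((Fin k → ℂ) →L[ℂ] F) := FiniteDimensional.proper ℂ _
  rw [← (ContinuousLinearEquiv.piRing (𝕜 := ℂ) (E := F) (Fin k)).comp_differentiableOn_iff,
    differentiableOn_pi]
  intro i
  set v : Fin k → ℂ := Pi.single i 1 with hv
  have hv1 : ‖v‖ = 1 := by rw [hv, Pi.norm_single, norm_one]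
  suffices h : DifferentiableOn ℂ (fun z => fderiv ℂ f z v) U from h
  intro z₀ hz₀
  obtain ⟨R, hR, hRU⟩ := Metric.isOpen_iff.1 hU z₀ hz₀
  set ρ := R / 4 with hρ
  have hρ0 : 0 < ρ := by positivity
  have hsub : closedBall z₀ (3 * ρ) ⊆ U :=
    (closedBall_subset_ball (by linarith)).trans hRU
  obtain ⟨M, hM⟩ := (isCompact_closedBall z₀ (3 * ρ)).exists_bound_of_continuousOn
    (hf.continuousOn.mono hsub)
  have hder : ∀ w ∈ closedBall z₀ (2 * ρ), ‖fderiv ℂ f w‖ ≤ 2 * M / ρ := by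
    intro w hw
    have hw' : ball w ρ ⊆ closedBall z₀ (3 * ρ) := by
      intro y hy
      have := dist_triangle y w z₀
      rw [mem_ball] at hy; rw [mem_closedBall] at hw ⊢
      linarith
    exact norm_fderiv_le_of_norm_le hρ0 (hf.mono (hw'.trans hsub)) fun y hy => hM y (hw' hy)
  have hmem : ∀ z ∈ ball z₀ ρ, ∀ t : ℂ, ‖t‖ ≤ ρ → z + t • v ∈ closedBall z₀ (2 * ρ) := by
    intro z hz t ht
    rw [mem_ball, dist_eq_norm] at hz
    rw [mem_closedBall, dist_eq_norm, add_sub_right_comm]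
    refine (norm_add_le _ _).trans ?_
    rw [norm_smul, hv1]; linarith
  have hsub2 : closedBall z₀ (2 * ρ) ⊆ U := (closedBall_subset_closedBall (by linarith)).trans hsub
  set c : ℝ → ℂ := fun θ => (2 * Real.pi * Complex.I : ℂ)⁻¹ *
    (deriv (circleMap 0 ρ) θ * ((circleMap 0 ρ θ - 0) ^ 2)⁻¹) with hc
  have hcm : ∀ θ, circleMap 0 ρ θ ≠ 0 := fun θ => circleMap_ne_center hρ0.ne'
  have hcc : Continuous c := by
    have h1 : Continuous fun θ => ((circleMap 0 ρ θ - 0) ^ 2)⁻¹ :=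
      Continuous.inv₀ (by fun_prop) fun θ => by simpa using hcm θ
    have h2 : Continuous fun θ => deriv (circleMap 0 ρ) θ := by
      simp only [deriv_circleMap]; fun_prop
    exact continuous_const.mul (h2.mul h1)
  have hrep : ∀ z ∈ ball z₀ ρ, fderiv ℂ f z v =
      ∫ θ in (0 : ℝ)..2 * Real.pi, c θ • f (z + circleMap 0 ρ θ • v) := by
    intro z hz
    rw [fderiv_apply_eq_circleIntegral hf hU hρ0 fun t ht => hsub2 (hmem z hz t ht), circleIntegral,
      ← intervalIntegral.integral_smul]
    simp only [hc, smul_smul]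
  have hnorm : ∀ θ, ‖circleMap 0 ρ θ‖ ≤ ρ := fun θ => by simp [abs_of_pos hρ0]
  have hFc : ∀ z ∈ ball z₀ ρ, Continuous fun θ => c θ • f (z + circleMap 0 ρ θ • v) := by
    intro z hz
    refine hcc.smul ?_
    refine hf.continuousOn.comp_continuous (by fun_prop) fun θ => hsub2 (hmem z hz _ (hnorm θ))
  borelize (Fin k → ℂ)
  have key : HasFDerivAt (fun z => ∫ θ in (0 : ℝ)..2 * Real.pi, c θ • f (z + circleMap 0 ρ θ • v))
      (∫ θ in (0 : ℝ)..2 * Real.pi, c θ • fderiv ℂ f (z₀ + circleMap 0 ρ θ • v)) z₀ := by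
    refine intervalIntegral.hasFDerivAt_integral_of_dominated_of_fderiv_le
      (F' := fun z θ => c θ • fderiv ℂ f (z + circleMap 0 ρ θ • v))
      (bound := fun θ => ‖c θ‖ * (2 * M / ρ))
      (ball_mem_nhds z₀ hρ0) ?_ ?_ ?_ ?_ ?_ ?_
    · filter_upwards [ball_mem_nhds z₀ hρ0] with z hz
      exact (hFc z hz).aestronglyMeasurable
    · exact (hFc z₀ (mem_ball_self hρ0)).intervalIntegrable _ _
    · borelize ((Fin k → ℂ) →L[ℂ] F)
      refine hcc.aestronglyMeasurable.smul (Measurable.aestronglyMeasurable ?_)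
      exact (measurable_fderiv ℂ f).comp (by fun_prop)
    · refine Filter.Eventually.of_forall fun θ _ z hz => ?_
      rw [norm_smul]
      exact mul_le_mul_of_nonneg_left (hder _ (hmem z hz _ (hnorm θ))) (norm_nonneg _)
    · exact (hcc.norm.mul continuous_const).intervalIntegrable _ _
    · refine Filter.Eventually.of_forall fun θ _ z hz => ?_
      have h1 := (hf.differentiableAt (hU.mem_nhds (hsub2 (hmem z hz _ (hnorm θ))))).hasFDerivAt
      have h2 : HasFDerivAt (fun z => z + circleMap 0 ρ θ • v)
        (ContinuousLinearMap.id ℂ (Fin k → ℂ)) z := (hasFDerivAt_id z).add_const _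
      exact (h1.comp z h2).const_smul (c θ)
  have := key.differentiableAt.congr_of_eventuallyEq
    (Filter.eventually_of_mem (ball_mem_nhds z₀ hρ0) hrep)
  exact this.differentiableWithinAt

/-- Cauchy's estimates for all derivatives: they are controlled by the supremum on a ball. -/
lemma norm_iteratedFDeriv_le_of_norm_le (n : ℕ) :
    ∀ {F : Type} [NormedAddCommGroup F] [NormedSpace ℂ F] [FiniteDimensional ℂ F]
      {f : (Fin k → ℂ) → F} {z : Fin k → ℂ} {δ M : ℝ}, 0 < δ → DifferentiableOn ℂ f (ball z δ) →
      (∀ w ∈ ball z δ, ‖f w‖ ≤ M) →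
      ‖iteratedFDeriv ℂ n f z‖ ≤ (∏ i ∈ Finset.range n, 2 * (2 / δ) * 2 ^ i) * M := by
  induction n with
  | zero =>
    intro F _ _ _ f z δ M hδ hf hM
    simpa using hM z (mem_ball_self hδ)
  | succ n ih =>
    intro F _ _ _ f z δ M hδ hf hM
    have h1 : ∀ w ∈ ball z (δ / 2), ‖fderiv ℂ f w‖ ≤ 2 * M / (δ / 2) := by
      intro w hw
      have hw' : ball w (δ / 2) ⊆ ball z δ := by
        refine ball_subset_ball' ?_
        rw [mem_ball] at hw; linarith
      exact norm_fderiv_le_of_norm_le (half_pos hδ) (hf.mono hw') fun y hy => hM y (hw' hy)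
    have h2 := ih (half_pos hδ) ((differentiableOn_fderiv isOpen_ball hf).mono
      (ball_subset_ball (half_le_self hδ.le))) h1
    rw [← norm_iteratedFDeriv_fderiv]
    refine h2.trans (le_of_eq ?_)
    rw [Finset.prod_range_succ']
    have : ∀ i ∈ Finset.range n, 2 * (2 / (δ / 2)) * (2 : ℝ) ^ i = 2 * (2 / δ) * 2 ^ (i + 1) := by
      intro i _
      field_simp; ring
    rw [Finset.prod_congr rfl this]
    field_simp

end Cauchy

/-! ### Excision functions -/

lemma IsSmooth.continuous_xDeriv {σ : ℝ≥0 → ℂ} (h : IsSmooth σ) (m : ℕ) :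
    Continuous (xDeriv m σ) := by
  have h1 : ContinuousOn (iteratedDerivWithin m (extend σ) (Set.Ici 0)) (Set.Ici 0) :=
    ContDiffOn.continuousOn_iteratedDerivWithin h (by exact_mod_cast le_top) uniqueDiffOn_halfLine
  exact h1.comp_continuous NNReal.continuous_coe fun x => x.2

/-- The symbol estimates only have to be checked for large `x`. -/
lemma IsSmooth.isSymbol_of_large {σ : ℝ≥0 → ℂ} (h : IsSmooth σ) {s : ℝ} {R : ℝ≥0}
    (hR : ∀ m : ℕ, ∃ D : ℝ, ∀ x > R, ‖xDeriv m σ x‖ ≤ D * bracket x ^ (s - m)) :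
    IsSymbol s σ := by
  refine ⟨h, fun m => ?_⟩
  obtain ⟨D, hD⟩ := hR m
  have hc : Continuous fun x => ‖xDeriv m σ x‖ * bracket x ^ (-(s - m)) :=
    (h.continuous_xDeriv m).norm.mul
      (continuous_bracket.rpow_const fun x => Or.inl (bracket_pos x).ne')
  obtain ⟨B, hB⟩ := (isCompact_Icc (a := (0 : ℝ≥0)) (b := R)).exists_bound_of_continuousOn
    hc.continuousOn
  refine ⟨max (max D B) 1, by positivity, fun x => ?_⟩
  rcases lt_or_ge R x with hx | hx
  · exact (hD x hx).trans (mul_le_mul_of_nonneg_right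
      ((le_max_left _ _).trans (le_max_left _ _)) (bracket_rpow_pos _ _).le)
  · have h1 := (le_abs_self _).trans (hB x ⟨zero_le, hx⟩)
    rw [Real.rpow_neg (bracket_pos x).le, ← div_eq_mul_inv, div_le_iff₀ (bracket_rpow_pos _ _)] at h1
    exact h1.trans (mul_le_mul_of_nonneg_right
      ((le_max_right _ _).trans (le_max_left _ _)) (bracket_rpow_pos _ _).le)

/-- The derivatives of a function that is constant for large `x`. -/
lemma xDeriv_of_eventually_const {σ : ℝ≥0 → ℂ} {R : ℝ≥0} {c : ℂ} (h : ∀ x > R, σ x = c) (m : ℕ) :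
    ∀ x > R, xDeriv m σ x = if m = 0 then c else 0 := by
  intro x hx
  have h0 : extend σ =ᶠ[𝓝[insert (x : ℝ) (Set.Ici 0)] (x : ℝ)] fun _ => c := by
    rw [Set.insert_eq_of_mem (show (x : ℝ) ∈ Set.Ici 0 from x.2)]
    have : Set.Ioi (R : ℝ) ∈ 𝓝[Set.Ici 0] (x : ℝ) :=
      mem_nhdsWithin_of_mem_nhds (Ioi_mem_nhds (by exact_mod_cast hx))
    filter_upwards [this, self_mem_nhdsWithin] with t ht ht0
    refine h _ ?_
    rw [gt_iff_lt, ← NNReal.coe_lt_coe, Real.coe_toNNReal t ht0]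
    exact ht
  rw [xDeriv, h0.iteratedDerivWithin_eq_of_nhds_insert m, iteratedDerivWithin_const]

lemma IsSmooth.isSymbol_of_compactSupport {σ : ℝ≥0 → ℂ} (h : IsSmooth σ) {R : ℝ≥0}
    (hR : ∀ x > R, σ x = 0) (s : ℝ) : IsSymbol s σ :=
  h.isSymbol_of_large fun m => ⟨0, fun x hx => by
    rw [xDeriv_of_eventually_const hR m x hx]; simp⟩

lemma IsSmooth.isSymbol_of_eventually_one {σ : ℝ≥0 → ℂ} (h : IsSmooth σ) {R : ℝ≥0}
    (hR : ∀ x > R, σ x = 1) : IsSymbol 0 σ := by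
  refine h.isSymbol_of_large (R := R) fun m => ⟨1, fun x hx => ?_⟩
  rw [xDeriv_of_eventually_const hR m x hx]
  rcases eq_or_ne m 0 with rfl | hm
  · simp
  · rw [if_neg hm, norm_zero, one_mul]
    exact (bracket_rpow_pos _ _).le

/-- An excision function as a complex valued function. -/
def cplx (χ : ℝ≥0 → ℝ) : ℝ≥0 → ℂ := fun x => (χ x : ℂ)

lemma IsExcision.isSmooth {χ : ℝ≥0 → ℝ} (h : IsExcision χ) : IsSmooth (cplx χ) :=
  Complex.ofRealCLM.contDiff.comp_contDiffOn h.1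

lemma IsExcision.isSymbol {χ : ℝ≥0 → ℝ} (h : IsExcision χ) : IsSymbol 0 (cplx χ) := by
  obtain ⟨R, _, hR⟩ := h.2.2
  exact h.isSmooth.isSymbol_of_eventually_one (R := R) fun x hx => by simp [cplx, hR x hx]

lemma IsExcision.exists_delta {χ : ℝ≥0 → ℝ} (h : IsExcision χ) :
    ∃ δ > 0, ∀ x < δ, cplx χ x = 0 := by
  obtain ⟨δ, hδ, h0⟩ := h.2.1
  exact ⟨δ, hδ, fun x hx => by simp [cplx, h0 x hx]⟩

/-- A smooth excision function which vanishes on `[0, a]` and is equal to one on `[2a, ∞)`. -/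
def excision (a : ℝ) : ℝ≥0 → ℝ := fun x => Real.smoothTransition (x / a - 1)

lemma excision_eq_zero {a : ℝ} (ha : 0 < a) {x : ℝ≥0} (hx : (x : ℝ) ≤ a) : excision a x = 0 :=
  Real.smoothTransition.zero_of_nonpos (by rw [sub_nonpos, div_le_one ha]; exact hx)

lemma excision_eq_one {a : ℝ} (ha : 0 < a) {x : ℝ≥0} (hx : 2 * a ≤ x) : excision a x = 1 :=
  Real.smoothTransition.one_of_one_le (by rw [le_sub_iff_add_le, le_div_iff₀ ha]; linarith)

lemma isExcision_excision {a : ℝ} (ha : 0 < a) : IsExcision (excision a) := by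
  refine ⟨?_, ⟨a.toNNReal, by simpa using ha, fun x hx => excision_eq_zero ha ?_⟩,
    max 1 (2 * a).toNNReal, le_max_left _ _, fun x hx => excision_eq_one ha ?_⟩
  · have h1 : ContDiffOn ℝ ∞ (fun t : ℝ => Real.smoothTransition (t / a - 1)) (Set.Ici 0) :=
      (Real.smoothTransition.contDiff.comp (by fun_prop)).contDiffOn
    refine h1.congr fun t ht => ?_
    simp [extend, excision, Real.coe_toNNReal t ht]
  · exact ((Real.lt_toNNReal_iff_coe_lt).1 hx).le
  · have := ((le_max_right _ _).trans_lt hx)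
    rw [Real.toNNReal_lt_iff_lt_coe (by positivity)] at this
    exact this.le

/-- The excision function used in all expansions below. -/
def stdExcision : ℝ≥0 → ℝ := excision 1

lemma isExcision_std : IsExcision stdExcision := isExcision_excision one_pos

/-! ### Holomorphic families with an asymptotic expansion -/

lemma remainder_eq (σ : ℝ≥0 → ℂ) (α : ℂ) (a : ℕ → ℂ) (χ : ℝ≥0 → ℝ) (N : ℕ) (x : ℝ≥0) :
    remainder σ α a χ N x = σ x - ∑ j ∈ Finset.range N, a j * cutPow (cplx χ) (α - j) x := by
  simp only [remainder, cutPow, cplx]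
  congr 1
  exact Finset.sum_congr rfl fun j _ => by ring

section Expansion

variable {E : Type*} [NormedAddCommGroup E] [NormedSpace ℂ E] {U : Set E} {α β : E → ℂ}
  {a b : ℕ → E → ℂ} {σ τ : E → ℝ≥0 → ℂ}

/-- The family `σ` is a holomorphic family with the asymptotic expansion `∑ⱼ aⱼ(z) x^(α(z) - j)`,
the remainders being estimated up to an arbitrarily small loss in the order. -/
structure FamExpansion (U : Set E) (α : E → ℂ) (a : ℕ → E → ℂ) (σ : E → ℝ≥0 → ℂ) : Prop where
  order : DifferentiableOn ℂ α U
  coeff : ∀ j, DifferentiableOn ℂ (a j) U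
  rem : ∀ N : ℕ, FamSymbol U (fun z => (α z).re - N)
    (fun z => remainder (σ z) (α z) (fun j => a j z) stdExcision N)

/-- Terms `a(z) η(x) x^(α(z) - j)` with `η` a cut-off symbol. -/
lemma famSymbol_term {η : ℝ≥0 → ℂ} {δ : ℝ≥0} (hδ : 0 < δ) (hη : ∀ x < δ, η x = 0) {s : ℝ}
    (hs : IsSymbol s η) (hα : DifferentiableOn ℂ α U) {h : E → ℂ} (hh : DifferentiableOn ℂ h U)
    (j : ℂ) :
    FamSymbol U (fun z => s + (α z).re - j.re) (fun z x => h z * cutPow η (α z - j) x) :=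
  ((famSymbol_cutPow hδ hη hs (hα.sub_const j)).smul_holo hh).mono fun z _ => by
    simp only [Complex.sub_re]; linarith

lemma famSymbol_excision_term {χ : ℝ≥0 → ℝ} (hχ : IsExcision χ) (hα : DifferentiableOn ℂ α U)
    {h : E → ℂ} (hh : DifferentiableOn ℂ h U) (j : ℕ) :
    FamSymbol U (fun z => (α z).re - j) (fun z x => h z * cutPow (cplx χ) (α z - j) x) := by
  obtain ⟨δ, hδ, h0⟩ := hχ.exists_delta
  refine (famSymbol_term hδ h0 hχ.isSymbol hα hh (j : ℂ)).mono fun z _ => by simp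

/-- It is enough to control the remainders of large index. -/
lemma FamExpansion.of_frequently (hα : DifferentiableOn ℂ α U)
    (ha : ∀ j, DifferentiableOn ℂ (a j) U)
    (h : ∀ N : ℕ, ∃ N' ≥ N, FamSymbol U (fun z => (α z).re - N)
      (fun z => remainder (σ z) (α z) (fun j => a j z) stdExcision N')) :
    FamExpansion U α a σ := by
  refine ⟨hα, ha, fun N => ?_⟩
  obtain ⟨N', hN', h1⟩ := h N
  have h2 : FamSymbol U (fun z => (α z).re - N) (fun z x => ∑ j ∈ Finset.Ico N N',
      a j z * cutPow (cplx stdExcision) (α z - j) x) := by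
    refine FamSymbol.sum fun j hj => (famSymbol_excision_term isExcision_std hα (ha j) j).mono ?_
    intro z _
    have : (N : ℝ) ≤ j := by exact_mod_cast (Finset.mem_Ico.1 hj).1
    linarith
  refine (h1.add h2).congr fun z _ => ?_
  funext x
  simp only [Pi.add_apply, remainder_eq]
  rw [← Finset.sum_range_add_sum_Ico _ hN']
  ring

lemma FamExpansion.famSymbol (h : FamExpansion U α a σ) : FamSymbol U (fun z => (α z).re) σ :=
  ((h.rem 0).mono fun z _ => by simp).congr fun z _ => by
    funext x; simp [remainder_eq]

lemma FamExpansion.congr (h : FamExpansion U α a σ) (hστ : ∀ z ∈ U, σ z = τ z) :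
    FamExpansion U α a τ :=
  ⟨h.order, h.coeff, fun N => (h.rem N).congr fun z hz => by rw [hστ z hz]⟩

lemma FamExpansion.mono_set {V : Set E} (h : FamExpansion U α a σ) (hV : V ⊆ U) :
    FamExpansion V α a σ :=
  ⟨h.order.mono hV, fun j => (h.coeff j).mono hV, fun N => (h.rem N).mono_set hV⟩

/-- The expansion does not depend on the excision function. -/
lemma FamExpansion.rem_excision (h : FamExpansion U α a σ) {χ : ℝ≥0 → ℝ} (hχ : IsExcision χ)
    (N : ℕ) : FamSymbol U (fun z => (α z).re - N)
      (fun z => remainder (σ z) (α z) (fun j => a j z) χ N) := by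
  obtain ⟨δ, hδ, h0⟩ := hχ.exists_delta
  obtain ⟨δ', hδ', h0'⟩ := isExcision_std.exists_delta
  obtain ⟨R, _, hR⟩ := hχ.2.2
  obtain ⟨R', _, hR'⟩ := isExcision_std.2.2
  have hsm : IsSmooth (cplx stdExcision - cplx χ) := ContDiffOn.sub isExcision_std.isSmooth hχ.isSmooth
  have hsupp : ∀ x > max R R', (cplx stdExcision - cplx χ) x = 0 := fun x hx => by
    simp [cplx, hR x ((le_max_left _ _).trans_lt hx), hR' x ((le_max_right _ _).trans_lt hx)]
  have hzero : ∀ x < min δ δ', (cplx stdExcision - cplx χ) x = 0 := fun x hx => by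
    simp [h0 x (hx.trans_le (min_le_left _ _)), h0' x (hx.trans_le (min_le_right _ _))]
  have h2 : FamSymbol U (fun z => (α z).re - N) (fun z x => ∑ j ∈ Finset.range N,
      a j z * cutPow (cplx stdExcision - cplx χ) (α z - j) x) :=
    FamSymbol.sum fun j _ => (famSymbol_term (lt_min hδ hδ') hzero
      (hsm.isSymbol_of_compactSupport hsupp (j - N)) h.order (h.coeff j) (j : ℂ)).mono fun z _ => by
        simp; linarith
  refine ((h.rem N).add h2).congr fun z _ => ?_
  funext x
  simp only [Pi.add_apply, remainder_eq, cutPow, Pi.sub_apply, sub_mul, mul_sub,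
    Finset.sum_sub_distrib]
  ring

lemma FamExpansion.smul_holo (h : FamExpansion U α a σ) {g : E → ℂ} (hg : DifferentiableOn ℂ g U) :
    FamExpansion U α (fun j z => g z * a j z) (fun z x => g z * σ z x) := by
  refine ⟨h.order, fun j => hg.mul (h.coeff j), fun N => ((h.rem N).smul_holo hg).congr ?_⟩
  intro z _
  funext x
  simp only [remainder_eq, mul_sub, Finset.mul_sum, mul_assoc]

lemma FamExpansion.comp {E' : Type*} [NormedAddCommGroup E'] [NormedSpace ℂ E'] {V : Set E'}
    {φ : E' → E} (h : FamExpansion U α a σ) (hφ : DifferentiableOn ℂ φ V) (hm : Set.MapsTo φ V U) :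
    FamExpansion V (α ∘ φ) (fun j => a j ∘ φ) (σ ∘ φ) :=
  ⟨h.order.comp hφ hm, fun j => (h.coeff j).comp hφ hm, fun N => (h.rem N).comp hφ hm⟩

/-- Smoothing families have the zero expansion, whatever the order. -/
lemma FamExpansion.of_smoothing (hα : DifferentiableOn ℂ α U)
    (h : ∀ N : ℕ, FamSymbol U (fun z => (α z).re - N) σ) :
    FamExpansion U α (fun _ _ => 0) σ :=
  ⟨hα, fun _ => differentiableOn_const _, fun N => (h N).congr fun z _ => by
    funext x; simp [remainder_eq]⟩

lemma sum_range_antidiagonal {M : Type*} [AddCommMonoid M] (f : ℕ → ℕ → M) (N : ℕ) :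
    ∑ j ∈ Finset.range N, ∑ p ∈ Finset.HasAntidiagonal.antidiagonal j, f p.1 p.2 =
      ∑ i ∈ Finset.range N, ∑ l ∈ Finset.range N, if i + l < N then f i l else 0 := by
  rw [← Finset.sum_product', ← Finset.sum_filter]
  rw [← Finset.sum_fiberwise_of_maps_to (t := Finset.range N) (g := fun p : ℕ × ℕ => p.1 + p.2)
    (by simp)]
  refine Finset.sum_congr rfl fun j hj => Finset.sum_congr ?_ fun _ _ => rfl
  ext p
  simp only [Finset.HasAntidiagonal.mem_antidiagonal, Finset.mem_filter, Finset.mem_product, Finset.mem_range] at hj ⊢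
  omega

/-- The product of two expansions is the Cauchy product. -/
lemma FamExpansion.mul (hσ : FamExpansion U α a σ) (hτ : FamExpansion U β b τ) :
    FamExpansion U (α + β)
      (fun j z => ∑ p ∈ Finset.HasAntidiagonal.antidiagonal j, a p.1 z * b p.2 z) (σ * τ) := by
  obtain ⟨δ, hδ, h0⟩ := isExcision_std.exists_delta
  obtain ⟨R, _, hR⟩ := isExcision_std.2.2
  set η := cplx stdExcision with hη
  have hηs : IsSymbol 0 η := isExcision_std.isSymbol
  have hsq0 : ∀ x < δ, (η * η) x = 0 := fun x hx => by simp [h0 x hx]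
  have hsqs : IsSmooth (η * η) := hηs.1.mul hηs.1
  have hsq : IsSymbol 0 (η * η) :=
    hsqs.isSymbol_of_eventually_one (R := R) fun x hx => by simp [hη, cplx, hR x hx]
  have hd0 : ∀ x < δ, (η * η - η) x = 0 := fun x hx => by simp [h0 x hx]
  have hd : ∀ s, IsSymbol s (η * η - η) :=
    IsSmooth.isSymbol_of_compactSupport (R := R) (ContDiffOn.sub hsqs hηs.1)
      fun x hx => by simp [hη, cplx, hR x hx]
  have horder : DifferentiableOn ℂ (α + β) U := hσ.order.add hτ.order
  refine ⟨horder, fun j => DifferentiableOn.fun_sum fun p _ => (hσ.coeff p.1).mul (hτ.coeff p.2),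
    fun N => ?_⟩
  have hR' := (hσ.rem N).mul hτ.famSymbol
  have hS' := hσ.famSymbol.mul (hτ.rem N)
  have hRS := (hσ.rem N).mul (hτ.rem N)
  have hterm : FamSymbol U (fun z => ((α + β) z).re - N) (fun z x => ∑ i ∈ Finset.range N,
      ∑ l ∈ Finset.range N, (a i z * b l z) *
        cutPow (if i + l < N then η * η - η else η * η) ((α + β) z - (i + l : ℕ)) x) := by
    refine FamSymbol.sum fun i _ => FamSymbol.sum fun l _ => ?_
    split_ifs with hil
    · exact (famSymbol_term hδ hd0 (hd ((i + l : ℕ) - N)) horder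
        ((hσ.coeff i).mul (hτ.coeff l)) ((i + l : ℕ) : ℂ)).mono fun z _ => by
          simp only [Complex.natCast_re]; linarith
    · refine (famSymbol_term hδ hsq0 hsq horder
        ((hσ.coeff i).mul (hτ.coeff l)) ((i + l : ℕ) : ℂ)).mono fun z _ => ?_
      have : (N : ℝ) ≤ (i + l : ℕ) := by exact_mod_cast not_lt.1 hil
      simp only [Complex.natCast_re]; linarith
  refine ((((hR'.mono ?_).add (hS'.mono ?_)).sub (hRS.mono ?_)).add hterm).congr ?_
  · intro z _; simp; linarith
  · intro z _; simp; linarith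
  · intro z _; simp; linarith
  intro z _
  funext x
  have hc : ∑ j ∈ Finset.range N, (∑ p ∈ Finset.HasAntidiagonal.antidiagonal j, a p.1 z * b p.2 z) *
      cutPow η ((α + β) z - j) x = ∑ i ∈ Finset.range N, ∑ l ∈ Finset.range N,
        if i + l < N then a i z * b l z * cutPow η ((α + β) z - (i + l : ℕ)) x else 0 := by
    rw [← sum_range_antidiagonal (fun i l => a i z * b l z * cutPow η ((α + β) z - (i + l : ℕ)) x)]
    refine Finset.sum_congr rfl fun j _ => ?_
    rw [Finset.sum_mul]
    refine Finset.sum_congr rfl fun p hp => ?_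
    rw [Finset.HasAntidiagonal.mem_antidiagonal.1 hp]
  have hAB : (∑ i ∈ Finset.range N, a i z * cutPow η (α z - i) x) *
      (∑ l ∈ Finset.range N, b l z * cutPow η (β z - l) x) =
      ∑ i ∈ Finset.range N, ∑ l ∈ Finset.range N,
        a i z * b l z * cutPow (η * η) ((α + β) z - (i + l : ℕ)) x := by
    rw [Finset.sum_mul_sum]
    refine Finset.sum_congr rfl fun i _ => Finset.sum_congr rfl fun l _ => ?_
    rcases lt_or_ge x δ with hx | hx
    · rw [cutPow_eq_zero h0 _ x hx, cutPow_eq_zero hsq0 _ x hx]; ring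
    · have hx0 : ((x : ℝ) : ℂ) ≠ 0 := by
        have : x ≠ 0 := (hδ.trans_le hx).ne'
        exact_mod_cast this
      simp only [cutPow, Pi.mul_apply]
      rw [show (α + β) z - (i + l : ℕ) = (α z - i) + (β z - l) by simp; ring,
        Complex.cpow_add _ _ hx0]
      ring
  have hfin : ∑ i ∈ Finset.range N, ∑ l ∈ Finset.range N, (a i z * b l z) *
        cutPow (if i + l < N then η * η - η else η * η) ((α + β) z - (i + l : ℕ)) x =
      (∑ i ∈ Finset.range N, ∑ l ∈ Finset.range N,
        a i z * b l z * cutPow (η * η) ((α + β) z - (i + l : ℕ)) x) -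
      ∑ i ∈ Finset.range N, ∑ l ∈ Finset.range N,
        if i + l < N then a i z * b l z * cutPow η ((α + β) z - (i + l : ℕ)) x else 0 := by
    rw [← Finset.sum_sub_distrib]
    refine Finset.sum_congr rfl fun i _ => ?_
    rw [← Finset.sum_sub_distrib]
    refine Finset.sum_congr rfl fun l _ => ?_
    split_ifs
    · simp only [cutPow, Pi.sub_apply]; ring
    · ring
  simp only [Pi.add_apply, Pi.sub_apply, Pi.mul_apply, remainder_eq]
  simp only [Pi.add_apply] at hfin hc hAB
  rw [hc, hfin, ← hAB]
  ring

/-- Powers of `x` with natural exponent are constant families. -/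
lemma famExpansion_pow (d : ℕ) :
    FamExpansion U (fun _ => (d : ℂ)) (fun j _ => if j = 0 then 1 else 0)
      (fun _ x => ((x : ℝ) : ℂ) ^ d) := by
  refine FamExpansion.of_frequently (differentiableOn_const _) (fun _ => differentiableOn_const _)
    fun N => ⟨N + 1, N.le_succ, ?_⟩
  obtain ⟨R, _, hR⟩ := isExcision_std.2.2
  have hs : IsSmooth (fun x => (1 - cplx stdExcision x) * ((x : ℝ) : ℂ) ^ d) := by
    refine IsSmooth.mul (σ := fun x => 1 - cplx stdExcision x) (ContDiffOn.sub contDiffOn_const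
      isExcision_std.isSmooth) ?_
    have : ContDiffOn ℝ ∞ (fun t : ℝ => (t : ℂ) ^ d) (Set.Ici 0) :=
      (Complex.ofRealCLM.contDiff.pow d).contDiffOn
    refine this.congr fun t ht => ?_
    simp [extend, Real.coe_toNNReal t ht]
  have h1 := hs.isSymbol_of_compactSupport (R := R)
    (fun x hx => by simp [cplx, hR x hx]) ((d : ℝ) - N)
  refine ((FamSymbol.of_isSymbol (U := U) h1).mono fun z _ => by simp).congr fun z _ => ?_
  funext x
  rw [remainder_eq, Finset.sum_range_succ', Finset.sum_eq_zero (by simp)]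
  simp [cutPow]
  ring

end Expansion

/-! ### Linear forms -/

section realForm

variable {ι : Type*}

lemma realForm_eq_linearCombination (v : ι →₀ ℝ) (z : ι → ℂ) :
    realForm v z = Finsupp.linearCombination ℝ z v := by
  simp [realForm, Finsupp.linearCombination_apply]

lemma realForm_add (v w : ι →₀ ℝ) (z : ι → ℂ) :
    realForm (v + w) z = realForm v z + realForm w z := by
  simp [realForm_eq_linearCombination]

lemma realForm_smul (c : ℝ) (v : ι →₀ ℝ) (z : ι → ℂ) :
    realForm (c • v) z = c * realForm v z := by
  simp [realForm_eq_linearCombination]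

lemma realForm_zero_left (z : ι → ℂ) : realForm (0 : ι →₀ ℝ) z = 0 := by
  simp [realForm_eq_linearCombination]

lemma realForm_zero_right (v : ι →₀ ℝ) : realForm v (0 : ι → ℂ) = 0 := by
  simp [realForm]

lemma realForm_single (i : ι) (z : ι → ℂ) : realForm (Finsupp.single i 1) z = z i := by
  simp [realForm_eq_linearCombination]

lemma realForm_add_right (v : ι →₀ ℝ) (z w : ι → ℂ) :
    realForm v (z + w) = realForm v z + realForm v w := by
  simp [realForm, Finsupp.sum, mul_add, Finset.sum_add_distrib]

lemma realForm_smul_right (v : ι →₀ ℝ) (c : ℂ) (z : ι → ℂ) :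
    realForm v (c • z) = c * realForm v z := by
  simp [realForm, Finsupp.sum, Finset.mul_sum, mul_left_comm]

lemma continuous_realForm (v : ι →₀ ℝ) : Continuous (realForm v) := by
  unfold realForm Finsupp.sum; fun_prop

lemma differentiable_realForm {k : ℕ} (v : Fin k →₀ ℝ) : Differentiable ℂ (realForm v) := by
  unfold realForm Finsupp.sum; fun_prop

lemma differentiable_affine {k : ℕ} (L : Fin k →₀ ℝ) (c : ℝ) : Differentiable ℂ (affine L c) :=
  (differentiable_realForm L).add_const _

end realForm

/-! ### Simple holomorphic families and their expansions -/

section Simple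

variable {k : ℕ} {U : Set (Fin k → ℂ)} {L : Fin k →₀ ℝ} {c : ℝ} {σ : (Fin k → ℂ) → ℝ≥0 → ℂ}

lemma FamExpansion.hasExpansion {E : Type*} [NormedAddCommGroup E] [NormedSpace ℂ E] {U : Set E}
    {α : E → ℂ} {a : ℕ → E → ℂ} {σ : E → ℝ≥0 → ℂ} (h : FamExpansion U α a σ) {z : E} (hz : z ∈ U) :
    HasExpansion (σ z) (α z) (fun j => a j z) := by
  obtain ⟨δ, hδ, h0⟩ := isExcision_std.exists_delta
  -- a remainder is the sum of its leading term, where no order is lost, and of the next remainder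
  have key : ∀ N : ℕ, IsSymbol ((α z).re - N)
      (remainder (σ z) (α z) (fun j => a j z) stdExcision N) := by
    intro N
    have h1 := (h.rem (N + 1)).isSymbol hz (s := (α z).re - N) (by push_cast; linarith)
    have h2 := isSymbol_cutPow hδ h0 isExcision_std.isSymbol (α z - N)
    have h3 := ((FamSymbol.of_isSymbol (U := (Set.univ : Set ℂ)) h2).smul_holo
      (h := fun _ => a N z) (differentiableOn_const _)).smooth 0 trivial
    have hsplit : remainder (σ z) (α z) (fun j => a j z) stdExcision N =
        remainder (σ z) (α z) (fun j => a j z) stdExcision (N + 1) +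
          fun x => a N z * cutPow (cplx stdExcision) (α z - N) x := by
      funext x
      simp only [Pi.add_apply, remainder_eq, Finset.sum_range_succ]
      ring
    rw [hsplit]
    refine ⟨h1.1.add h3, fun m => ?_⟩
    obtain ⟨C, hC0, hC⟩ := h1.2 m
    obtain ⟨D, hD0, hD⟩ := h2.2 m
    refine ⟨C + ‖a N z‖ * D, by positivity, fun x => ?_⟩
    rw [xDeriv_add h1.1 h3, xDeriv_const_mul, add_mul, mul_assoc]
    refine (norm_add_le _ _).trans (add_le_add (hC x) ?_)
    rw [norm_mul]
    have := hD x
    simp only [Complex.sub_re, Complex.natCast_re, zero_add] at this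
    exact mul_le_mul_of_nonneg_left this (norm_nonneg _)
  refine ⟨?_, stdExcision, isExcision_std, fun N _ => key N⟩
  have := key 0
  rwa [Nat.cast_zero, sub_zero, show remainder (σ z) (α z) (fun j => a j z) stdExcision 0 = σ z by
    funext x; simp [remainder_eq]] at this

/-- Families with an expansion are simple holomorphic families, by Cauchy's estimates. -/
lemma FamExpansion.isSimpleHolomorphicFamily {a : ℕ → (Fin k → ℂ) → ℂ}
    (h : FamExpansion U (affine L c) a σ) (hU : IsOpen U) (hconn : IsConnected U) :
    IsSimpleHolomorphicFamily U L c σ := by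
  refine ⟨hU, hconn, a, fun z hz => h.hasExpansion hz, fun N χ _ hχ m => ?_⟩
  have hrem := h.rem_excision hχ N
  refine ⟨fun x => hrem.holo m x, fun K hKU hK n ε hε => ?_⟩
  set G : ℝ≥0 → (Fin k → ℂ) → ℂ := fun x w =>
    xDeriv m (remainder (σ w) (affine L c w) (fun j => a j w) χ N) x with hG
  refine hK.induction_on (p := fun s => ∃ C : ℝ, 0 < C ∧ ∀ z ∈ s, ∀ x : ℝ≥0,
    ‖iteratedFDeriv ℂ n (G x) z‖ ≤ C * bracket x ^ ((affine L c z).re - N - m + ε)) ?_ ?_ ?_ ?_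
  · exact ⟨1, one_pos, by simp⟩
  · rintro s t hst ⟨C, hC0, hC⟩
    exact ⟨C, hC0, fun z hz => hC z (hst hz)⟩
  · rintro s t ⟨C, hC0, hC⟩ ⟨D, hD0, hD⟩
    refine ⟨max C D, lt_max_of_lt_left hC0, fun z hz x => ?_⟩
    rcases hz with hz | hz
    · exact (hC z hz x).trans
        (mul_le_mul_of_nonneg_right (le_max_left _ _) (bracket_rpow_pos _ _).le)
    · exact (hD z hz x).trans
        (mul_le_mul_of_nonneg_right (le_max_right _ _) (bracket_rpow_pos _ _).le)
  intro z₀ hz₀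
  obtain ⟨C, hC0, hC⟩ := hrem.bound' m (hKU hz₀) (half_pos hε)
  rw [hU.nhdsWithin_eq (hKU hz₀)] at hC
  have hre : ContinuousAt (fun z => (affine L c z).re) z₀ :=
    (Complex.continuous_re.comp (differentiable_affine L c).continuous).continuousAt
  obtain ⟨δ, hδ, hball⟩ := Metric.eventually_nhds_iff_ball.1
    ((hC.and (hU.eventually_mem (hKU hz₀))).and ((Metric.tendsto_nhds.1 hre) _ (half_pos hε)))
  refine ⟨Metric.ball z₀ (δ / 2), mem_nhdsWithin_of_mem_nhds (Metric.ball_mem_nhds _ (half_pos hδ)),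
    (∏ i ∈ Finset.range n, 2 * (2 / (δ / 2)) * 2 ^ i) * C, by positivity, fun z hz x => ?_⟩
  have hsub : Metric.ball z (δ / 2) ⊆ Metric.ball z₀ δ := by
    refine Metric.ball_subset_ball' ?_
    rw [Metric.mem_ball] at hz; linarith
  have h1 := norm_iteratedFDeriv_le_of_norm_le n (f := G x) (z := z) (half_pos hδ)
    ((hrem.holo m x).mono fun w hw => (hball w (hsub hw)).1.2)
    fun w hw => (hball w (hsub hw)).1.1 x
  rw [← mul_assoc] at h1
  refine h1.trans (mul_le_mul_of_nonneg_left (bracket_rpow_mono x ?_) (by positivity))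
  have h2 := (hball z (hsub (Metric.mem_ball_self (half_pos hδ)))).2
  rw [Real.dist_eq, abs_lt] at h2
  linarith [h2.1]

/-- The coefficients of a simple holomorphic family are holomorphic: the partial sums of the
expansion are differences of remainders for two excision functions, evaluated at `x = 1`. -/
lemma IsSimpleHolomorphicFamily.exists_famExpansion (h : IsSimpleHolomorphicFamily U L c σ) :
    ∃ a, FamExpansion U (affine L c) a σ := by
  obtain ⟨hU, -, a, hexp, hest⟩ := h
  obtain ⟨δ, hδ, h0⟩ := isExcision_std.exists_delta
  have hα : DifferentiableOn ℂ (affine L c) U := (differentiable_affine L c).differentiableOn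
  have hsum : ∀ N : ℕ, DifferentiableOn ℂ (fun z => ∑ j ∈ Finset.range N, a j z) U := by
    intro N
    rcases Nat.eq_zero_or_pos N with rfl | hN
    · simp [differentiableOn_const]
    have h1 := (hest N _ hN (isExcision_excision one_pos) 0).1 1
    have h2 := (hest N _ hN (isExcision_excision (a := 1 / 2) (by norm_num)) 0).1 1
    refine (h1.sub h2).congr fun z _ => ?_
    simp only [Pi.sub_apply, xDeriv_zero, remainder, NNReal.coe_one, Complex.ofReal_one, Complex.one_cpow]
    rw [excision_eq_zero one_pos (by simp), excision_eq_one (a := 1 / 2) (by norm_num) (by simp)]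
    simp
  have ha : ∀ j, DifferentiableOn ℂ (a j) U := fun j =>
    ((hsum (j + 1)).sub (hsum j)).congr fun z _ => by simp [Finset.sum_range_succ]
  refine ⟨a, FamExpansion.of_frequently hα ha fun N => ⟨N + 1, N.le_succ, ?_⟩⟩
  refine FamSymbol.mono (r := fun z => (affine L c z).re - (N + 1 : ℕ)) ⟨fun z hz => ?_,
    fun m x => (hest (N + 1) _ (by omega) isExcision_std m).1 x, fun m z₀ hz₀ ε hε => ?_⟩
    fun z _ => by push_cast; linarith
  · have h1 : IsSmooth (σ z) := (hexp z hz).1.1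
    have h2 : IsSmooth (fun x => ∑ j ∈ Finset.range (N + 1),
        a j z * cutPow (cplx stdExcision) (affine L c z - j) x) :=
      ContDiffOn.sum fun j _ => (isSmooth_cutPow isExcision_std.isSmooth hδ h0 _).const_mul _
    have h3 : IsSmooth (σ z - fun x => ∑ j ∈ Finset.range (N + 1),
        a j z * cutPow (cplx stdExcision) (affine L c z - j) x) := ContDiffOn.sub h1 h2
    convert h3 using 1
    funext x
    rw [remainder_eq, Pi.sub_apply]
  · have hre : ContinuousAt (fun z => (affine L c z).re) z₀ :=
      (Complex.continuous_re.comp (differentiable_affine L c).continuous).continuousAt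
    obtain ⟨ρ, hρ, hball⟩ := Metric.nhds_basis_closedBall.eventually_iff.1
      ((hU.eventually_mem hz₀).and ((Metric.tendsto_nhds.1 hre) _ (half_pos hε)))
    obtain ⟨C, hC0, hC⟩ := (hest (N + 1) _ (by omega) isExcision_std m).2
      (Metric.closedBall z₀ ρ) (fun z hz => (hball hz).1) (isCompact_closedBall _ _) 0 _ (half_pos hε)
    refine ⟨C, ?_⟩
    filter_upwards [mem_nhdsWithin_of_mem_nhds (Metric.closedBall_mem_nhds z₀ hρ)] with z hz x
    have h1 := hC z hz x
    rw [norm_iteratedFDeriv_zero] at h1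
    refine h1.trans (mul_le_mul_of_nonneg_left (bracket_rpow_mono x ?_) hC0.le)
    have h2 := (hball hz).2
    rw [Real.dist_eq, abs_lt] at h2
    linarith [h2.2]

end Simple

/-! ### Affine substitutions with real coefficients -/

section affineSubst

variable {ι κ μ : Type*}

/-- The affine substitution `(ι → ℂ) → (κ → ℂ)` with real coefficients whose pull-back on linear
forms is `v ↦ T v + b v`. -/
def affineSubst (T : (κ →₀ ℝ) →ₗ[ℝ] (ι →₀ ℝ)) (b : (κ →₀ ℝ) →ₗ[ℝ] ℝ) (z : ι → ℂ) : κ → ℂ :=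
  fun i => realForm (T (Finsupp.single i 1)) z + b (Finsupp.single i 1)

lemma realForm_affineSubst (T : (κ →₀ ℝ) →ₗ[ℝ] (ι →₀ ℝ)) (b : (κ →₀ ℝ) →ₗ[ℝ] ℝ) (v : κ →₀ ℝ)
    (z : ι → ℂ) : realForm v (affineSubst T b z) = realForm (T v) z + b v := by
  induction v using Finsupp.induction_linear with
  | zero => simp [realForm_zero_left]
  | add v w hv hw => simp only [realForm_add, map_add, hv, hw]; push_cast; ring
  | single i r =>
    have : Finsupp.single i r = r • Finsupp.single i (1 : ℝ) := by simp
    rw [this, realForm_smul, realForm_single, map_smul, map_smul, realForm_smul, affineSubst]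
    simp [mul_add]

lemma affineSubst_affineSubst (T : (κ →₀ ℝ) →ₗ[ℝ] (ι →₀ ℝ)) (b : (κ →₀ ℝ) →ₗ[ℝ] ℝ)
    (S : (ι →₀ ℝ) →ₗ[ℝ] (μ →₀ ℝ)) (d : (ι →₀ ℝ) →ₗ[ℝ] ℝ) (z : μ → ℂ) :
    affineSubst T b (affineSubst S d z) = affineSubst (S ∘ₗ T) (b + d ∘ₗ T) z := by
  funext i
  simp only [affineSubst, realForm_affineSubst, LinearMap.comp_apply, LinearMap.add_apply]
  push_cast; ring

lemma continuous_affineSubst (T : (κ →₀ ℝ) →ₗ[ℝ] (ι →₀ ℝ)) (b : (κ →₀ ℝ) →ₗ[ℝ] ℝ) :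
    Continuous (affineSubst T b) :=
  continuous_pi fun _ => (continuous_realForm _).add continuous_const

lemma differentiable_affineSubst {k n : ℕ} (T : (Fin n →₀ ℝ) →ₗ[ℝ] (Fin k →₀ ℝ))
    (b : (Fin n →₀ ℝ) →ₗ[ℝ] ℝ) : Differentiable ℂ (affineSubst T b) :=
  differentiable_pi.2 fun _ => (differentiable_realForm _).add_const _

lemma tendsto_affineSubst_smul_zero (T : (κ →₀ ℝ) →ₗ[ℝ] (ι →₀ ℝ)) (b : (κ →₀ ℝ) →ₗ[ℝ] ℝ) :
    Filter.Tendsto (fun t : ℝ => affineSubst T (t • b) 0) (𝓝 0) (𝓝 0) := by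
  have h : Continuous fun t : ℝ => affineSubst T (t • b) (0 : ι → ℂ) := by
    refine continuous_pi fun i => ?_
    simp only [affineSubst, realForm_zero_right, LinearMap.smul_apply, smul_eq_mul]
    fun_prop
  have := h.tendsto 0
  rwa [show affineSubst T ((0 : ℝ) • b) (0 : ι → ℂ) = 0 by
    funext i; simp [affineSubst, realForm_zero_right]] at this

end affineSubst

/-! ### The filter of germs off real hyperplanes -/

section germFilter

variable {ι κ : Type*}

lemma eventually_realForm_ne_zero {v : ι →₀ ℝ} (hv : v ≠ 0) :
    ∀ᶠ z in germFilter ι, realForm v z ≠ 0 := by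
  have h : germFilter ι ≤ Filter.principal {z | realForm v z ≠ 0} :=
    inf_le_right.trans (iInf_le (fun v : {v : ι →₀ ℝ // v ≠ 0} =>
      Filter.principal {z : ι → ℂ | realForm v.1 z ≠ 0}) ⟨v, hv⟩)
  exact h (Filter.mem_principal_self _)

lemma eventually_germFilter_iff {P : (ι → ℂ) → Prop} :
    (∀ᶠ z in germFilter ι, P z) ↔ ∃ Φ : Finset (ι →₀ ℝ), (∀ v ∈ Φ, v ≠ 0) ∧
      ∀ᶠ z in 𝓝 0, (∀ v ∈ Φ, realForm v z ≠ 0) → P z := by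
  classical
  constructor
  · intro h
    obtain ⟨s, hs, t, ht, hst⟩ := Filter.mem_inf_iff.1 h
    obtain ⟨I, hI, V, hV, rfl⟩ := Filter.mem_iInf.1 ht
    refine ⟨hI.toFinset.image Subtype.val, by simp +contextual, ?_⟩
    filter_upwards [hs] with z hz hne
    have : z ∈ s ∩ ⋂ i, V i := ⟨hz, Set.mem_iInter.2 fun i => hV i
      (hne i.1.1 (Finset.mem_image_of_mem _ (hI.mem_toFinset.2 i.2)))⟩
    rw [← hst] at this
    exact this
  · rintro ⟨Φ, hΦ, h⟩
    have h1 : ∀ᶠ z in germFilter ι, ∀ v ∈ Φ, realForm v z ≠ 0 :=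
      (Filter.eventually_all_finset _).2 fun v hv => eventually_realForm_ne_zero (hΦ v hv)
    have h2 := h.filter_mono (inf_le_left : germFilter ι ≤ 𝓝 0)
    filter_upwards [h1, h2] with z hz hz' using hz' hz

lemma germFilter_le_nhds : germFilter ι ≤ 𝓝 0 := inf_le_left

/-- Restriction of germs to generic affine subspaces: a property that holds off finitely many
hyperplanes near zero holds on the image of `affineSubst T (t • b)` for small `t ≠ 0`, off finitely
many hyperplanes near zero, provided that no form in a certain finite set `Φ` is killed by both
`T` and `b`. -/
lemma eventually_affineSubst {P : (κ → ℂ) → Prop} (h : ∀ᶠ y in germFilter κ, P y) :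
    ∃ Φ : Finset (κ →₀ ℝ), (∀ v ∈ Φ, v ≠ 0) ∧ ∀ {ι : Type} (T : (κ →₀ ℝ) →ₗ[ℝ] (ι →₀ ℝ))
      (b : (κ →₀ ℝ) →ₗ[ℝ] ℝ), (∀ v ∈ Φ, T v = 0 → b v ≠ 0) →
      ∀ᶠ t in 𝓝[≠] (0 : ℝ), ∀ᶠ z in germFilter ι, P (affineSubst T (t • b) z) := by
  obtain ⟨Φ, hΦ, hP⟩ := eventually_germFilter_iff.1 h
  refine ⟨Φ, hΦ, fun {ι} T b hgood => ?_⟩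
  have h1 := (tendsto_affineSubst_smul_zero T b).eventually hP.eventually_nhds
  filter_upwards [mem_nhdsWithin_of_mem_nhds h1, self_mem_nhdsWithin] with t ht ht0
  have h2 : ∀ᶠ z in germFilter ι, (∀ v ∈ Φ, realForm v (affineSubst T (t • b) z) ≠ 0) →
      P (affineSubst T (t • b) z) :=
    germFilter_le_nhds ((continuous_affineSubst T (t • b)).continuousAt.eventually ht)
  have h3 : ∀ᶠ z in germFilter ι, ∀ v ∈ Φ, realForm v (affineSubst T (t • b) z) ≠ 0 := by
    refine (Filter.eventually_all_finset _).2 fun v hv => ?_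
    simp only [realForm_affineSubst]
    by_cases hb : b v = 0
    · filter_upwards [eventually_realForm_ne_zero fun h0 => hgood v hv h0 hb] with z hz
      simpa [hb] using hz
    · refine germFilter_le_nhds ?_
      have hc : ContinuousAt (fun z : ι → ℂ => realForm (T v) z + ((t • b) v : ℝ)) 0 :=
        ((continuous_realForm _).add continuous_const).continuousAt
      refine hc.eventually_ne ?_
      simpa [realForm_zero_right, hb] using ht0
  filter_upwards [h2, h3] with z hz hz' using hz hz'

/-- Linear substitutions that are injective on linear forms act on germs. -/
lemma tendsto_affineSubst {κ ι : Type} {T : (κ →₀ ℝ) →ₗ[ℝ] (ι →₀ ℝ)} (hT : Function.Injective T) :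
    Filter.Tendsto (affineSubst T 0) (germFilter ι) (germFilter κ) := by
  intro P hP
  obtain ⟨Φ, hΦ, h⟩ := eventually_affineSubst (P := (· ∈ P)) hP
  have h1 := h (ι := ι) T 0 fun v hv h0 => absurd ((map_eq_zero_iff T hT).1 h0) (hΦ v hv)
  obtain ⟨t, ht⟩ := h1.exists
  rw [smul_zero] at ht
  exact ht

end germFilter

/-! ### Denominators and meromorphic families -/

/-- The multiplicative monoid generated by the nonzero linear forms with real coefficients. -/
def denominators (k : ℕ) : Submonoid ((Fin k → ℂ) → ℂ) :=
  Submonoid.closure {d | ∃ v : Fin k →₀ ℝ, v ≠ 0 ∧ d = realForm v}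

section denominators

variable {k n : ℕ} {d : (Fin k → ℂ) → ℂ}

lemma realForm_mem_denominators {v : Fin k →₀ ℝ} (hv : v ≠ 0) :
    realForm v ∈ denominators k :=
  Submonoid.subset_closure ⟨v, hv, rfl⟩

lemma formProd_mem_denominators {ℓ : Fin n → (Fin k →₀ ℝ)} (hℓ : ∀ i, ℓ i ≠ 0) (s : Fin n → ℕ) :
    formProd ℓ s ∈ denominators k := by
  have : formProd ℓ s = ∏ i, realForm (ℓ i) ^ s i := by
    funext z; simp [formProd]
  rw [this]
  exact Submonoid.prod_mem _ fun i _ => Submonoid.pow_mem _ (realForm_mem_denominators (hℓ i)) _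

lemma exists_formProd_of_mem_denominators (hd : d ∈ denominators k) :
    ∃ (n : ℕ) (ℓ : Fin n → (Fin k →₀ ℝ)) (s : Fin n → ℕ), (∀ i, ℓ i ≠ 0) ∧ formProd ℓ s = d := by
  induction hd using Submonoid.closure_induction with
  | mem d hd =>
    obtain ⟨v, hv, rfl⟩ := hd
    exact ⟨1, fun _ => v, fun _ => 1, fun _ => hv, by funext z; simp [formProd]⟩
  | one => exact ⟨0, Fin.elim0, Fin.elim0, fun i => i.elim0, by funext z; simp [formProd]⟩
  | mul d e _ _ hd he =>
    obtain ⟨n, ℓ, s, hℓ, rfl⟩ := hd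
    obtain ⟨m, ℓ', s', hℓ', rfl⟩ := he
    refine ⟨n + m, Fin.append ℓ ℓ', Fin.append s s', fun i => ?_, ?_⟩
    · induction i using Fin.addCases with
      | left i => simpa using hℓ i
      | right i => simpa using hℓ' i
    · funext z; simp [formProd, Fin.prod_univ_add]

lemma differentiable_of_mem_denominators (hd : d ∈ denominators k) : Differentiable ℂ d := by
  induction hd using Submonoid.closure_induction with
  | mem d hd => obtain ⟨v, -, rfl⟩ := hd; exact differentiable_realForm v
  | one => exact differentiable_const _
  | mul d e _ _ hd he => exact hd.mul he

lemma eventually_ne_zero_of_mem_denominators (hd : d ∈ denominators k) :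
    ∀ᶠ z in germFilter (Fin k), d z ≠ 0 := by
  induction hd using Submonoid.closure_induction with
  | mem d hd => obtain ⟨v, hv, rfl⟩ := hd; exact eventually_realForm_ne_zero hv
  | one => simp
  | mul d e _ _ hd he => filter_upwards [hd, he] with z h1 h2 using mul_ne_zero h1 h2

/-- Under a generic affine substitution a denominator remains a denominator, up to a factor which
is holomorphic and does not vanish at zero. -/
lemma denominators_affineSubst (hd : d ∈ denominators k) :
    ∃ Φ : Finset (Fin k →₀ ℝ), (∀ v ∈ Φ, v ≠ 0) ∧
      ∀ {n : ℕ} (T : (Fin k →₀ ℝ) →ₗ[ℝ] (Fin n →₀ ℝ)) (b : (Fin k →₀ ℝ) →ₗ[ℝ] ℝ),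
      (∀ v ∈ Φ, T v = 0 → b v ≠ 0) → ∀ t : ℝ, t ≠ 0 →
      ∃ d' ∈ denominators n, ∃ u : (Fin n → ℂ) → ℂ, Differentiable ℂ u ∧ u 0 ≠ 0 ∧
        ∀ z, d (affineSubst T (t • b) z) = d' z * u z := by
  classical
  induction hd using Submonoid.closure_induction with
  | mem d hd =>
    obtain ⟨v, hv, rfl⟩ := hd
    refine ⟨{v}, by simpa using hv, fun {n} T b hgood t ht => ?_⟩
    simp only [Finset.mem_singleton, forall_eq] at hgood
    by_cases hb : b v = 0
    · refine ⟨realForm (T v), realForm_mem_denominators fun h => hgood h hb, 1,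
        differentiable_const _, one_ne_zero, fun z => ?_⟩
      simp [realForm_affineSubst, hb]
    · refine ⟨1, one_mem _, fun z => realForm (T v) z + (t * b v : ℝ),
        (differentiable_realForm _).add_const _, ?_, fun z => ?_⟩
      · simpa [realForm_zero_right] using ⟨ht, hb⟩
      · simp [realForm_affineSubst]
  | one =>
    exact ⟨∅, by simp, fun T b _ t _ => ⟨1, one_mem _, 1, differentiable_const _, one_ne_zero,
      fun z => by simp⟩⟩
  | mul d e _ _ hd he =>
    obtain ⟨Φ, hΦ, hd⟩ := hd
    obtain ⟨Ψ, hΨ, he⟩ := he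
    refine ⟨Φ ∪ Ψ, fun v hv => (Finset.mem_union.1 hv).elim (hΦ v) (hΨ v),
      fun {n} T b hgood t ht => ?_⟩
    obtain ⟨d', hd', u, hu, hu0, h1⟩ := hd T b (fun v hv => hgood v (Finset.mem_union_left _ hv)) t ht
    obtain ⟨e', he', w, hw, hw0, h2⟩ := he T b (fun v hv => hgood v (Finset.mem_union_right _ hv)) t ht
    refine ⟨d' * e', mul_mem hd' he', u * w, hu.mul hw, mul_ne_zero hu0 hw0, fun z => ?_⟩
    simp only [Pi.mul_apply, h1, h2]; ring

end denominators

section Mero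

open Metric

variable {k n : ℕ}

/-- Families which become, after multiplication by a denominator, a family with the property `P`
on a ball around zero. -/
def Mero (P : Set (Fin k → ℂ) → ((Fin k → ℂ) → ℝ≥0 → ℂ) → Prop) (σ : (Fin k → ℂ) → ℝ≥0 → ℂ) :
    Prop :=
  ∃ d ∈ denominators k, ∃ r > 0, ∃ τ, P (ball 0 r) τ ∧
    ∀ᶠ z in germFilter (Fin k), ∀ x, d z * σ z x = τ z x

variable {P P₁ P₂ : Set (Fin k → ℂ) → ((Fin k → ℂ) → ℝ≥0 → ℂ) → Prop}
  {σ σ₁ σ₂ : (Fin k → ℂ) → ℝ≥0 → ℂ}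

lemma Mero.imp (h : Mero P₁ σ) (h12 : ∀ U τ, P₁ U τ → P₂ U τ) : Mero P₂ σ := by
  obtain ⟨d, hd, r, hr, τ, hτ, he⟩ := h
  exact ⟨d, hd, r, hr, τ, h12 _ _ hτ, he⟩

lemma Mero.mul (h₁ : Mero P₁ σ₁) (h₂ : Mero P₂ σ₂)
    (mono₁ : ∀ U V τ, V ⊆ U → P₁ U τ → P₁ V τ) (mono₂ : ∀ U V τ, V ⊆ U → P₂ U τ → P₂ V τ)
    (hmul : ∀ U τ₁ τ₂, P₁ U τ₁ → P₂ U τ₂ → P U (τ₁ * τ₂)) : Mero P (σ₁ * σ₂) := by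
  obtain ⟨d₁, hd₁, r₁, hr₁, τ₁, hτ₁, he₁⟩ := h₁
  obtain ⟨d₂, hd₂, r₂, hr₂, τ₂, hτ₂, he₂⟩ := h₂
  refine ⟨d₁ * d₂, mul_mem hd₁ hd₂, min r₁ r₂, lt_min hr₁ hr₂, τ₁ * τ₂,
    hmul _ _ _ (mono₁ _ _ _ (ball_subset_ball (min_le_left _ _)) hτ₁)
      (mono₂ _ _ _ (ball_subset_ball (min_le_right _ _)) hτ₂), ?_⟩
  filter_upwards [he₁, he₂] with z h1 h2 x
  simp only [Pi.mul_apply, ← h1 x, ← h2 x]; ring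

/-- Restriction of meromorphic families to generic affine subspaces. -/
lemma Mero.restrict (h : Mero P σ) :
    ∃ Φ : Finset (Fin k →₀ ℝ), (∀ v ∈ Φ, v ≠ 0) ∧
      ∀ {n : ℕ} (T : (Fin k →₀ ℝ) →ₗ[ℝ] (Fin n →₀ ℝ)) (b : (Fin k →₀ ℝ) →ₗ[ℝ] ℝ),
      (∀ v ∈ Φ, T v = 0 → b v ≠ 0) → ∀ᶠ t in 𝓝[≠] (0 : ℝ),
      ∀ Q : Set (Fin n → ℂ) → ((Fin n → ℂ) → ℝ≥0 → ℂ) → Prop,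
        (∀ U V τ (g : (Fin n → ℂ) → ℂ), P U τ → DifferentiableOn ℂ g V →
          Set.MapsTo (affineSubst T (t • b)) V U →
          Q V (fun z x => g z * τ (affineSubst T (t • b) z) x)) →
        Mero Q (σ ∘ affineSubst T (t • b)) := by
  classical
  obtain ⟨d, hd, r, hr, τ, hτ, he⟩ := h
  obtain ⟨Φ, hΦ, h1⟩ := denominators_affineSubst hd
  obtain ⟨Ψ, hΨ, h2⟩ := eventually_affineSubst he
  refine ⟨Φ ∪ Ψ, fun v hv => (Finset.mem_union.1 hv).elim (hΦ v) (hΨ v), fun {n} T b hgood => ?_⟩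
  have h3 := h2 T b fun v hv => hgood v (Finset.mem_union_right _ hv)
  have h4 := (tendsto_affineSubst_smul_zero T b).eventually (ball_mem_nhds 0 hr)
  filter_upwards [h3, mem_nhdsWithin_of_mem_nhds h4, self_mem_nhdsWithin] with t h5 h6 ht Q hQ
  obtain ⟨d', hd', u, hu, hu0, h7⟩ :=
    h1 T b (fun v hv => hgood v (Finset.mem_union_left _ hv)) t ht
  have h8 : ∀ᶠ z in 𝓝 (0 : Fin n → ℂ), affineSubst T (t • b) z ∈ ball 0 r ∧ u z ≠ 0 :=
    ((continuous_affineSubst T (t • b)).continuousAt.eventually (isOpen_ball.mem_nhds h6)).and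
      (hu.continuous.continuousAt.eventually_ne hu0)
  obtain ⟨r', hr', h9⟩ := eventually_nhds_iff_ball.1 h8
  refine ⟨d', hd', r', hr', _, hQ _ (ball 0 r') τ (fun z => (u z)⁻¹) hτ
    (hu.differentiableOn.inv fun z hz => (h9 z hz).2) fun z hz => (h9 z hz).1, ?_⟩
  filter_upwards [h5, germFilter_le_nhds h8] with z hz hz' x
  rw [← hz x, h7, Function.comp_apply]
  field_simp [hz'.2]

/-- Pull-back of meromorphic families along linear maps. -/
lemma Mero.pullback (h : Mero P σ) {T : (Fin k →₀ ℝ) →ₗ[ℝ] (Fin n →₀ ℝ)}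
    (hT : Function.Injective T) {Q : Set (Fin n → ℂ) → ((Fin n → ℂ) → ℝ≥0 → ℂ) → Prop}
    (hQ : ∀ U V τ (g : (Fin n → ℂ) → ℂ), P U τ → DifferentiableOn ℂ g V →
          Set.MapsTo (affineSubst T 0) V U →
          Q V (fun z x => g z * τ (affineSubst T 0 z) x)) :
    Mero Q (σ ∘ affineSubst T 0) := by
  obtain ⟨Φ, hΦ, h1⟩ := h.restrict
  obtain ⟨t, ht⟩ := (h1 T 0 fun v hv h0 => absurd ((map_eq_zero_iff T hT).1 h0) (hΦ v hv)).exists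
  rw [smul_zero] at ht
  exact ht Q hQ

/-- Clearing the denominators of the exceptional hyperplanes. -/
lemma exists_formProd_of_eventually {d : (Fin k → ℂ) → ℂ} (hd : d ∈ denominators k)
    {P : (Fin k → ℂ) → Prop} (hP : ∀ᶠ z in germFilter (Fin k), P z) {r : ℝ} (hr : 0 < r) :
    ∃ (n : ℕ) (ℓ : Fin n → (Fin k →₀ ℝ)) (s : Fin n → ℕ) (q : (Fin k → ℂ) → ℂ) (r' : ℝ),
      0 < r' ∧ r' ≤ r ∧ (∀ i, ℓ i ≠ 0) ∧ Differentiable ℂ q ∧ (∀ z, formProd ℓ s z = q z * d z) ∧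
      ∀ z ∈ ball (0 : Fin k → ℂ) r', (∀ i, realForm (ℓ i) z ≠ 0) → P z := by
  obtain ⟨Φ, hΦ, hP⟩ := eventually_germFilter_iff.1 hP
  obtain ⟨r', hr', h1⟩ := eventually_nhds_iff_ball.1 hP
  have hq : ∏ v ∈ Φ, realForm v ∈ denominators k :=
    Submonoid.prod_mem _ fun v hv => realForm_mem_denominators (hΦ v hv)
  obtain ⟨n, ℓ, s, hℓ, hfp⟩ := exists_formProd_of_mem_denominators (mul_mem hq hd)
  refine ⟨n, ℓ, s, ∏ v ∈ Φ, realForm v, min r' r, lt_min hr' hr, min_le_right _ _, hℓ,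
    differentiable_of_mem_denominators hq, fun z => by rw [hfp]; rfl, fun z hz hne => ?_⟩
  refine h1 z (ball_subset_ball (min_le_left _ _) hz) fun v hv h0 => ?_
  have h2 : formProd ℓ s z ≠ 0 := Finset.prod_ne_zero_iff.2 fun i _ => pow_ne_zero _ (hne i)
  rw [hfp, Pi.mul_apply, Finset.prod_apply, Finset.prod_eq_zero hv h0, zero_mul] at h2
  exact h2 rfl

lemma isConnected_ball {r : ℝ} (hr : 0 < r) : IsConnected (ball (0 : Fin k → ℂ) r) :=
  ⟨⟨0, mem_ball_self hr⟩, (convex_ball 0 r).isPreconnected⟩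

lemma eventually_forall_realForm_ne_zero {ℓ : Fin n → (Fin k →₀ ℝ)} (hℓ : ∀ i, ℓ i ≠ 0) :
    ∀ᶠ z in germFilter (Fin k), ∀ i, realForm (ℓ i) z ≠ 0 :=
  Filter.eventually_all.2 fun i => eventually_realForm_ne_zero (hℓ i)

/-- Families with an expansion of affine order `L + c`. -/
def HasOrder (L : Fin k →₀ ℝ) (c : ℝ) (U : Set (Fin k → ℂ)) (τ : (Fin k → ℂ) → ℝ≥0 → ℂ) : Prop :=
  ∃ a, FamExpansion U (affine L c) a τ

/-- Smoothing families. -/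
def IsSmoothing (U : Set (Fin k → ℂ)) (τ : (Fin k → ℂ) → ℝ≥0 → ℂ) : Prop :=
  ∀ s : ℝ, FamSymbol U (fun _ => s) τ

/-- Families which do not depend on `x`. -/
def IsXConst (U : Set (Fin k → ℂ)) (τ : (Fin k → ℂ) → ℝ≥0 → ℂ) : Prop :=
  ∃ h : (Fin k → ℂ) → ℂ, DifferentiableOn ℂ h U ∧ ∀ z ∈ U, ∀ x, τ z x = h z

lemma isSimpleMeromorphic_iff {L : Fin k →₀ ℝ} {c : ℝ} :
    IsSimpleMeromorphic L c σ ↔ Mero (HasOrder L c) σ := by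
  constructor
  · rintro ⟨U, n, ℓ, s, τ, h0, hℓ, hτ, he⟩
    obtain ⟨r, hr, hrU⟩ := Metric.isOpen_iff.1 hτ.1 0 h0
    obtain ⟨a, ha⟩ := hτ.exists_famExpansion
    refine ⟨formProd ℓ s, formProd_mem_denominators hℓ s, r, hr, τ, ⟨a, ha.mono_set hrU⟩, ?_⟩
    filter_upwards [eventually_forall_realForm_ne_zero hℓ,
      germFilter_le_nhds (hτ.1.mem_nhds h0)] with z hz hzU using he z hzU hz
  · rintro ⟨d, hd, r, hr, τ, ⟨a, ha⟩, he⟩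
    obtain ⟨n, ℓ, s, q, r', hr', hle, hℓ, hq, hfp, hP⟩ := exists_formProd_of_eventually hd he hr
    refine ⟨ball 0 r', n, ℓ, s, fun z x => q z * τ z x, mem_ball_self hr', hℓ,
      ((ha.mono_set (ball_subset_ball hle)).smul_holo
        hq.differentiableOn).isSimpleHolomorphicFamily isOpen_ball (isConnected_ball hr'),
      fun z hz hne x => ?_⟩
    rw [hfp, mul_assoc, hP z hz hne x]

lemma isMeromorphicFunction_iff {f : (Fin k → ℂ) → ℂ} :
    IsMeromorphicFunction f ↔ Mero IsXConst (fun z _ => f z) := by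
  constructor
  · rintro ⟨U, n, ℓ, s, h, h0, hU, -, hℓ, hh, he⟩
    obtain ⟨r, hr, hrU⟩ := Metric.isOpen_iff.1 hU 0 h0
    refine ⟨formProd ℓ s, formProd_mem_denominators hℓ s, r, hr, fun z _ => h z,
      ⟨h, hh.mono hrU, fun _ _ _ => rfl⟩, ?_⟩
    filter_upwards [eventually_forall_realForm_ne_zero hℓ,
      germFilter_le_nhds (hU.mem_nhds h0)] with z hz hzU x using he z hzU hz
  · rintro ⟨d, hd, r, hr, τ, ⟨h, hh, hτ⟩, he⟩
    obtain ⟨n, ℓ, s, q, r', hr', hle, hℓ, hq, hfp, hP⟩ := exists_formProd_of_eventually hd he hr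
    refine ⟨ball 0 r', n, ℓ, s, fun z => q z * h z, mem_ball_self hr', isOpen_ball,
      isConnected_ball hr', hℓ, hq.differentiableOn.mul (hh.mono (ball_subset_ball hle)),
      fun z hz hne => ?_⟩
    rw [hfp, mul_assoc, hP z hz hne 0, hτ z (ball_subset_ball hle hz)]

end Mero

/-! ### Operations on families of symbols -/

section families

variable {k n : ℕ} {U V : Set (Fin k → ℂ)} {τ τ' : (Fin k → ℂ) → ℝ≥0 → ℂ} {L L' : Fin k →₀ ℝ}
  {c c' : ℝ}

lemma affine_add (L L' : Fin k →₀ ℝ) (c c' : ℝ) :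
    affine (L + L') (c + c') = affine L c + affine L' c' := by
  funext z; simp only [affine, realForm_add, Pi.add_apply]; push_cast; ring

lemma affine_affineSubst (L : Fin k →₀ ℝ) (c : ℝ) (T : (Fin k →₀ ℝ) →ₗ[ℝ] (Fin n →₀ ℝ))
    (b : (Fin k →₀ ℝ) →ₗ[ℝ] ℝ) : affine L c ∘ affineSubst T b = affine (T L) (c + b L) := by
  funext z; simp only [affine, realForm_affineSubst, Function.comp_apply]; push_cast; ring

lemma HasOrder.mono_set (h : HasOrder L c U τ) (hV : V ⊆ U) : HasOrder L c V τ :=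
  let ⟨a, ha⟩ := h; ⟨a, ha.mono_set hV⟩

lemma HasOrder.mul (h : HasOrder L c U τ) (h' : HasOrder L' c' U τ') :
    HasOrder (L + L') (c + c') U (τ * τ') := by
  obtain ⟨a, ha⟩ := h
  obtain ⟨a', ha'⟩ := h'
  exact ⟨_, by rw [affine_add]; exact ha.mul ha'⟩

lemma HasOrder.affineSubst (h : HasOrder L c U τ) {T : (Fin k →₀ ℝ) →ₗ[ℝ] (Fin n →₀ ℝ)}
    {b : (Fin k →₀ ℝ) →ₗ[ℝ] ℝ} {V : Set (Fin n → ℂ)} {g : (Fin n → ℂ) → ℂ}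
    (hg : DifferentiableOn ℂ g V) (hm : Set.MapsTo (affineSubst T b) V U) :
    HasOrder (T L) (c + b L) V (fun z x => g z * τ (affineSubst T b z) x) := by
  obtain ⟨a, ha⟩ := h
  have h1 := (ha.comp (differentiable_affineSubst T b).differentiableOn hm).smul_holo hg
  rw [affine_affineSubst] at h1
  exact ⟨_, h1⟩

lemma IsSmoothing.mono_set (h : IsSmoothing U τ) (hV : V ⊆ U) : IsSmoothing V τ :=
  fun s => (h s).mono_set hV

/-- A smoothing family may be given any order, even one that varies with the parameter. -/
lemma IsSmoothing.famSymbol (h : IsSmoothing U τ) (r : (Fin k → ℂ) → ℝ) : FamSymbol U r τ where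
  smooth := (h 0).smooth
  holo := (h 0).holo
  bound m z₀ hz₀ ε hε := (h (r z₀)).bound m z₀ hz₀ ε hε

lemma IsSmoothing.hasOrder (h : IsSmoothing U τ) (L : Fin k →₀ ℝ) (c : ℝ) : HasOrder L c U τ :=
  ⟨_, FamExpansion.of_smoothing (differentiable_affine L c).differentiableOn fun _ => h.famSymbol _⟩

lemma IsSmoothing.mul_hasOrder (h : IsSmoothing U τ) (h' : HasOrder L c U τ') :
    IsSmoothing U (τ * τ') := by
  obtain ⟨a, ha⟩ := h'
  intro s
  exact ((h.famSymbol fun z => s - (affine L c z).re).mul ha.famSymbol).mono fun z _ => by simp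

lemma IsSmoothing.affineSubst (h : IsSmoothing U τ) {T : (Fin k →₀ ℝ) →ₗ[ℝ] (Fin n →₀ ℝ)}
    {b : (Fin k →₀ ℝ) →ₗ[ℝ] ℝ} {V : Set (Fin n → ℂ)} {g : (Fin n → ℂ) → ℂ}
    (hg : DifferentiableOn ℂ g V) (hm : Set.MapsTo (affineSubst T b) V U) :
    IsSmoothing V (fun z x => g z * τ (affineSubst T b z) x) :=
  fun s => ((h s).comp (differentiable_affineSubst T b).differentiableOn hm).smul_holo hg

lemma IsXConst.mono_set (h : IsXConst U τ) (hV : V ⊆ U) : IsXConst V τ :=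
  let ⟨g, hg, he⟩ := h; ⟨g, hg.mono hV, fun z hz => he z (hV hz)⟩

lemma IsXConst.mul (h : IsXConst U τ) (h' : IsXConst U τ') : IsXConst U (τ * τ') := by
  obtain ⟨g, hg, he⟩ := h
  obtain ⟨g', hg', he'⟩ := h'
  exact ⟨g * g', hg.mul hg', fun z hz x => by simp [he z hz x, he' z hz x]⟩

lemma IsXConst.affineSubst (h : IsXConst U τ) {T : (Fin k →₀ ℝ) →ₗ[ℝ] (Fin n →₀ ℝ)}
    {b : (Fin k →₀ ℝ) →ₗ[ℝ] ℝ} {V : Set (Fin n → ℂ)} {g : (Fin n → ℂ) → ℂ}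
    (hg : DifferentiableOn ℂ g V) (hm : Set.MapsTo (affineSubst T b) V U) :
    IsXConst V (fun z x => g z * τ (affineSubst T b z) x) := by
  obtain ⟨h, hh, he⟩ := h
  exact ⟨fun z => g z * h (LocalitySymbols.affineSubst T b z),
    hg.mul (hh.comp (differentiable_affineSubst T b).differentiableOn hm),
    fun z hz x => by simp only [he _ (hm hz) x]⟩

lemma IsXConst.mul_pow (h : IsXConst U τ) (d : ℕ) :
    HasOrder 0 d U (fun z x => τ z x * ((x : ℝ) : ℂ) ^ d) := by
  obtain ⟨g, hg, he⟩ := h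
  have h1 : affine (0 : Fin k →₀ ℝ) (d : ℝ) = fun _ => (d : ℂ) := by
    funext z; simp [affine, realForm_zero_left]
  have h2 := (famExpansion_pow d).smul_holo hg
  rw [← h1] at h2
  refine ⟨_, h2.congr fun z hz => ?_⟩
  funext x
  rw [he z hz x]

end families

/-! ### Germs and their pull-backs -/

section germs

variable {ι κ μ : Type}

lemma toGerm_surjective : Function.Surjective (toGerm : ((ι → ℂ) → ℝ≥0 → ℂ) → SGerm ι) :=
  fun g => Filter.Germ.inductionOn g fun f => ⟨f, rfl⟩

lemma toGerm_eq_iff {f g : (ι → ℂ) → ℝ≥0 → ℂ} :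
    toGerm f = toGerm g ↔ ∀ᶠ z in germFilter ι, f z = g z := Filter.Germ.coe_eq

lemma toGerm_add (f g : (ι → ℂ) → ℝ≥0 → ℂ) : toGerm (f + g) = toGerm f + toGerm g := rfl

lemma toGerm_mul (f g : (ι → ℂ) → ℝ≥0 → ℂ) : toGerm (f * g) = toGerm f * toGerm g := rfl

lemma toGerm_smul (c : ℂ) (f : (ι → ℂ) → ℝ≥0 → ℂ) : toGerm (c • f) = c • toGerm f := rfl

lemma SGerm.smul_mul (c : ℂ) (g h : SGerm ι) : (c • g) * h = c • (g * h) := by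
  obtain ⟨g, rfl⟩ := toGerm_surjective g
  obtain ⟨h, rfl⟩ := toGerm_surjective h
  rw [← toGerm_smul, ← toGerm_mul, ← toGerm_mul, ← toGerm_smul, smul_mul_assoc]

/-- Products of elements of two spans. -/
lemma mul_mem_of_span {S S' : Set (SGerm ι)} {M : Submodule ℂ (SGerm ι)}
    (h : ∀ s ∈ S, ∀ s' ∈ S', s * s' ∈ M) {x y : SGerm ι} (hx : x ∈ Submodule.span ℂ S)
    (hy : y ∈ Submodule.span ℂ S') : x * y ∈ M := by
  induction hx using Submodule.span_induction with
  | zero => rw [zero_mul]; exact M.zero_mem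
  | add x x' _ _ hx hx' => rw [add_mul]; exact M.add_mem hx hx'
  | smul c x _ hx => rw [SGerm.smul_mul]; exact M.smul_mem c hx
  | mem x hx =>
    induction hy using Submodule.span_induction with
    | zero => rw [mul_zero]; exact M.zero_mem
    | add y y' _ _ hy hy' => rw [mul_add]; exact M.add_mem hy hy'
    | smul c y _ hy => rw [mul_comm, SGerm.smul_mul, mul_comm]; exact M.smul_mem c hy
    | mem y hy => exact h x hx y hy

/-- The pull-back of germs along the linear map with the injective transpose `T`. -/
def pullback {T : (κ →₀ ℝ) →ₗ[ℝ] (ι →₀ ℝ)} (hT : Function.Injective T) :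
    SGerm κ →ₗ[ℂ] SGerm ι where
  toFun g := g.compTendsto (affineSubst T 0) (tendsto_affineSubst hT)
  map_add' g h := by
    obtain ⟨g, rfl⟩ := toGerm_surjective g
    obtain ⟨h, rfl⟩ := toGerm_surjective h
    rfl
  map_smul' c g := by
    obtain ⟨g, rfl⟩ := toGerm_surjective g
    rfl

lemma pullback_toGerm {T : (κ →₀ ℝ) →ₗ[ℝ] (ι →₀ ℝ)} (hT : Function.Injective T)
    (f : (κ → ℂ) → ℝ≥0 → ℂ) : pullback hT (toGerm f) = toGerm (f ∘ affineSubst T 0) := rfl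

lemma pullback_mul {T : (κ →₀ ℝ) →ₗ[ℝ] (ι →₀ ℝ)} (hT : Function.Injective T) (g h : SGerm κ) :
    pullback hT (g * h) = pullback hT g * pullback hT h := by
  obtain ⟨g, rfl⟩ := toGerm_surjective g
  obtain ⟨h, rfl⟩ := toGerm_surjective h
  rfl

lemma pullback_pullback {T : (κ →₀ ℝ) →ₗ[ℝ] (ι →₀ ℝ)} (hT : Function.Injective T)
    {S : (ι →₀ ℝ) →ₗ[ℝ] (μ →₀ ℝ)} (hS : Function.Injective S)
    {R : (κ →₀ ℝ) →ₗ[ℝ] (μ →₀ ℝ)} (hR : Function.Injective R) (h : S ∘ₗ T = R) (g : SGerm κ) :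
    pullback hS (pullback hT g) = pullback hR g := by
  obtain ⟨g, rfl⟩ := toGerm_surjective g
  simp only [pullback_toGerm, Function.comp_assoc]
  congr 2
  funext z
  simp [affineSubst_affineSubst, h]

end germs

section meromorphicGerms

variable {k n : ℕ}

lemma mem_meromorphicGerms {L : Fin k →₀ ℝ} {c : ℝ} {σ : (Fin k → ℂ) → ℝ≥0 → ℂ}
    (h : Mero (HasOrder L c) σ) : toGerm σ ∈ meromorphicGerms k :=
  Submodule.subset_span ⟨L, c, σ, isSimpleMeromorphic_iff.2 h, rfl⟩

lemma Mero.mul_hasOrder {L L' : Fin k →₀ ℝ} {c c' : ℝ} {σ σ' : (Fin k → ℂ) → ℝ≥0 → ℂ}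
    (h : Mero (HasOrder L c) σ) (h' : Mero (HasOrder L' c') σ') :
    Mero (HasOrder (L + L') (c + c')) (σ * σ') :=
  h.mul h' (fun _ _ _ hV h => h.mono_set hV) (fun _ _ _ hV h => h.mono_set hV)
    fun _ _ _ h h' => h.mul h'

lemma Mero.pullback_hasOrder {L : Fin k →₀ ℝ} {c : ℝ} {σ : (Fin k → ℂ) → ℝ≥0 → ℂ}
    (h : Mero (HasOrder L c) σ) {T : (Fin k →₀ ℝ) →ₗ[ℝ] (Fin n →₀ ℝ)}
    (hT : Function.Injective T) : Mero (HasOrder (T L) c) (σ ∘ affineSubst T 0) :=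
  h.pullback hT fun U V τ g hτ hg hm => by simpa using hτ.affineSubst hg hm

lemma mul_mem_meromorphicGerms {g h : SGerm (Fin k)} (hg : g ∈ meromorphicGerms k)
    (hh : h ∈ meromorphicGerms k) : g * h ∈ meromorphicGerms k := by
  refine mul_mem_of_span ?_ hg hh
  rintro _ ⟨L, c, σ, hσ, rfl⟩ _ ⟨L', c', σ', hσ', rfl⟩
  rw [← toGerm_mul]
  exact mem_meromorphicGerms ((isSimpleMeromorphic_iff.1 hσ).mul_hasOrder
    (isSimpleMeromorphic_iff.1 hσ'))

lemma pullback_mem_meromorphicGerms {T : (Fin k →₀ ℝ) →ₗ[ℝ] (Fin n →₀ ℝ)}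
    (hT : Function.Injective T) {g : SGerm (Fin k)} (hg : g ∈ meromorphicGerms k) :
    pullback hT g ∈ meromorphicGerms n := by
  induction hg using Submodule.span_induction with
  | mem g hg =>
    obtain ⟨L, c, σ, hσ, rfl⟩ := hg
    rw [pullback_toGerm]
    exact mem_meromorphicGerms ((isSimpleMeromorphic_iff.1 hσ).pullback_hasOrder hT)
  | zero => rw [map_zero]; exact Submodule.zero_mem _
  | add x y _ _ hx hy => rw [map_add]; exact Submodule.add_mem _ hx hy
  | smul c x _ hx => rw [map_smul]; exact Submodule.smul_mem _ c hx

/-- Restrictions of meromorphic germs of symbols to generic affine subspaces are meromorphic germs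
of symbols. -/
lemma restrict_mem_meromorphicGerms {σ : (Fin k → ℂ) → ℝ≥0 → ℂ}
    (hσ : toGerm σ ∈ meromorphicGerms k) :
    ∃ Φ : Finset (Fin k →₀ ℝ), (∀ v ∈ Φ, v ≠ 0) ∧
      ∀ {n : ℕ} (T : (Fin k →₀ ℝ) →ₗ[ℝ] (Fin n →₀ ℝ)) (b : (Fin k →₀ ℝ) →ₗ[ℝ] ℝ),
      (∀ v ∈ Φ, T v = 0 → b v ≠ 0) → ∀ᶠ t in 𝓝[≠] (0 : ℝ),
        toGerm (σ ∘ affineSubst T (t • b)) ∈ meromorphicGerms n := by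
  classical
  suffices h : ∀ g ∈ meromorphicGerms k, ∃ σ', toGerm σ' = g ∧
      ∃ Φ : Finset (Fin k →₀ ℝ), (∀ v ∈ Φ, v ≠ 0) ∧
      ∀ {n : ℕ} (T : (Fin k →₀ ℝ) →ₗ[ℝ] (Fin n →₀ ℝ)) (b : (Fin k →₀ ℝ) →ₗ[ℝ] ℝ),
      (∀ v ∈ Φ, T v = 0 → b v ≠ 0) → ∀ᶠ t in 𝓝[≠] (0 : ℝ),
        toGerm (σ' ∘ affineSubst T (t • b)) ∈ meromorphicGerms n by
    obtain ⟨σ', hσ', Φ, hΦ, h1⟩ := h _ hσ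
    obtain ⟨Ψ, hΨ, h2⟩ := eventually_affineSubst (toGerm_eq_iff.1 hσ')
    refine ⟨Φ ∪ Ψ, fun v hv => (Finset.mem_union.1 hv).elim (hΦ v) (hΨ v), fun T b hb => ?_⟩
    filter_upwards [h1 T b fun v hv => hb v (Finset.mem_union_left _ hv),
      h2 T b fun v hv => hb v (Finset.mem_union_right _ hv)] with t ht ht'
    have h3 : toGerm (σ' ∘ affineSubst T (t • b)) = toGerm (σ ∘ affineSubst T (t • b)) :=
      toGerm_eq_iff.2 ht'
    rwa [← h3]
  intro g hg
  induction hg using Submodule.span_induction with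
  | mem g hg =>
    obtain ⟨L, c, σ, hσ, rfl⟩ := hg
    refine ⟨σ, rfl, ?_⟩
    obtain ⟨Φ, hΦ, h1⟩ := (isSimpleMeromorphic_iff.1 hσ).restrict
    refine ⟨Φ, hΦ, fun {n} T b hb => ?_⟩
    filter_upwards [h1 T b hb] with t ht
    exact mem_meromorphicGerms (ht (HasOrder (T L) (c + (t • b) L))
      fun U V τ g hτ hg hm => hτ.affineSubst hg hm)
  | zero =>
    exact ⟨0, rfl, ∅, by simp, fun T b _ => Filter.Eventually.of_forall fun t =>
      Submodule.zero_mem _⟩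
  | add x y _ _ hx hy =>
    obtain ⟨σ, rfl, Φ, hΦ, h1⟩ := hx
    obtain ⟨σ', rfl, Ψ, hΨ, h2⟩ := hy
    refine ⟨σ + σ', rfl, Φ ∪ Ψ, fun v hv => (Finset.mem_union.1 hv).elim (hΦ v) (hΨ v),
      fun T b hb => ?_⟩
    filter_upwards [h1 T b fun v hv => hb v (Finset.mem_union_left _ hv),
      h2 T b fun v hv => hb v (Finset.mem_union_right _ hv)] with t ht ht'
    exact Submodule.add_mem _ ht ht'
  | smul c x _ hx =>
    obtain ⟨σ, rfl, Φ, hΦ, h1⟩ := hx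
    refine ⟨c • σ, rfl, Φ, hΦ, fun T b hb => ?_⟩
    filter_upwards [h1 T b hb] with t ht
    exact Submodule.smul_mem _ c ht

end meromorphicGerms

/-! ### Generic functionals on linear forms -/

section generic

variable {V : Type*} [AddCommGroup V] [Module ℝ V]

lemma exists_annihilator (W : Submodule ℝ V) (Ψ : Finset V) :
    ∃ b : V →ₗ[ℝ] ℝ, (∀ w ∈ W, b w = 0) ∧ ∀ v ∈ Ψ, v ∉ W → b v ≠ 0 := by
  classical
  obtain ⟨f, hf⟩ := Module.exists_dual_forall_apply_ne_zero (K := ℝ)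
    (fun v : {v : Ψ // v.1 ∉ W} => W.mkQ v.1)
    fun v h0 => v.2 ((Submodule.Quotient.mk_eq_zero W).1 h0)
  refine ⟨f ∘ₗ W.mkQ, fun w hw => ?_, fun v hv hvW => hf ⟨⟨v, hv⟩, hvW⟩⟩
  rw [LinearMap.comp_apply, Submodule.mkQ_apply, (Submodule.Quotient.mk_eq_zero W).2 hw, map_zero]

/-- A linear projection that kills `W₁` and maps `W₂` to a complement of `W₁ ⊓ W₂` in `W₂`. -/
lemma exists_projection (W₁ W₂ : Submodule ℝ V) :
    ∃ p : V →ₗ[ℝ] V, (∀ v ∈ W₁, p v = 0) ∧ (∀ v ∈ W₂, v - p v ∈ W₁ ⊓ W₂) ∧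
      ∀ v, p v ∈ W₁ ⊓ W₂ → p v = 0 := by
  obtain ⟨C, hC⟩ := Submodule.exists_isCompl (W₁ ⊓ W₂)
  set D := C ⊓ W₂ with hD
  have hinj : LinearMap.ker (W₁.mkQ ∘ₗ D.subtype) = ⊥ := by
    rw [LinearMap.ker_eq_bot']
    intro d hd
    have h1 : (d : V) ∈ W₁ := (Submodule.Quotient.mk_eq_zero W₁).1 hd
    have h2 : (d : V) ∈ (W₁ ⊓ W₂) ⊓ C := ⟨⟨h1, d.2.2⟩, d.2.1⟩
    rw [hC.inf_eq_bot, Submodule.mem_bot] at h2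
    exact Subtype.ext h2
  obtain ⟨q, hq⟩ := LinearMap.exists_leftInverse_of_injective _ hinj
  refine ⟨D.subtype ∘ₗ q ∘ₗ W₁.mkQ, fun v hv => ?_, fun v hv => ?_, fun v hv => ?_⟩
  · simp [(Submodule.Quotient.mk_eq_zero W₁).2 hv]
  · have h1 : v ∈ (W₁ ⊓ W₂) ⊔ D := by
      rw [hD, ← sup_inf_assoc_of_le C inf_le_right, hC.sup_eq_top]
      exact ⟨trivial, hv⟩
    obtain ⟨w, hw, d, hd, rfl⟩ := Submodule.mem_sup.1 h1
    have h2 : q (W₁.mkQ d) = ⟨d, hd⟩ := LinearMap.congr_fun hq ⟨d, hd⟩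
    have h3 : W₁.mkQ w = 0 := (Submodule.Quotient.mk_eq_zero W₁).2 hw.1
    simp only [LinearMap.comp_apply, map_add, h2, h3, map_zero, zero_add, Submodule.subtype_apply]
    simpa using hw
  · have h2 : D.subtype (q (W₁.mkQ v)) ∈ (W₁ ⊓ W₂) ⊓ C := ⟨hv, (q (W₁.mkQ v)).2.1⟩
    rw [hC.inf_eq_bot, Submodule.mem_bot] at h2
    exact h2

lemma exists_linearIndependent_span (W : Submodule ℝ V) [FiniteDimensional ℝ W] :
    ∃ (k : ℕ) (L : Fin k → V), LinearIndependent ℝ L ∧ Submodule.span ℝ (Set.range L) = W := by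
  refine ⟨_, fun i => (Module.finBasis ℝ W i : V),
    (Module.finBasis ℝ W).linearIndependent.map' W.subtype (Submodule.ker_subtype W), ?_⟩
  have : Set.range (fun i => (Module.finBasis ℝ W i : V)) =
      W.subtype '' Set.range (Module.finBasis ℝ W) := by
    rw [← Set.range_comp]; rfl
  rw [this, Submodule.span_image, Module.Basis.span_eq, Submodule.map_top, Submodule.range_subtype]

end generic

/-! ### Dependence subspaces -/

section dependence

variable {g h : SGerm ℕ} {W W' W₁ W₂ : Submodule ℝ (ℕ →₀ ℝ)} {k : ℕ} {L : Fin k → (ℕ →₀ ℝ)}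

lemma affineSubst_linearCombination {ι κ : Type*} (L : κ → (ι →₀ ℝ)) (z : ι → ℂ) :
    affineSubst (Finsupp.linearCombination ℝ L) 0 z = fun i => realForm (L i) z := by
  funext i; simp [affineSubst]

lemma injective_linearCombination (hL : LinearIndependent ℝ L) :
    Function.Injective (Finsupp.linearCombination ℝ L) := hL

/-- The pull-back along the map `z ↦ (L₁(z), …, L_k(z))` for independent linear forms `Lᵢ`. -/
abbrev formPullback (hL : LinearIndependent ℝ L) : SGerm (Fin k) →ₗ[ℂ] SGerm ℕ :=
  pullback (injective_linearCombination hL)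

lemma formPullback_toGerm (hL : LinearIndependent ℝ L) (τ : (Fin k → ℂ) → ℝ≥0 → ℂ) :
    formPullback hL (toGerm τ) = toGerm fun z => τ fun i => realForm (L i) z := by
  rw [formPullback, pullback_toGerm]
  congr 1
  funext z
  rw [Function.comp_apply, affineSubst_linearCombination]

lemma dependsOn_iff : DependsOn g W ↔ ∃ (k : ℕ) (L : Fin k → (ℕ →₀ ℝ))
    (hL : LinearIndependent ℝ L), Submodule.span ℝ (Set.range L) = W ∧
      ∃ γ ∈ meromorphicGerms k, g = formPullback hL γ := by
  constructor
  · rintro ⟨k, L, τ, hL, hW, hτ, rfl⟩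
    exact ⟨k, L, hL, hW, toGerm τ, hτ, (formPullback_toGerm hL τ).symm⟩
  · rintro ⟨k, L, hL, hW, γ, hγ, rfl⟩
    obtain ⟨τ, rfl⟩ := toGerm_surjective γ
    exact ⟨k, L, τ, hL, hW, hγ, formPullback_toGerm hL τ⟩

lemma DependsOn.finiteDimensional (hg : DependsOn g W) : FiniteDimensional ℝ W := by
  obtain ⟨k, L, _, -, rfl, -⟩ := hg
  exact FiniteDimensional.span_of_finite ℝ (Set.finite_range L)

/-- A left inverse of the map `x ↦ ∑ xᵢ Lᵢ`. -/
lemma exists_section (hL : LinearIndependent ℝ L) :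
    ∃ S : (ℕ →₀ ℝ) →ₗ[ℝ] (Fin k →₀ ℝ),
      (∀ x, S (Finsupp.linearCombination ℝ L x) = x) ∧
      ∀ v ∈ Submodule.span ℝ (Set.range L), Finsupp.linearCombination ℝ L (S v) = v := by
  obtain ⟨S, hS⟩ := LinearMap.exists_leftInverse_of_injective (Finsupp.linearCombination ℝ L)
    (LinearMap.ker_eq_bot.2 hL)
  have h1 : ∀ x, S (Finsupp.linearCombination ℝ L x) = x := fun x => LinearMap.congr_fun hS x
  refine ⟨S, h1, fun v hv => ?_⟩
  rw [← Finsupp.range_linearCombination] at hv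
  obtain ⟨x, rfl⟩ := hv
  rw [h1]

lemma linearCombination_mem_span {n : ℕ} (M : Fin n → (ℕ →₀ ℝ)) (x : Fin n →₀ ℝ) :
    Finsupp.linearCombination ℝ M x ∈ Submodule.span ℝ (Set.range M) := by
  rw [← Finsupp.range_linearCombination]; exact ⟨x, rfl⟩

/-- Between systems of independent forms whose spans are nested there is an injective transition
map. -/
lemma exists_transition {n : ℕ} {M : Fin n → (ℕ →₀ ℝ)} (hM : LinearIndependent ℝ M)
    (hL : LinearIndependent ℝ L)
    (hle : Submodule.span ℝ (Set.range M) ≤ Submodule.span ℝ (Set.range L)) :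
    ∃ T : (Fin n →₀ ℝ) →ₗ[ℝ] (Fin k →₀ ℝ), Function.Injective T ∧
      Finsupp.linearCombination ℝ L ∘ₗ T = Finsupp.linearCombination ℝ M := by
  obtain ⟨S, -, hS⟩ := exists_section hL
  have h1 : Finsupp.linearCombination ℝ L ∘ₗ (S ∘ₗ Finsupp.linearCombination ℝ M) =
      Finsupp.linearCombination ℝ M :=
    LinearMap.ext fun x => hS _ (hle (linearCombination_mem_span M x))
  refine ⟨S ∘ₗ Finsupp.linearCombination ℝ M, fun x y hxy => hM ?_, h1⟩
  rw [← h1]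
  exact congrArg (Finsupp.linearCombination ℝ L) hxy

lemma DependsOn.exists_formPullback (hg : DependsOn g W) (hL : LinearIndependent ℝ L)
    (hle : W ≤ Submodule.span ℝ (Set.range L)) :
    ∃ γ ∈ meromorphicGerms k, g = formPullback hL γ := by
  obtain ⟨n, M, hM, rfl, γ, hγ, rfl⟩ := dependsOn_iff.1 hg
  obtain ⟨T, hT, hTM⟩ := exists_transition hM hL hle
  exact ⟨pullback hT γ, pullback_mem_meromorphicGerms hT hγ, (pullback_pullback hT hL hM hTM γ).symm⟩

lemma DependsOn.exists_common (hg : DependsOn g W₁) (hh : DependsOn h W₂) :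
    ∃ (k : ℕ) (L : Fin k → (ℕ →₀ ℝ)) (hL : LinearIndependent ℝ L),
      Submodule.span ℝ (Set.range L) = W₁ ⊔ W₂ ∧ (∃ γ ∈ meromorphicGerms k, g = formPullback hL γ) ∧
      ∃ η ∈ meromorphicGerms k, h = formPullback hL η := by
  have := hg.finiteDimensional
  have := hh.finiteDimensional
  obtain ⟨k, L, hL, hspan⟩ := exists_linearIndependent_span (W₁ ⊔ W₂)
  exact ⟨k, L, hL, hspan, hg.exists_formPullback hL (hspan ▸ le_sup_left),
    hh.exists_formPullback hL (hspan ▸ le_sup_right)⟩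

lemma DependsOn.add (hg : DependsOn g W₁) (hh : DependsOn h W₂) : DependsOn (g + h) (W₁ ⊔ W₂) := by
  obtain ⟨k, L, hL, hspan, ⟨γ, hγ, rfl⟩, η, hη, rfl⟩ := hg.exists_common hh
  exact dependsOn_iff.2 ⟨k, L, hL, hspan, γ + η, Submodule.add_mem _ hγ hη, (map_add _ _ _).symm⟩

lemma DependsOn.mul (hg : DependsOn g W₁) (hh : DependsOn h W₂) : DependsOn (g * h) (W₁ ⊔ W₂) := by
  obtain ⟨k, L, hL, hspan, ⟨γ, hγ, rfl⟩, η, hη, rfl⟩ := hg.exists_common hh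
  exact dependsOn_iff.2 ⟨k, L, hL, hspan, γ * η, mul_mem_meromorphicGerms hγ hη,
    (pullback_mul _ _ _).symm⟩

lemma DependsOn.smul (hg : DependsOn g W) (c : ℂ) : DependsOn (c • g) W := by
  obtain ⟨k, L, hL, hspan, γ, hγ, rfl⟩ := dependsOn_iff.1 hg
  exact dependsOn_iff.2 ⟨k, L, hL, hspan, c • γ, Submodule.smul_mem _ c hγ, (map_smul _ _ _).symm⟩

/-- A functional which vanishes on `W` and on no element of `Ψ` outside `W`. -/
def IsGenericFor (W : Submodule ℝ (ℕ →₀ ℝ)) (Ψ : Finset (ℕ →₀ ℝ)) (b : (ℕ →₀ ℝ) →ₗ[ℝ] ℝ) : Prop :=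
  (∀ w ∈ W, b w = 0) ∧ ∀ v ∈ Ψ, v ∉ W → b v ≠ 0

lemma IsGenericFor.mono {Ψ Ψ' : Finset (ℕ →₀ ℝ)} {b : (ℕ →₀ ℝ) →ₗ[ℝ] ℝ}
    (h : IsGenericFor W Ψ b) (hΨ : Ψ' ⊆ Ψ) : IsGenericFor W Ψ' b :=
  ⟨h.1, fun v hv => h.2 v (hΨ hv)⟩

/-- The slice `u ↦ (point with Lᵢ = uᵢ)`, displaced in a generic direction on which the `Lᵢ`
vanish, meets the domain of every germ. -/
lemma eventually_slice {P : (ℕ → ℂ) → Prop} (hP : ∀ᶠ z in germFilter ℕ, P z)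
    {S : (ℕ →₀ ℝ) →ₗ[ℝ] (Fin k →₀ ℝ)} (hS : ∀ v ∈ W, S v = 0 → v = 0) :
    ∃ Ψ : Finset (ℕ →₀ ℝ), ∀ b, IsGenericFor W Ψ b →
      ∀ᶠ t in 𝓝[≠] (0 : ℝ), ∀ᶠ u in germFilter (Fin k), P (affineSubst S (t • b) u) := by
  obtain ⟨Φ, hΦ, h⟩ := eventually_affineSubst hP
  exact ⟨Φ, fun b hb => h S b fun v hv h0 => hb.2 v hv fun hvW => hΦ v hv (hS v hvW h0)⟩

/-- If a germ depends on `W₁` and on `W₂`, it depends on their intersection: it is determined by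
its restriction to a generic slice transversal to the forms in `W₁ ⊓ W₂`. -/
lemma DependsOn.inf (hg₁ : DependsOn g W₁) (hg₂ : DependsOn g W₂) : DependsOn g (W₁ ⊓ W₂) := by
  classical
  obtain ⟨f, rfl⟩ := toGerm_surjective g
  obtain ⟨k₁, L₁, τ₁, hL₁, hW₁, hτ₁, he₁⟩ := hg₁
  obtain ⟨k₂, L₂, τ₂, hL₂, hW₂, hτ₂, he₂⟩ := hg₂
  have hfin : FiniteDimensional ℝ W₁ := hW₁ ▸ FiniteDimensional.span_of_finite ℝ (Set.finite_range L₁)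
  have : FiniteDimensional ℝ (W₁ ⊓ W₂ : Submodule ℝ (ℕ →₀ ℝ)) :=
    Submodule.finiteDimensional_of_le (inf_le_left : W₁ ⊓ W₂ ≤ W₁)
  obtain ⟨k, L, hL, hW⟩ := exists_linearIndependent_span (W₁ ⊓ W₂)
  obtain ⟨S, hS1, hS2⟩ := exists_section hL
  rw [hW] at hS2
  obtain ⟨p, hp1, hp2, hp3⟩ := exists_projection W₁ W₂
  have hE1 := toGerm_eq_iff.1 he₁
  have hE2 := toGerm_eq_iff.1 he₂
  -- `y` agrees with `z` on the forms in `W₁`, and with the projection `z'` of `z` to the slice on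
  -- the forms in `W₂`
  set Λ := Finsupp.linearCombination ℝ L with hΛ
  set R : (ℕ →₀ ℝ) →ₗ[ℝ] (ℕ →₀ ℝ) := LinearMap.id - p + Λ ∘ₗ S ∘ₗ p with hR
  obtain ⟨Φ₁, hΦ₁, hy1⟩ := eventually_affineSubst hE1
  obtain ⟨Φ₂, hΦ₂, hy2⟩ := eventually_affineSubst hE2
  obtain ⟨Φ₃, hΦ₃, hmero⟩ := restrict_mem_meromorphicGerms hτ₁
  set Λ₁ := Finsupp.linearCombination ℝ L₁ with hΛ₁
  obtain ⟨b, hbW, hb⟩ := exists_annihilator (W₁ ⊓ W₂)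
    (Φ₁ ∪ Φ₂ ∪ (Φ₁ ∪ Φ₂).image p ∪ Φ₃.image Λ₁)
  have hbΦ : ∀ v ∈ Φ₁ ∪ Φ₂, v ∉ W₁ ⊓ W₂ → b v ≠ 0 := fun v hv =>
    hb v (Finset.mem_union_left _ (Finset.mem_union_left _ hv))
  have hbp : ∀ v ∈ Φ₁ ∪ Φ₂, p v ∉ W₁ ⊓ W₂ → b (p v) ≠ 0 := fun v hv =>
    hb _ (Finset.mem_union_left _ (Finset.mem_union_right _ (Finset.mem_image_of_mem _ hv)))
  have hΦne : ∀ v ∈ Φ₁ ∪ Φ₂, v ≠ 0 := fun v hv => (Finset.mem_union.1 hv).elim (hΦ₁ v) (hΦ₂ v)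
  have goody : ∀ v ∈ Φ₁ ∪ Φ₂, R v = 0 → (b ∘ₗ p) v ≠ 0 := by
    intro v hv h0
    refine hbp v hv fun hpv => hΦne v hv ?_
    have := hp3 v hpv
    simpa [hR, this] using h0
  have goodz : ∀ v ∈ Φ₁ ∪ Φ₂, (Λ ∘ₗ S) v = 0 → b v ≠ 0 := by
    intro v hv h0
    refine hbΦ v hv fun hvW => hΦne v hv ?_
    rwa [LinearMap.comp_apply, hS2 v hvW] at h0
  have goods : ∀ v ∈ Φ₁ ∪ Φ₂, S v = 0 → b v ≠ 0 := fun v hv h0 =>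
    goodz v hv (by rw [LinearMap.comp_apply, h0, map_zero])
  have goodm : ∀ v ∈ Φ₃, (S ∘ₗ Λ₁) v = 0 → (b ∘ₗ Λ₁) v ≠ 0 := by
    intro v hv h0
    refine hb _ (Finset.mem_union_right _ (Finset.mem_image_of_mem _ hv)) fun hvW => hΦ₃ v hv ?_
    have h1 := hS2 _ hvW
    rw [show S (Λ₁ v) = 0 from h0, map_zero] at h1
    exact (map_eq_zero_iff Λ₁ hL₁).1 h1.symm
  have hA := hy1 (ι := ℕ) R (b ∘ₗ p) fun v hv => goody v (Finset.mem_union_left _ hv)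
  have hB := hy2 (ι := ℕ) R (b ∘ₗ p) fun v hv => goody v (Finset.mem_union_right _ hv)
  have hC := hy2 (ι := ℕ) (Λ ∘ₗ S) b fun v hv => goodz v (Finset.mem_union_right _ hv)
  have hD := hy1 (ι := Fin k) S b fun v hv => goods v (Finset.mem_union_left _ hv)
  obtain ⟨t, htA, htB, htC, htD, htm⟩ :=
    (hA.and (hB.and (hC.and (hD.and (hmero (S ∘ₗ Λ₁) (b ∘ₗ Λ₁) goodm))))).exists
  refine ⟨k, L, f ∘ affineSubst S (t • b), hL, hW, ?_, ?_⟩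
  · have h1 : toGerm (f ∘ affineSubst S (t • b)) =
        toGerm (τ₁ ∘ affineSubst (S ∘ₗ Λ₁) (t • (b ∘ₗ Λ₁))) := by
      refine toGerm_eq_iff.2 ?_
      filter_upwards [htD] with u hu
      rw [Function.comp_apply, hu, ← affineSubst_linearCombination, affineSubst_affineSubst]
      simp [hΛ₁, LinearMap.smul_comp]
    rw [h1]
    exact htm
  · refine toGerm_eq_iff.2 ?_
    filter_upwards [hE1, htA, htB, htC] with z h1 h2 h3 h4
    have e1 : (fun i => realForm (L₁ i) (affineSubst R (t • (b ∘ₗ p)) z)) =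
        fun i => realForm (L₁ i) z := by
      funext i
      have hi : L₁ i ∈ W₁ := hW₁ ▸ Submodule.subset_span (Set.mem_range_self i)
      simp [realForm_affineSubst, hR, hp1 _ hi]
    have e2 : (fun i => realForm (L₂ i) (affineSubst R (t • (b ∘ₗ p)) z)) =
        fun i => realForm (L₂ i) (affineSubst (Λ ∘ₗ S) (t • b) z) := by
      funext i
      have hi : L₂ i ∈ W₂ := hW₂ ▸ Submodule.subset_span (Set.mem_range_self i)
      have h5 := hS2 _ (hp2 _ hi)
      have h6 := hbW _ (hp2 _ hi)
      rw [map_sub, map_sub, sub_eq_iff_eq_add] at h5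
      rw [map_sub, sub_eq_zero] at h6
      simp [realForm_affineSubst, hR, h5, h6]
    have e3 : affineSubst S (t • b) (fun i => realForm (L i) z) =
        affineSubst (Λ ∘ₗ S) (t • b) z := by
      rw [← affineSubst_linearCombination, affineSubst_affineSubst]
      simp [hΛ]
    rw [Function.comp_apply, e3, h4, ← e2, ← h3, h2, e1, h1]

/-- The dependence subspace is the least subspace of dependence. -/
lemma isLeast_Dep (hg : DependsOn g W) : IsLeast {W | DependsOn g W} (Dep g) := by
  have hne : {W | DependsOn g W}.Nonempty := ⟨W, hg⟩
  obtain ⟨W₀, hW₀, hmin⟩ : ∃ W₀, DependsOn g W₀ ∧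
      ∀ W, DependsOn g W → Module.finrank ℝ W₀ ≤ Module.finrank ℝ W := by
    obtain ⟨W₀, hW₀, h⟩ := WellFounded.has_min
      (InvImage.wf (fun W : Submodule ℝ (ℕ →₀ ℝ) => Module.finrank ℝ W) wellFounded_lt) _ hne
    exact ⟨W₀, hW₀, fun W hW => not_lt.1 (h W hW)⟩
  have hle : ∀ W, DependsOn g W → W₀ ≤ W := by
    intro W hW
    have := hW₀.finiteDimensional
    have h1 := Submodule.eq_of_le_of_finrank_le (inf_le_left : W₀ ⊓ W ≤ W₀) (hmin _ (hW₀.inf hW))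
    exact inf_eq_left.1 h1
  have hleast : IsLeast {W | DependsOn g W} W₀ := ⟨hW₀, fun W hW => hle W hW⟩
  rwa [Dep, hleast.isGLB.sInf_eq]

lemma Dep_le (hg : DependsOn g W) : Dep g ≤ W := sInf_le hg

end dependence

/-! ### Uniqueness of asymptotic expansions -/

section asymptotics

open Filter Asymptotics

/-- The finite sum `∑ c(e) x ^ e` of complex powers. -/
def expSum (x : ℝ) : (ℂ →₀ ℂ) →ₗ[ℂ] ℂ := Finsupp.linearCombination ℂ fun e => (x : ℂ) ^ e

lemma expSum_single (x : ℝ) (e a : ℂ) : expSum x (Finsupp.single e a) = a * (x : ℂ) ^ e := by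
  simp [expSum]

lemma isBigO_cpow {e : ℂ} {M : ℝ} (h : e.re ≤ M) :
    (fun x : ℝ => (x : ℂ) ^ e) =O[atTop] fun x => x ^ M := by
  refine IsBigO.of_bound 1 ?_
  filter_upwards [eventually_ge_atTop 1] with x hx
  have hx0 : 0 < x := by linarith
  rw [Complex.norm_cpow_eq_rpow_re_of_pos hx0, Real.norm_of_nonneg (Real.rpow_nonneg hx0.le _),
    one_mul]
  exact Real.rpow_le_rpow_of_exponent_le hx h

lemma eq_zero_of_isBigO_cpow {e a : ℂ} {M : ℝ} (h : M < e.re)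
    (hO : (fun x : ℝ => a * (x : ℂ) ^ e) =O[atTop] fun x => x ^ M) : a = 0 := by
  by_contra ha
  obtain ⟨C, hC⟩ := hO.bound
  have h1 : Tendsto (fun x : ℝ => ‖a‖ * x ^ (e.re - M)) atTop atTop :=
    (tendsto_rpow_atTop (sub_pos.2 h)).const_mul_atTop (norm_pos_iff.2 ha)
  obtain ⟨x, h2, h3, h4⟩ := (hC.and ((h1.eventually_gt_atTop C).and (eventually_gt_atTop 0))).exists
  rw [norm_mul, Complex.norm_cpow_eq_rpow_re_of_pos h4,
    Real.norm_of_nonneg (Real.rpow_nonneg h4.le _)] at h2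
  rw [Real.rpow_sub h4, ← mul_div_assoc, lt_div_iff₀ (Real.rpow_pos_of_pos h4 _)] at h3
  linarith

/-- Finitely many complex numbers are separated by the powers of some positive real number. -/
lemma exists_scale (s : Finset ℂ) (e₀ : ℂ) (he : e₀ ∉ s) :
    ∃ l : ℝ, 0 < l ∧ ∀ e ∈ s, (l : ℂ) ^ e ≠ (l : ℂ) ^ e₀ := by
  have h1 : ∀ e ∈ s, ∀ᶠ h : ℝ in 𝓝[≠] (0 : ℝ), Complex.exp ((h : ℂ) * (e - e₀)) ≠ 1 := by
    intro e hes
    have hd : HasDerivAt (fun h : ℝ => Complex.exp (h * (e - e₀))) (e - e₀) 0 := by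
      have h2 : HasDerivAt (fun h : ℝ => (h : ℂ) * (e - e₀)) (1 * (e - e₀)) 0 :=
        (Complex.ofRealCLM.hasDerivAt (x := (0 : ℝ))).mul_const _
      simpa using h2.cexp
    exact hd.eventually_ne (sub_ne_zero.2 fun h => he (h ▸ hes))
  obtain ⟨h, hh⟩ := ((Filter.eventually_all_finset s).2 h1).exists
  refine ⟨Real.exp h, Real.exp_pos h, fun e hes heq => hh e hes ?_⟩
  have hne : ((Real.exp h : ℝ) : ℂ) ≠ 0 := by exact_mod_cast (Real.exp_pos h).ne'
  rw [Complex.cpow_def_of_ne_zero hne, Complex.cpow_def_of_ne_zero hne,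
    ← Complex.ofReal_log (Real.exp_pos h).le, Real.log_exp] at heq
  rw [mul_sub, Complex.exp_sub, heq, div_self (Complex.exp_ne_zero _)]

/-- A finite sum of distinct complex powers that decays faster than each of them is zero: the
exponents are removed one by one with the operators `f ↦ f(l x) - l ^ e f(x)`. -/
lemma eq_zero_of_isBigO_sum {M : ℝ} (s : Finset ℂ) :
    ∀ c : ℂ → ℂ, (∀ e ∈ s, M < e.re) →
      (fun x : ℝ => ∑ e ∈ s, c e * (x : ℂ) ^ e) =O[atTop] (fun x => x ^ M) → ∀ e ∈ s, c e = 0 := by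
  induction s using Finset.induction_on with
  | empty => simp
  | insert e₀ s he₀ ih =>
    intro c hM hO
    obtain ⟨l, hl, hsep⟩ := exists_scale s e₀ he₀
    have hscale : (fun x : ℝ => ∑ e ∈ insert e₀ s, c e * ((l * x : ℝ) : ℂ) ^ e)
        =O[atTop] fun x => x ^ M := by
      have h1 := hO.comp_tendsto (tendsto_id.const_mul_atTop hl)
      refine h1.trans (IsBigO.of_bound (l ^ M) ?_)
      filter_upwards [eventually_gt_atTop 0] with x hx
      simp only [Function.comp_apply, id_eq]
      rw [Real.mul_rpow hl.le hx.le, norm_mul, Real.norm_of_nonneg (Real.rpow_nonneg hl.le _)]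
    have hdiff := hscale.sub (hO.const_mul_left ((l : ℂ) ^ e₀))
    have h2 : ∀ e ∈ s, c e * ((l : ℂ) ^ e - (l : ℂ) ^ e₀) = 0 := by
      refine ih (fun e => c e * ((l : ℂ) ^ e - (l : ℂ) ^ e₀))
        (fun e he => hM e (Finset.mem_insert_of_mem he)) (hdiff.congr' ?_ EventuallyEq.rfl)
      filter_upwards [eventually_gt_atTop 0] with x hx
      rw [Finset.mul_sum, ← Finset.sum_sub_distrib, Finset.sum_insert he₀]
      have h3 : ∀ e : ℂ, ((l * x : ℝ) : ℂ) ^ e = (l : ℂ) ^ e * (x : ℂ) ^ e := fun e => by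
        rw [Complex.ofReal_mul, Complex.mul_cpow_ofReal_nonneg hl.le hx.le]
      simp only [h3]
      rw [show c e₀ * ((l : ℂ) ^ e₀ * (x : ℂ) ^ e₀) - (l : ℂ) ^ e₀ * (c e₀ * (x : ℂ) ^ e₀) = 0 by
        ring, zero_add]
      exact Finset.sum_congr rfl fun e _ => by ring
    have h4 : ∀ e ∈ s, c e = 0 := fun e he =>
      (mul_eq_zero.1 (h2 e he)).resolve_right (sub_ne_zero.2 (hsep e he))
    have h5 : c e₀ = 0 := by
      refine eq_zero_of_isBigO_cpow (hM e₀ (Finset.mem_insert_self _ _)) (hO.congr_left fun x => ?_)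
      rw [Finset.sum_insert he₀, Finset.sum_eq_zero fun e he => by rw [h4 e he, zero_mul], add_zero]
    intro e he
    rcases Finset.mem_insert.1 he with rfl | he
    · exact h5
    · exact h4 e he

lemma eq_zero_of_isBigO_expSum {M : ℝ} {c : ℂ →₀ ℂ} (hM : ∀ e, c e ≠ 0 → M < e.re)
    (hO : (fun x : ℝ => expSum x c) =O[atTop] fun x => x ^ M) : c = 0 := by
  have h1 := eq_zero_of_isBigO_sum c.support c (fun e he => hM e (Finsupp.mem_support_iff.1 he))
    (hO.congr_left fun x => by simp [expSum, Finsupp.linearCombination_apply, Finsupp.sum])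
  ext e
  by_contra h
  exact h (h1 e (Finsupp.mem_support_iff.2 h))

/-- The function `φ` on `[0, ∞)` is rapidly decreasing at infinity. -/
def IsRapid (φ : ℝ≥0 → ℂ) : Prop := ∀ M : ℕ, extend φ =O[atTop] fun x => x ^ (-(M : ℝ))

/-- The function `φ` on `[0, ∞)` has an asymptotic expansion at infinity in complex powers with
exponents in `E`. -/
def HasExponents (E : Set ℂ) (φ : ℝ≥0 → ℂ) : Prop :=
  ∀ M : ℕ, ∃ c : ℂ →₀ ℂ, (∀ e, c e ≠ 0 → e ∈ E) ∧
    (fun x => extend φ x - expSum x c) =O[atTop] fun x => x ^ (-(M : ℝ))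

variable {E E' : Set ℂ} {φ ψ : ℝ≥0 → ℂ}

lemma HasExponents.mono (h : HasExponents E φ) (hE : E ⊆ E') : HasExponents E' φ := fun M =>
  let ⟨c, hc, hO⟩ := h M; ⟨c, fun e he => hE (hc e he), hO⟩

lemma HasExponents.add (hφ : HasExponents E φ) (hψ : HasExponents E ψ) :
    HasExponents E (φ + ψ) := by
  intro M
  obtain ⟨c, hc, hO⟩ := hφ M
  obtain ⟨d, hd, hO'⟩ := hψ M
  refine ⟨c + d, fun e he => ?_, (hO.add hO').congr_left fun x => ?_⟩
  · by_cases h : c e = 0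
    · exact hd e fun h' => he (by simp [h, h'])
    · exact hc e h
  · rw [map_add]; simp only [extend, Pi.add_apply]; ring

lemma HasExponents.const_mul (hφ : HasExponents E φ) (a : ℂ) :
    HasExponents E (fun x => a * φ x) := by
  intro M
  obtain ⟨c, hc, hO⟩ := hφ M
  refine ⟨a • c, fun e he => hc e fun h => he (by simp [h]),
    (hO.const_mul_left a).congr_left fun x => ?_⟩
  rw [map_smul, smul_eq_mul]; simp only [extend]; ring

lemma HasExponents.zero : HasExponents E (0 : ℝ≥0 → ℂ) := fun M =>
  ⟨0, by simp, by simpa [extend] using isBigO_zero _ _⟩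

lemma HasExponents.pow (d : ℕ) (hd : (d : ℂ) ∈ E) :
    HasExponents E (fun x => ((x : ℝ) : ℂ) ^ d) := by
  intro M
  refine ⟨Finsupp.single d 1, fun e he => ?_, ?_⟩
  · rw [Finsupp.single_apply_ne_zero] at he
    exact he.1 ▸ hd
  · refine (isBigO_zero _ _).congr' ?_ EventuallyEq.rfl
    filter_upwards [eventually_ge_atTop 0] with x hx
    simp [expSum_single, extend, Real.coe_toNNReal x hx]

/-- Two asymptotic expansions of a function with disjoint sets of exponents vanish. -/
lemma HasExponents.isRapid (h : HasExponents E φ) (h' : HasExponents E' φ) (hd : Disjoint E E') :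
    IsRapid φ := by
  intro M
  classical
  obtain ⟨c, hc, hO⟩ := h M
  obtain ⟨c', hc', hO'⟩ := h' M
  -- the part of the expansion which is not absorbed by the error term
  have htrunc : ∀ c : ℂ →₀ ℂ, (fun x => expSum x c - expSum x (c.filter fun e => -(M : ℝ) < e.re))
      =O[atTop] fun x : ℝ => x ^ (-(M : ℝ)) := by
    intro c
    have h1 : (fun x : ℝ => ∑ e ∈ (c.filter fun e => ¬ -(M : ℝ) < e.re).support,
        (c.filter fun e => ¬ -(M : ℝ) < e.re) e * (x : ℂ) ^ e) =O[atTop]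
        fun x : ℝ => x ^ (-(M : ℝ)) := by
      refine IsBigO.fun_sum fun e he => (isBigO_cpow ?_).const_mul_left _
      rw [Finsupp.support_filter, Finset.mem_filter] at he
      exact not_lt.1 he.2
    refine h1.congr_left fun x => ?_
    have h2 : expSum x c = expSum x (c.filter fun e => -(M : ℝ) < e.re) +
        expSum x (c.filter fun e => ¬ -(M : ℝ) < e.re) := by
      rw [← map_add, Finsupp.filter_add_filter_not]
    rw [h2, add_sub_cancel_left]
    simp only [expSum, Finsupp.linearCombination_apply, Finsupp.sum, smul_eq_mul]
  have h1 := hO.add (htrunc c)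
  have h2 := hO'.add (htrunc c')
  have h3 := (h2.sub h1).congr_left (f₂ := fun x => expSum x
      (c.filter (fun e => -(M : ℝ) < e.re) - c'.filter fun e => -(M : ℝ) < e.re)) fun x => by
    rw [map_sub]; ring
  have h4 := eq_zero_of_isBigO_expSum (fun e he => by
    by_contra hlt
    exact he (by simp [hlt])) h3
  have h5 : c.filter (fun e => -(M : ℝ) < e.re) = 0 := by
    ext e
    have h6 := DFunLike.congr_fun h4 e
    simp only [Finsupp.sub_apply, Finsupp.coe_zero, Pi.zero_apply, Finsupp.filter_apply] at h6 ⊢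
    split_ifs at h6 ⊢
    · by_contra hne
      refine Set.disjoint_left.1 hd (hc e hne) (hc' e fun h0 => hne ?_)
      rw [h0, sub_zero] at h6; exact h6
    · rfl
  refine h1.congr_left fun x => ?_
  rw [h5, map_zero]; ring

lemma isBigO_of_isSymbol {M : ℕ} (h : IsSymbol (-(M : ℝ)) φ) :
    extend φ =O[atTop] fun x => x ^ (-(M : ℝ)) := by
  obtain ⟨D, hD0, hD⟩ := h.2 0
  refine IsBigO.of_bound D ?_
  filter_upwards [eventually_gt_atTop 0] with x hx
  have h1 := hD x.toNNReal
  rw [xDeriv_zero] at h1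
  refine h1.trans (mul_le_mul_of_nonneg_left ?_ hD0.le)
  rw [Real.norm_of_nonneg (Real.rpow_nonneg hx.le _)]
  have h2 := coe_le_bracket x.toNNReal
  rw [Real.coe_toNNReal x hx.le] at h2
  simpa using Real.rpow_le_rpow_of_nonpos hx h2 (by simp : -(M : ℝ) ≤ 0)

lemma cutPow_std_eventually (e : ℂ) :
    ∀ᶠ x : ℝ in atTop, cutPow (cplx stdExcision) e x.toNNReal = (x : ℂ) ^ e := by
  obtain ⟨R, _, hR⟩ := isExcision_std.2.2
  filter_upwards [eventually_gt_atTop (R : ℝ)] with x hx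
  have hx0 : 0 ≤ x := R.2.trans hx.le
  have : R < x.toNNReal := by rw [← NNReal.coe_lt_coe, Real.coe_toNNReal x hx0]; exact hx
  simp [cutPow, cplx, hR _ this, Real.coe_toNNReal x hx0]

/-- The members of a family with an expansion have the expected exponents. -/
lemma FamExpansion.hasExponents {F : Type*} [NormedAddCommGroup F] [NormedSpace ℂ F] {U : Set F}
    {α : F → ℂ} {a : ℕ → F → ℂ} {σ : F → ℝ≥0 → ℂ} (h : FamExpansion U α a σ) {z : F} (hz : z ∈ U) :
    HasExponents {e | ∃ j : ℕ, e = α z - j} (σ z) := by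
  intro M
  obtain ⟨N, hN⟩ := exists_nat_gt ((α z).re + M)
  have h1 := isBigO_of_isSymbol (M := M) ((h.rem N).isSymbol hz (by linarith))
  refine ⟨∑ j ∈ Finset.range N, Finsupp.single (α z - j) (a j z), fun e he => ?_,
    h1.congr' ?_ EventuallyEq.rfl⟩
  · rw [Finsupp.finsetSum_apply] at he
    obtain ⟨j, -, hj⟩ := Finset.exists_ne_zero_of_sum_ne_zero he
    rw [Finsupp.single_apply_ne_zero] at hj
    exact ⟨j, hj.1⟩
  · have h2 : ∀ᶠ x : ℝ in atTop, ∀ j ∈ Finset.range N,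
        cutPow (cplx stdExcision) (α z - j) x.toNNReal = (x : ℂ) ^ (α z - j) :=
      (Filter.eventually_all_finset _).2 fun j _ => cutPow_std_eventually _
    filter_upwards [h2] with x hx
    simp only [extend, remainder_eq, map_sum, expSum_single]
    rw [Finset.sum_congr rfl fun j hj => by rw [hx j hj]]

end asymptotics

/-! ### Sums of families of constant order -/

section constOrder

open Filter Asymptotics

variable {k : ℕ} {U : Set (Fin k → ℂ)} {τ τ' : (Fin k → ℂ) → ℝ≥0 → ℂ}

/-- Families with an expansion in powers of `x` with constant real exponents, not necessarily
differing by integers, and holomorphic coefficients. -/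
def HasConstExponents (U : Set (Fin k → ℂ)) (τ : (Fin k → ℂ) → ℝ≥0 → ℂ) : Prop :=
  ∀ M : ℕ, ∃ (ι : Type) (_ : Fintype ι) (e : ι → ℝ) (c : ι → (Fin k → ℂ) → ℂ),
    (∀ i, DifferentiableOn ℂ (c i) U) ∧ FamSymbol U (fun _ => -(M : ℝ))
      (fun z x => τ z x - ∑ i, c i z * cutPow (cplx stdExcision) (e i) x)

lemma HasConstExponents.add (h : HasConstExponents U τ) (h' : HasConstExponents U τ') :
    HasConstExponents U (τ + τ') := by
  intro M
  obtain ⟨ι, _, e, c, hc, hs⟩ := h M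
  obtain ⟨ι', _, e', c', hc', hs'⟩ := h' M
  refine ⟨ι ⊕ ι', inferInstance, Sum.elim e e', Sum.elim c c', ?_, (hs.add hs').congr fun z _ => ?_⟩
  · rintro (i | i)
    · exact hc i
    · exact hc' i
  · funext x; simp; ring

lemma HasConstExponents.smul_holo (h : HasConstExponents U τ) {g : (Fin k → ℂ) → ℂ}
    (hg : DifferentiableOn ℂ g U) : HasConstExponents U (fun z x => g z * τ z x) := by
  intro M
  obtain ⟨ι, _, e, c, hc, hs⟩ := h M
  refine ⟨ι, inferInstance, e, fun i z => g z * c i z, fun i => hg.mul (hc i),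
    (hs.smul_holo hg).congr fun z _ => ?_⟩
  funext x; simp only [mul_sub, Finset.mul_sum, mul_assoc]

lemma HasConstExponents.zero : HasConstExponents U (fun _ _ => 0) := fun M =>
  ⟨Empty, inferInstance, Empty.elim, fun i => i.elim, fun i => i.elim, by simpa using FamSymbol.zero⟩

lemma HasConstExponents.mono_set {V : Set (Fin k → ℂ)} (h : HasConstExponents U τ) (hV : V ⊆ U) :
    HasConstExponents V τ := fun M =>
  let ⟨ι, hι, e, c, hc, hs⟩ := h M
  ⟨ι, hι, e, c, fun i => (hc i).mono hV, hs.mono_set hV⟩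

lemma HasOrder.hasConstExponents {c : ℝ} (h : HasOrder 0 c U τ) : HasConstExponents U τ := by
  obtain ⟨a, ha⟩ := h
  intro M
  obtain ⟨N, hN⟩ := exists_nat_gt (c + M)
  refine ⟨Fin N, inferInstance, fun j => c - j, fun j => a j, fun j => ha.coeff j,
    ((ha.rem N).mono fun z _ => ?_).congr fun z _ => ?_⟩
  · simp only [affine, realForm_zero_left, zero_add, Complex.ofReal_re]; linarith
  · funext x
    rw [remainder_eq, Finset.sum_range]
    simp [affine, realForm_zero_left]

/-- A family with constant exponents whose members are rapidly decreasing for a dense set of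
parameters is smoothing: all its coefficients vanish. -/
lemma HasConstExponents.isSmoothing (h : HasConstExponents U τ) {D : Set (Fin k → ℂ)} (hDU : D ⊆ U)
    (hD : U ⊆ closure D) (hτ : ∀ z ∈ D, IsRapid (τ z)) : IsSmoothing U τ := by
  classical
  obtain ⟨δ, hδ, h0⟩ := isExcision_std.exists_delta
  suffices key : ∀ M : ℕ, FamSymbol U (fun _ => -(M : ℝ)) τ by
    intro s
    obtain ⟨M, hM⟩ := exists_nat_ge (-s)
    exact (key M).mono fun _ _ => by linarith
  intro M
  obtain ⟨ι, _, e, c, hc, hs⟩ := h (M + 1)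
  set I : Finset ι := Finset.univ.filter fun i => -(M : ℝ) < e i with hI
  set d : (Fin k → ℂ) → (ℂ →₀ ℂ) := fun z => ∑ i ∈ I, Finsupp.single (e i : ℂ) (c i z) with hd
  have hsmall : FamSymbol U (fun _ => -(M : ℝ)) (fun z x => ∑ i ∈ Finset.univ.filter
      (fun i => ¬ -(M : ℝ) < e i), c i z * cutPow (cplx stdExcision) (e i) x) := by
    refine FamSymbol.sum fun i hi => ?_
    have h1 := (famSymbol_cutPow (E := Fin k → ℂ) (U := U) hδ h0 isExcision_std.isSymbol
      (differentiableOn_const (c := (e i : ℂ)))).smul_holo (hc i)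
    refine h1.mono fun z _ => ?_
    simpa using (Finset.mem_filter.1 hi).2
  have hall := (hs.mono (r' := fun _ => -(M : ℝ)) fun _ _ => by push_cast; linarith).add hsmall
  have hrest : FamSymbol U (fun _ => -(M : ℝ)) (fun z x => τ z x -
      ∑ i ∈ I, c i z * cutPow (cplx stdExcision) (e i) x) := by
    refine hall.congr fun z _ => ?_
    funext x
    simp only [Pi.add_apply]
    rw [← Finset.sum_filter_add_sum_filter_not Finset.univ fun i => -(M : ℝ) < e i]
    ring
  have hcoef : ∀ z e', d z e' = ∑ i ∈ I, if (e i : ℂ) = e' then c i z else 0 := fun z e' => by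
    simp [hd, Finsupp.finsetSum_apply, Finsupp.single_apply]
  have hdD : ∀ z ∈ D, d z = 0 := by
    intro z hz
    have hs2 : FamSymbol U (fun _ => -((M : ℝ) + 1)) (fun z x => τ z x -
      ∑ i, c i z * cutPow (cplx stdExcision) (e i) x) := by simpa using hs
    have h1 := isBigO_of_isSymbol (M := M) (hs2.isSymbol (hDU hz) (by linarith))
    have hsm : (fun x : ℝ => ∑ i ∈ Finset.univ.filter (fun i => ¬ -(M : ℝ) < e i),
        c i z * (x : ℂ) ^ (e i : ℂ)) =O[atTop] fun x => x ^ (-(M : ℝ)) :=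
      IsBigO.fun_sum fun i hi =>
        (isBigO_cpow (by simpa using (Finset.mem_filter.1 hi).2)).const_mul_left _
    refine eq_zero_of_isBigO_expSum (M := -(M : ℝ)) (fun e' he' => ?_)
      ((((hτ z hz M).sub h1).sub hsm).congr' ?_ EventuallyEq.rfl)
    · rw [hcoef] at he'
      obtain ⟨i, hi, hne⟩ := Finset.exists_ne_zero_of_sum_ne_zero he'
      have : (e i : ℂ) = e' := by by_contra hne'; exact hne (if_neg hne')
      rw [← this, Complex.ofReal_re]
      exact (Finset.mem_filter.1 hi).2
    · have h2 : ∀ᶠ x : ℝ in atTop, ∀ i, cutPow (cplx stdExcision) (e i) x.toNNReal =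
          (x : ℂ) ^ (e i : ℂ) := Filter.eventually_all.2 fun i => cutPow_std_eventually _
      filter_upwards [h2] with x hx
      simp only [extend, hx, hd, map_sum, expSum_single]
      rw [← Finset.sum_filter_add_sum_filter_not Finset.univ fun i => -(M : ℝ) < e i]
      ring
  have hdU : ∀ z ∈ U, d z = 0 := by
    intro z hz
    ext e'
    have hcont : ContinuousOn (fun z => d z e') U := by
      simp only [hcoef]
      refine continuousOn_finsetSum _ fun i _ => ?_
      split_ifs
      · exact (hc i).continuousOn
      · exact continuousOn_const
    have heq : Set.EqOn (fun z => d z e') (fun _ => 0) D := fun w hw => by simp [hdD w hw]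
    exact heq.of_subset_closure hcont continuousOn_const hDU hD hz
  refine hrest.congr fun z hz => ?_
  funext x
  have h3 : ∑ i ∈ I, c i z * cutPow (cplx stdExcision) (e i) x =
      cplx stdExcision x * expSum x (d z) := by
    simp only [hd, map_sum, expSum_single, cutPow, Finset.mul_sum]
    exact Finset.sum_congr rfl fun i _ => by ring
  rw [h3, hdU z hz, map_zero, mul_zero, sub_zero]

/-- Near zero, generic parameters at which finitely many nonzero real forms take nonreal values are
dense. -/
lemma exists_ball_subset_closure {P : (Fin k → ℂ) → Prop} (hP : ∀ᶠ z in germFilter (Fin k), P z)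
    (A : Finset (Fin k →₀ ℝ)) (hA : ∀ v ∈ A, v ≠ 0) :
    ∃ r > 0, ∀ r' ≤ r, Metric.ball (0 : Fin k → ℂ) r' ⊆
      closure {z | z ∈ Metric.ball (0 : Fin k → ℂ) r' ∧ P z ∧ ∀ v ∈ A, (realForm v z).im ≠ 0} := by
  classical
  obtain ⟨Φ, hΦ, hP⟩ := eventually_germFilter_iff.1 hP
  obtain ⟨r, hr, hball⟩ := Metric.eventually_nhds_iff_ball.1 hP
  obtain ⟨b, -, hb⟩ := exists_annihilator (⊥ : Submodule ℝ (Fin k →₀ ℝ)) (Φ ∪ A)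
  set w : Fin k → ℂ := affineSubst (0 : (Fin k →₀ ℝ) →ₗ[ℝ] (Fin k →₀ ℝ)) b 0 with hw
  have hwv : ∀ v, realForm v w = b v := fun v => by
    rw [hw, realForm_affineSubst]; simp [realForm_zero_left]
  refine ⟨r, hr, fun r' hr' u hu => ?_⟩
  have hform : ∀ v (t : ℝ), realForm v (u + (t * Complex.I : ℂ) • w) =
      realForm v u + t * (Complex.I * b v) := fun v t => by
    rw [realForm_add_right, realForm_smul_right, hwv]; ring
  have hcont : Continuous fun t : ℝ => u + (t * Complex.I : ℂ) • w := by fun_prop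
  have htend : Filter.Tendsto (fun t : ℝ => u + (t * Complex.I : ℂ) • w) (𝓝[≠] 0) (𝓝 u) := by
    have := hcont.tendsto 0
    simp only [Complex.ofReal_zero, zero_mul, zero_smul, add_zero] at this
    exact this.mono_left nhdsWithin_le_nhds
  have hbne : ∀ v ∈ Φ ∪ A, b v ≠ 0 := fun v hv => hb v hv fun h0 => by
    rw [Submodule.mem_bot] at h0
    exact (Finset.mem_union.1 hv).elim (hΦ v) (hA v) h0
  have h1 : ∀ᶠ t : ℝ in 𝓝[≠] (0 : ℝ), ∀ v ∈ Φ, realForm v (u + (t * Complex.I : ℂ) • w) ≠ 0 := by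
    refine (Filter.eventually_all_finset _).2 fun v hv => ?_
    simp only [hform]
    have hd : HasDerivAt (fun t : ℝ => realForm v u + t * (Complex.I * b v))
        (1 * (Complex.I * b v)) 0 :=
      ((Complex.ofRealCLM.hasDerivAt (x := (0 : ℝ))).mul_const _).const_add _
    refine hd.eventually_ne ?_
    simpa using hbne v (Finset.mem_union_left _ hv)
  have h2 : ∀ᶠ t : ℝ in 𝓝[≠] (0 : ℝ), ∀ v ∈ A, (realForm v (u + (t * Complex.I : ℂ) • w)).im ≠ 0 := by
    refine (Filter.eventually_all_finset _).2 fun v hv => ?_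
    have him : ∀ t : ℝ, (realForm v (u + (t * Complex.I : ℂ) • w)).im =
        (realForm v u).im + t * b v := fun t => by rw [hform]; simp
    simp only [him]
    have hd : HasDerivAt (fun t : ℝ => (realForm v u).im + t * b v) (1 * b v) 0 :=
      ((hasDerivAt_id (0 : ℝ)).mul_const _).const_add _
    refine hd.eventually_ne ?_
    simpa using hbne v (Finset.mem_union_right _ hv)
  refine mem_closure_of_tendsto htend ?_
  filter_upwards [htend.eventually (Metric.isOpen_ball.mem_nhds hu), h1, h2] with t ht ht1 ht2
  exact ⟨ht, hball _ (Metric.ball_subset_ball hr' ht) ht1, ht2⟩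

end constOrder

/-! ### Spaces of germs in finitely many variables -/

section spaces

variable {k n : ℕ} {P : Set (Fin k → ℂ) → ((Fin k → ℂ) → ℝ≥0 → ℂ) → Prop}
  {σ σ₁ σ₂ : (Fin k → ℂ) → ℝ≥0 → ℂ}

lemma Mero.add (h₁ : Mero P σ₁) (h₂ : Mero P σ₂)
    (hmono : ∀ U V τ, V ⊆ U → P U τ → P V τ)
    (hsmul : ∀ U τ (g : (Fin k → ℂ) → ℂ), P U τ → DifferentiableOn ℂ g U →
      P U (fun z x => g z * τ z x))
    (hadd : ∀ U τ τ', P U τ → P U τ' → P U (τ + τ')) : Mero P (σ₁ + σ₂) := by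
  obtain ⟨d₁, hd₁, r₁, hr₁, τ₁, hτ₁, he₁⟩ := h₁
  obtain ⟨d₂, hd₂, r₂, hr₂, τ₂, hτ₂, he₂⟩ := h₂
  have h1 := hmono _ (Metric.ball 0 (min r₁ r₂)) _ (Metric.ball_subset_ball (min_le_left _ _)) hτ₁
  have h2 := hmono _ (Metric.ball 0 (min r₁ r₂)) _ (Metric.ball_subset_ball (min_le_right _ _)) hτ₂
  refine ⟨d₁ * d₂, mul_mem hd₁ hd₂, min r₁ r₂, lt_min hr₁ hr₂, _,
    hadd _ _ _ (hsmul _ _ d₂ h1 (differentiable_of_mem_denominators hd₂).differentiableOn)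
      (hsmul _ _ d₁ h2 (differentiable_of_mem_denominators hd₁).differentiableOn), ?_⟩
  filter_upwards [he₁, he₂] with z h3 h4 x
  simp only [Pi.mul_apply, Pi.add_apply, ← h3 x, ← h4 x]; ring

/-- The span of the simple germs of affine order with linear part in `A`. -/
def simpleSpan (A : Set (Fin k →₀ ℝ)) : Submodule ℂ (SGerm (Fin k)) :=
  Submodule.span ℂ {g | ∃ v ∈ A, ∃ c σ, Mero (HasOrder v c) σ ∧ g = toGerm σ}

/-- The span of the simple germs of constant order in `C`. -/
def constSpan (k : ℕ) (C : Set ℝ) : Submodule ℂ (SGerm (Fin k)) :=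
  Submodule.span ℂ {g | ∃ c ∈ C, ∃ σ, Mero (HasOrder 0 c) σ ∧ g = toGerm σ}

/-- The span of the products of meromorphic functions with powers of `x`. -/
def polySpan (k : ℕ) : Submodule ℂ (SGerm (Fin k)) :=
  Submodule.span ℂ {g | ∃ (h : (Fin k → ℂ) → ℂ) (d : ℕ), Mero IsXConst (fun z _ => h z) ∧
    g = toGerm fun z x => h z * ((x : ℝ) : ℂ) ^ d}

/-- The span of the meromorphic germs of smoothing families. -/
def smoothSpan (k : ℕ) : Submodule ℂ (SGerm (Fin k)) :=
  Submodule.span ℂ {g | ∃ σ, Mero IsSmoothing σ ∧ g = toGerm σ}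

lemma simpleSpan_mono {A A' : Set (Fin k →₀ ℝ)} (h : A ⊆ A') : simpleSpan A ≤ simpleSpan A' :=
  Submodule.span_mono fun _ ⟨v, hv, hg⟩ => ⟨v, h hv, hg⟩

lemma constSpan_mono {C C' : Set ℝ} (h : C ⊆ C') : constSpan k C ≤ constSpan k C' :=
  Submodule.span_mono fun _ ⟨v, hv, hg⟩ => ⟨v, h hv, hg⟩

lemma mem_polySpan {h : (Fin k → ℂ) → ℂ} (hh : Mero IsXConst (fun z _ => h z))
    (p : Polynomial ℝ) :
    (toGerm fun z x => h z * ((p.eval (x : ℝ) : ℝ) : ℂ)) ∈ polySpan k := by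
  induction p using Polynomial.induction_on' with
  | add p q hp hq =>
    convert (polySpan k).add_mem hp hq using 1
    rw [← toGerm_add]
    congr 1
    funext z x
    simp [mul_add]
  | monomial d a =>
    convert (polySpan k).smul_mem (a : ℂ) (Submodule.subset_span ⟨h, d, hh, rfl⟩) using 1
    rw [← toGerm_smul]
    congr 1
    funext z x
    simp only [Polynomial.eval_monomial, Pi.smul_apply, smul_eq_mul]
    push_cast; ring

/-- The germs which have exponents in `E` at almost every parameter at which the forms in `A` take
nonreal values. -/
def exponentGerms (A : Finset (Fin k →₀ ℝ)) (E : Set ℂ) : Submodule ℂ (SGerm (Fin k)) where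
  carrier := {γ | ∃ τ, γ = toGerm τ ∧ ∀ᶠ u in germFilter (Fin k),
    (∀ v ∈ A, (realForm v u).im ≠ 0) → HasExponents E (τ u)}
  add_mem' := by
    rintro _ _ ⟨τ, rfl, h⟩ ⟨τ', rfl, h'⟩
    refine ⟨τ + τ', rfl, ?_⟩
    filter_upwards [h, h'] with u hu hu' hA using (hu hA).add (hu' hA)
  zero_mem' := ⟨0, rfl, Filter.Eventually.of_forall fun _ _ => HasExponents.zero⟩
  smul_mem' := by
    rintro c _ ⟨τ, rfl, h⟩
    refine ⟨c • τ, rfl, ?_⟩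
    filter_upwards [h] with u hu hA using (hu hA).const_mul c

lemma exponentGerms_mono {A : Finset (Fin k →₀ ℝ)} {E E' : Set ℂ} (h : E ⊆ E') :
    exponentGerms A E ≤ exponentGerms A E' := by
  rintro _ ⟨τ, rfl, hτ⟩
  exact ⟨τ, rfl, hτ.mono fun u hu hA => (hu hA).mono h⟩

/-- Where its denominator does not vanish, a simple meromorphic family has the exponents of the
holomorphic family in its numerator. -/
lemma Mero.eventually_hasExponents {v : Fin k →₀ ℝ} {c : ℝ} (h : Mero (HasOrder v c) σ) :
    ∀ᶠ u in germFilter (Fin k), HasExponents {e | ∃ j : ℕ, e = affine v c u - j} (σ u) := by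
  obtain ⟨d, hd, r, hr, τ, ⟨a, ha⟩, he⟩ := h
  filter_upwards [he, eventually_ne_zero_of_mem_denominators hd,
    germFilter_le_nhds (Metric.ball_mem_nhds 0 hr)] with u h1 h2 h3
  convert (ha.hasExponents h3).const_mul (d u)⁻¹ using 1
  funext x
  rw [← h1 x, inv_mul_cancel_left₀ h2]

lemma simpleSpan_le_exponentGerms (A : Finset (Fin k →₀ ℝ)) :
    simpleSpan (A : Set (Fin k →₀ ℝ)) ≤ exponentGerms A {e | e.im ≠ 0} := by
  refine Submodule.span_le.2 ?_
  rintro _ ⟨v, hv, c, σ, hσ, rfl⟩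
  refine ⟨σ, rfl, ?_⟩
  filter_upwards [hσ.eventually_hasExponents] with u hu hA
  refine hu.mono ?_
  rintro _ ⟨j, rfl⟩
  simpa [affine] using hA v hv

lemma constSpan_le_exponentGerms (A : Finset (Fin k →₀ ℝ)) (C : Set ℝ) :
    constSpan k C ≤ exponentGerms A {e | ∃ c ∈ C, ∃ j : ℕ, e = (c : ℂ) - j} := by
  refine Submodule.span_le.2 ?_
  rintro _ ⟨c, hc, σ, hσ, rfl⟩
  refine ⟨σ, rfl, ?_⟩
  filter_upwards [hσ.eventually_hasExponents] with u hu _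
  refine hu.mono ?_
  rintro _ ⟨j, rfl⟩
  exact ⟨c, hc, j, by simp [affine, realForm_zero_left]⟩

lemma polySpan_le_exponentGerms (A : Finset (Fin k →₀ ℝ)) :
    polySpan k ≤ exponentGerms A {e | ∃ d : ℕ, e = d} := by
  refine Submodule.span_le.2 ?_
  rintro _ ⟨h, d, -, rfl⟩
  exact ⟨_, rfl, Filter.Eventually.of_forall fun u _ =>
    (HasExponents.pow (E := {e | ∃ d : ℕ, e = d}) d ⟨d, rfl⟩).const_mul (h u)⟩

/-- Sums of germs of constant orders have expansions in finitely many sequences of real powers, which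
need not have a common order modulo the integers. -/
lemma Mero.of_constSpan {C : Set ℝ} {γ : SGerm (Fin k)} (hγ : γ ∈ constSpan k C) :
    ∃ τ, γ = toGerm τ ∧ Mero HasConstExponents τ := by
  induction hγ using Submodule.span_induction with
  | mem γ hγ =>
    obtain ⟨c, -, σ, hσ, rfl⟩ := hγ
    exact ⟨σ, rfl, hσ.imp fun U τ h => h.hasConstExponents⟩
  | zero =>
    refine ⟨0, rfl, 1, one_mem _, 1, one_pos, 0, HasConstExponents.zero, ?_⟩
    simp
  | add x y _ _ hx hy =>
    obtain ⟨τ, rfl, hτ⟩ := hx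
    obtain ⟨τ', rfl, hτ'⟩ := hy
    exact ⟨τ + τ', rfl, hτ.add hτ' (fun _ _ _ hV h => h.mono_set hV)
      (fun _ _ _ h hg => h.smul_holo hg) fun _ _ _ h h' => h.add h'⟩
  | smul c x _ hx =>
    obtain ⟨τ, rfl, d, hd, r, hr, τ', hτ', he⟩ := hx
    refine ⟨c • τ, rfl, d, hd, r, hr, _,
      hτ'.smul_holo (g := fun _ => c) (differentiableOn_const _), ?_⟩
    filter_upwards [he] with z hz x
    rw [← hz x]; simp only [Pi.smul_apply, smul_eq_mul]; ring

/-- A sum of germs of constant orders in `C` that has exponents disjoint from those prescribed by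
`C` is smoothing. -/
lemma mem_smoothSpan_of_disjoint {C : Set ℝ} {γ : SGerm (Fin k)} (hγ : γ ∈ constSpan k C)
    {A : Finset (Fin k →₀ ℝ)} (hA : ∀ v ∈ A, v ≠ 0) {E : Set ℂ} (hE : γ ∈ exponentGerms A E)
    (hd : Disjoint {e | ∃ c ∈ C, ∃ j : ℕ, e = (c : ℂ) - j} E) : γ ∈ smoothSpan k := by
  obtain ⟨τ, rfl, d, hdd, r, hr, τ', hτ', he⟩ := Mero.of_constSpan hγ
  obtain ⟨τ₁, h1, hτ₁⟩ := constSpan_le_exponentGerms A C hγ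
  obtain ⟨τ₂, h2, hτ₂⟩ := hE
  have hrapid : ∀ᶠ u in germFilter (Fin k), (∀ x, d u * τ u x = τ' u x) ∧
      ((∀ v ∈ A, (realForm v u).im ≠ 0) → IsRapid (τ u)) := by
    filter_upwards [he, toGerm_eq_iff.1 h1, toGerm_eq_iff.1 h2, hτ₁, hτ₂] with u h3 h4 h5 h6 h7
    exact ⟨h3, fun hu => HasExponents.isRapid (h4 ▸ h6 hu) (h5 ▸ h7 hu) hd⟩
  obtain ⟨r₁, hr₁, hball⟩ := exists_ball_subset_closure hrapid A hA
  refine Submodule.subset_span ⟨τ, ⟨d, hdd, min r r₁, lt_min hr hr₁, τ',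
    (hτ'.mono_set (Metric.ball_subset_ball (min_le_left _ _))).isSmoothing (fun z hz => hz.1)
      (hball _ (min_le_right _ _)) ?_, he⟩, rfl⟩
  rintro u ⟨-, ⟨h3, h4⟩, h5⟩ M
  exact ((h4 h5 M).const_mul_left (d u)).congr_left fun x => h3 _

end spaces

/-! ### Restriction of admissible germs to generic slices -/

section slices

variable {k n : ℕ} {W : Submodule ℝ (ℕ →₀ ℝ)} {S : (ℕ →₀ ℝ) →ₗ[ℝ] (Fin k →₀ ℝ)}

/-- Linear forms in the first `n` variables. -/
def firstForms (n : ℕ) : (Fin n →₀ ℝ) →ₗ[ℝ] (ℕ →₀ ℝ) := Finsupp.lmapDomain ℝ ℝ Fin.val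

lemma injective_firstForms (n : ℕ) : Function.Injective (firstForms n) :=
  Finsupp.mapDomain_injective Fin.val_injective

lemma affineSubst_firstForms (z : ℕ → ℂ) : affineSubst (firstForms n) 0 z = firstCoords n z := by
  funext i
  simp [affineSubst, firstForms, Finsupp.lmapDomain_apply, Finsupp.mapDomain_single,
    realForm_single, firstCoords]

/-- Restriction of meromorphic families in the first `n` variables to generic slices. -/
lemma Mero.slice {P : Set (Fin n → ℂ) → ((Fin n → ℂ) → ℝ≥0 → ℂ) → Prop}
    {σ : (Fin n → ℂ) → ℝ≥0 → ℂ} (h : Mero P σ) (hS : ∀ v ∈ W, S v = 0 → v = 0) :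
    ∃ Ψ : Finset (ℕ →₀ ℝ), ∀ b, IsGenericFor W Ψ b → ∀ᶠ t in 𝓝[≠] (0 : ℝ),
      ∀ Q : Set (Fin k → ℂ) → ((Fin k → ℂ) → ℝ≥0 → ℂ) → Prop,
        (∀ U V τ (g : (Fin k → ℂ) → ℂ), P U τ → DifferentiableOn ℂ g V →
          Set.MapsTo (affineSubst (S ∘ₗ firstForms n) (t • (b ∘ₗ firstForms n))) V U →
          Q V (fun z x => g z * τ (affineSubst (S ∘ₗ firstForms n) (t • (b ∘ₗ firstForms n)) z) x)) →
        Mero Q (fun u => σ (firstCoords n (affineSubst S (t • b) u))) := by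
  classical
  obtain ⟨Φ, hΦ, h1⟩ := h.restrict
  refine ⟨Φ.image (firstForms n), fun b hb => ?_⟩
  filter_upwards [h1 (S ∘ₗ firstForms n) (b ∘ₗ firstForms n) fun v hv h0 =>
    hb.2 _ (Finset.mem_image_of_mem _ hv) fun hW => hΦ v hv
      ((map_eq_zero_iff _ (injective_firstForms n)).1 (hS _ hW h0))] with t ht Q hQ
  convert ht Q hQ using 1
  funext u
  rw [Function.comp_apply, ← affineSubst_firstForms, affineSubst_affineSubst, LinearMap.smul_comp,
    zero_add]

/-- An admissible germ restricts to generic slices as a sum of simple germs of nonconstant orders,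
of germs of constant orders `c + t q` which vary with the slice, and of a polynomial part. -/
lemma exists_slice_decomposition {f : (ℕ → ℂ) → ℝ≥0 → ℂ} (hf : toGerm f ∈ Omega)
    (hS : ∀ v ∈ W, S v = 0 → v = 0) :
    ∃ Ψ : Finset (ℕ →₀ ℝ), ∀ b, IsGenericFor W Ψ b →
      ∃ (A : Finset (Fin k →₀ ℝ)) (B : Finset (ℝ × ℝ)), (∀ v ∈ A, v ≠ 0) ∧ (∀ p ∈ B, p.2 ≠ 0) ∧
        ∀ᶠ t in 𝓝[≠] (0 : ℝ), toGerm (f ∘ affineSubst S (t • b)) ∈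
          simpleSpan (A : Set (Fin k →₀ ℝ)) ⊔ constSpan k ((fun p : ℝ × ℝ => p.1 + t * p.2) '' B) ⊔
            polySpan k := by
  classical
  suffices h : ∀ g ∈ Omega, ∃ f, toGerm f = g ∧ ∃ Ψ : Finset (ℕ →₀ ℝ), ∀ b, IsGenericFor W Ψ b →
      ∃ (A : Finset (Fin k →₀ ℝ)) (B : Finset (ℝ × ℝ)), (∀ v ∈ A, v ≠ 0) ∧ (∀ p ∈ B, p.2 ≠ 0) ∧
        ∀ᶠ t in 𝓝[≠] (0 : ℝ), toGerm (f ∘ affineSubst S (t • b)) ∈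
          simpleSpan (A : Set (Fin k →₀ ℝ)) ⊔ constSpan k ((fun p : ℝ × ℝ => p.1 + t * p.2) '' B) ⊔
            polySpan k by
    obtain ⟨f', hf', Ψ, h1⟩ := h _ hf
    obtain ⟨Ψ', h2⟩ := eventually_slice (toGerm_eq_iff.1 hf') hS
    refine ⟨Ψ ∪ Ψ', fun b hb => ?_⟩
    obtain ⟨A, B, hA, hB, h3⟩ := h1 b (hb.mono Finset.subset_union_left)
    refine ⟨A, B, hA, hB, ?_⟩
    filter_upwards [h3, h2 b (hb.mono Finset.subset_union_right)] with t ht ht'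
    have h4 : toGerm (f' ∘ affineSubst S (t • b)) = toGerm (f ∘ affineSubst S (t • b)) :=
      toGerm_eq_iff.2 ht'
    rwa [← h4]
  intro g hg
  induction hg using Submodule.span_induction with
  | mem g hg =>
    rcases hg with ⟨n, L, c, σ, hL, hσ, rfl⟩ | ⟨n, h, p, hh, rfl⟩
    · obtain ⟨Ψ, hΨ⟩ := (isSimpleMeromorphic_iff.1 hσ).slice hS
      refine ⟨_, rfl, insert (firstForms n L) Ψ, fun b hb => ?_⟩
      have h1 : ∀ᶠ t in 𝓝[≠] (0 : ℝ), Mero (HasOrder (S (firstForms n L)) (c + t * b (firstForms n L)))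
          (fun u => σ (firstCoords n (affineSubst S (t • b) u))) := by
        filter_upwards [hΨ b (hb.mono (Finset.subset_insert _ _))] with t ht
        refine ht _ fun U V τ g hτ hg hm => ?_
        simpa using hτ.affineSubst hg hm
      by_cases h0 : S (firstForms n L) = 0
      · have hb0 : b (firstForms n L) ≠ 0 := hb.2 _ (Finset.mem_insert_self _ _) fun hW =>
          hL ((map_eq_zero_iff _ (injective_firstForms n)).1 (hS _ hW h0))
        refine ⟨∅, {(c, b (firstForms n L))}, by simp, by simpa using hb0, ?_⟩
        filter_upwards [h1] with t ht
        rw [h0] at ht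
        exact Submodule.mem_sup_left (Submodule.mem_sup_right
          (Submodule.subset_span ⟨_, ⟨(c, b (firstForms n L)), by simp, rfl⟩, _, ht, rfl⟩))
      · refine ⟨{S (firstForms n L)}, ∅, by simpa using h0, by simp, ?_⟩
        filter_upwards [h1] with t ht
        exact Submodule.mem_sup_left (Submodule.mem_sup_left
          (Submodule.subset_span ⟨_, by simp, _, _, ht, rfl⟩))
    · obtain ⟨Ψ, hΨ⟩ := (isMeromorphicFunction_iff.1 hh).slice hS
      refine ⟨_, rfl, Ψ, fun b hb => ⟨∅, ∅, by simp, by simp, ?_⟩⟩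
      filter_upwards [hΨ b hb] with t ht
      exact Submodule.mem_sup_right (mem_polySpan
        (ht IsXConst fun U V τ g hτ hg hm => hτ.affineSubst hg hm) p)
  | zero =>
    exact ⟨0, rfl, ∅, fun b _ => ⟨∅, ∅, by simp, by simp, Filter.Eventually.of_forall fun t =>
      Submodule.zero_mem _⟩⟩
  | add x y _ _ hx hy =>
    obtain ⟨f, rfl, Ψ, h1⟩ := hx
    obtain ⟨f', rfl, Ψ', h2⟩ := hy
    refine ⟨f + f', rfl, Ψ ∪ Ψ', fun b hb => ?_⟩
    obtain ⟨A, B, hA, hB, h3⟩ := h1 b (hb.mono Finset.subset_union_left)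
    obtain ⟨A', B', hA', hB', h4⟩ := h2 b (hb.mono Finset.subset_union_right)
    refine ⟨A ∪ A', B ∪ B', fun v hv => (Finset.mem_union.1 hv).elim (hA v) (hA' v),
      fun v hv => (Finset.mem_union.1 hv).elim (hB v) (hB' v), ?_⟩
    filter_upwards [h3, h4] with t ht ht'
    refine Submodule.add_mem _ (sup_le_sup_right (sup_le_sup (simpleSpan_mono ?_)
      (constSpan_mono (Set.image_mono ?_))) _ ht) (sup_le_sup_right (sup_le_sup (simpleSpan_mono ?_)
      (constSpan_mono (Set.image_mono ?_))) _ ht')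
    all_goals simp
  | smul c x _ hx =>
    obtain ⟨f, rfl, Ψ, h1⟩ := hx
    refine ⟨c • f, rfl, Ψ, fun b hb => ?_⟩
    obtain ⟨A, B, hA, hB, h3⟩ := h1 b hb
    refine ⟨A, B, hA, hB, ?_⟩
    filter_upwards [h3] with t ht
    exact Submodule.smul_mem _ c ht

/-- A nonconstant affine function takes no integral values near zero, except possibly at zero. -/
lemma eventually_forall_int_ne (a : ℝ) {q : ℝ} (hq : q ≠ 0) :
    ∀ᶠ t in 𝓝[≠] (0 : ℝ), ∀ m : ℤ, a + t * q ≠ m := by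
  have h1 : ∀ᶠ y in 𝓝 a, y ∈ Set.Ioo ((⌈a⌉ : ℝ) - 1) (⌊a⌋ + 1) :=
    Ioo_mem_nhds (by linarith [Int.ceil_lt_add_one a]) (Int.lt_floor_add_one a)
  have hc : Continuous fun t : ℝ => a + t * q := by fun_prop
  have h2 : Filter.Tendsto (fun t : ℝ => a + t * q) (𝓝 0) (𝓝 a) := by
    simpa using hc.tendsto 0
  filter_upwards [mem_nhdsWithin_of_mem_nhds (h2.eventually h1), self_mem_nhdsWithin]
    with t ht ht0 m hm
  rw [hm] at ht
  have h3 : ⌈a⌉ ≤ m := by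
    have : (⌈a⌉ : ℝ) < m + 1 := by linarith [ht.1]
    exact Int.lt_add_one_iff.1 (by exact_mod_cast this)
  have h4 : m ≤ ⌊a⌋ := Int.lt_add_one_iff.1 (by exact_mod_cast ht.2)
  have h5 : a = m := le_antisymm (Int.ceil_le.1 h3) (Int.le_floor.1 h4)
  rw [← h5, add_eq_left, mul_eq_zero] at hm
  exact hm.elim ht0 hq

/-- An admissible germ which depends on the span of the independent forms `Lᵢ` is the pull-back of
an admissible germ along them, up to smoothing germs. The constant orders on the slices with
parameters `t₀` and `t₁` do not differ by integers, so that the parts of constant order of the two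
restrictions, which are restrictions of the same germ, are smoothing. -/
lemma exists_formPullback_of_mem_Omega {L : Fin k → (ℕ →₀ ℝ)} (hL : LinearIndependent ℝ L)
    {g : SGerm ℕ} (hg : g ∈ Omega) (hdep : DependsOn g (Submodule.span ℝ (Set.range L))) :
    ∃ γ ∈ simpleSpan {v : Fin k →₀ ℝ | v ≠ 0} ⊔ polySpan k ⊔ smoothSpan k,
      g = formPullback hL γ := by
  classical
  obtain ⟨γ, -, hγ⟩ := hdep.exists_formPullback hL le_rfl
  refine ⟨γ, ?_, hγ⟩
  obtain ⟨f, rfl⟩ := toGerm_surjective g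
  obtain ⟨τ, rfl⟩ := toGerm_surjective γ
  rw [formPullback_toGerm] at hγ
  obtain ⟨S, hS1, hS2⟩ := exists_section hL
  have hS : ∀ v ∈ Submodule.span ℝ (Set.range L), S v = 0 → v = 0 := fun v hv h0 => by
    rw [← hS2 v hv, h0, map_zero]
  obtain ⟨Ψ, hΨ⟩ := exists_slice_decomposition hg hS
  obtain ⟨Ψ', hΨ'⟩ := eventually_slice (toGerm_eq_iff.1 hγ) hS
  obtain ⟨b, hbW, hb⟩ := exists_annihilator (Submodule.span ℝ (Set.range L)) (Ψ ∪ Ψ')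
  have hb' : IsGenericFor (Submodule.span ℝ (Set.range L)) (Ψ ∪ Ψ') b := ⟨hbW, hb⟩
  obtain ⟨A, B, hA, hB, h1⟩ := hΨ b (hb'.mono Finset.subset_union_left)
  have h2 := hΨ' b (hb'.mono Finset.subset_union_right)
  have h3 : ∀ᶠ t in 𝓝[≠] (0 : ℝ), toGerm τ ∈
      simpleSpan (A : Set (Fin k →₀ ℝ)) ⊔ constSpan k ((fun p : ℝ × ℝ => p.1 + t * p.2) '' B) ⊔
        polySpan k := by
    filter_upwards [h1, h2] with t ht ht'
    convert ht using 1
    refine toGerm_eq_iff.2 ?_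
    filter_upwards [ht'] with u hu
    rw [Function.comp_apply, hu]
    congr 1
    funext i
    have h4 : S (L i) = Finsupp.single i 1 := by
      rw [← hS1 (Finsupp.single i 1)]; simp
    have h5 : b (L i) = 0 := hbW _ (Submodule.subset_span (Set.mem_range_self i))
    simp [realForm_affineSubst, h4, h5, realForm_single]
  have hint : ∀ᶠ t in 𝓝[≠] (0 : ℝ), ∀ p ∈ B, ∀ m : ℤ, p.1 + t * p.2 ≠ m :=
    (Filter.eventually_all_finset _).2 fun p hp => eventually_forall_int_ne _ (hB p hp)
  obtain ⟨t₀, ht₀, hint₀⟩ := (h3.and hint).exists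
  have hint' : ∀ᶠ t in 𝓝[≠] (0 : ℝ), ∀ p ∈ B, ∀ p' ∈ B, ∀ m : ℤ,
      (p'.1 - (p.1 + t₀ * p.2)) + t * p'.2 ≠ m :=
    (Filter.eventually_all_finset _).2 fun p _ => (Filter.eventually_all_finset _).2 fun p' hp' =>
      eventually_forall_int_ne _ (hB p' hp')
  obtain ⟨t₁, ht₁, hint₁⟩ := (h3.and hint').exists
  obtain ⟨ab₀, hab₀, p₀, hp₀, e₀⟩ := Submodule.mem_sup.1 ht₀
  obtain ⟨a₀, ha₀, b₀, hb₀, rfl⟩ := Submodule.mem_sup.1 hab₀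
  obtain ⟨ab₁, hab₁, p₁, hp₁, e₁⟩ := Submodule.mem_sup.1 ht₁
  obtain ⟨a₁, ha₁, b₁, hb₁, rfl⟩ := Submodule.mem_sup.1 hab₁
  have hb₀' : b₀ = (a₁ - a₀) + b₁ + (p₁ - p₀) := by
    rw [← e₁] at e₀
    rw [← sub_eq_zero] at e₀ ⊢
    rw [← e₀]; abel
  -- the exponents of `b₀` are the `p.1 + t₀ p.2 - j`; those on the right of `hb₀'` are nonreal, of the
  -- form `p.1 + t₁ p.2 - j`, or natural numbers
  have hsm : b₀ ∈ smoothSpan k := by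
    refine mem_smoothSpan_of_disjoint hb₀ hA (E := {e | e.im ≠ 0} ∪ {e | ∃ c ∈
      (fun p : ℝ × ℝ => p.1 + t₁ * p.2) '' (B : Set (ℝ × ℝ)), ∃ j : ℕ, e = (c : ℂ) - j} ∪
      {e | ∃ d : ℕ, e = d}) ?_ ?_
    · rw [hb₀']
      refine Submodule.add_mem _ (Submodule.add_mem _ ?_ ?_) ?_
      · exact exponentGerms_mono (fun e he => Or.inl (Or.inl he))
          (simpleSpan_le_exponentGerms A (Submodule.sub_mem _ ha₁ ha₀))
      · exact exponentGerms_mono (fun e he => Or.inl (Or.inr he))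
          (constSpan_le_exponentGerms A _ hb₁)
      · exact exponentGerms_mono (fun e he => Or.inr he)
          (polySpan_le_exponentGerms A (Submodule.sub_mem _ hp₁ hp₀))
    · rw [Set.disjoint_left]
      rintro _ ⟨_, ⟨p, hp, rfl⟩, j, rfl⟩ ((h | ⟨_, ⟨p', hp', rfl⟩, i, h⟩) | ⟨d, h⟩)
      · exact h (by simp)
      · have h6 : p.1 + t₀ * p.2 - j = p'.1 + t₁ * p'.2 - i := by exact_mod_cast h
        exact hint₁ p hp p' hp' (i - j) (by push_cast; linarith)
      · have h6 : p.1 + t₀ * p.2 - j = d := by exact_mod_cast h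
        exact hint₀ p hp (d + j) (by push_cast; linarith)
  rw [← e₀]
  refine Submodule.add_mem _ (Submodule.add_mem _ ?_ ?_) ?_
  · exact Submodule.mem_sup_left (Submodule.mem_sup_left (simpleSpan_mono (fun v hv => hA v hv) ha₀))
  · exact Submodule.mem_sup_right hsm
  · exact Submodule.mem_sup_left (Submodule.mem_sup_right hp₀)

end slices

/-! ### Products of independent admissible germs -/

section products

variable {k n m : ℕ}

/-- The germs in `k` variables which are admissible up to smoothing germs. For `k > 0` smoothing
germs are admissible; they are listed because nonconstant orders do not exist for `k = 0`. -/
def admissibleSpan (k : ℕ) : Submodule ℂ (SGerm (Fin k)) :=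
  simpleSpan {v : Fin k →₀ ℝ | v ≠ 0} ⊔ polySpan k ⊔ smoothSpan k

lemma Mero.mul_pow {h : (Fin k → ℂ) → ℂ} (hh : Mero IsXConst (fun z _ => h z)) (d : ℕ) :
    Mero (HasOrder 0 d) (fun z x => h z * ((x : ℝ) : ℂ) ^ d) := by
  obtain ⟨e, he, r, hr, τ, hτ, heq⟩ := hh
  refine ⟨e, he, r, hr, _, hτ.mul_pow d, ?_⟩
  filter_upwards [heq] with z hz x
  rw [← hz x, mul_assoc]

/-- Simple germs of affine order with linear part in `A`, products of meromorphic functions with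
powers of `x`, and smoothing germs. They generate `admissibleSpan k` if `A` is the set of all
nonzero forms. -/
def admissibleGenerators (A : Set (Fin k →₀ ℝ)) : Set (SGerm (Fin k)) :=
  ({g | ∃ v ∈ A, ∃ c σ, Mero (HasOrder v c) σ ∧ g = toGerm σ} ∪
    {g | ∃ (h : (Fin k → ℂ) → ℂ) (d : ℕ), Mero IsXConst (fun z _ => h z) ∧
      g = toGerm fun z x => h z * ((x : ℝ) : ℂ) ^ d}) ∪
    {g | ∃ σ, Mero IsSmoothing σ ∧ g = toGerm σ}

lemma admissibleSpan_eq :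
    admissibleSpan k = Submodule.span ℂ (admissibleGenerators {v : Fin k →₀ ℝ | v ≠ 0}) := by
  rw [admissibleGenerators, Submodule.span_union, Submodule.span_union]; rfl

lemma exists_hasOrder_of_mem {A : Set (Fin k →₀ ℝ)} {g : SGerm (Fin k)}
    (hg : g ∈ admissibleGenerators A) :
    ∃ v c σ, Mero (HasOrder v c) σ ∧ g = toGerm σ := by
  rcases hg with (⟨v, -, c, σ, hσ, rfl⟩ | ⟨h, d, hh, rfl⟩) | ⟨σ, hσ, rfl⟩
  · exact ⟨v, c, σ, hσ, rfl⟩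
  · exact ⟨0, d, _, hh.mul_pow d, rfl⟩
  · exact ⟨0, 0, σ, hσ.imp fun U τ h => h.hasOrder 0 0, rfl⟩

lemma polySpan_le_meromorphicGerms : polySpan k ≤ meromorphicGerms k := by
  refine Submodule.span_le.2 ?_
  rintro _ ⟨h, d, hh, rfl⟩
  exact mem_meromorphicGerms (hh.mul_pow d)

lemma pullback_mem_admissibleGenerators {T : (Fin k →₀ ℝ) →ₗ[ℝ] (Fin n →₀ ℝ)}
    (hT : Function.Injective T) {A : Set (Fin k →₀ ℝ)} {g : SGerm (Fin k)}
    (hg : g ∈ admissibleGenerators A) : pullback hT g ∈ admissibleGenerators (T '' A) := by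
  rcases hg with (⟨v, hv, c, σ, hσ, rfl⟩ | ⟨h, d, hh, rfl⟩) | ⟨σ, hσ, rfl⟩
  · exact Or.inl (Or.inl ⟨T v, ⟨v, hv, rfl⟩, c, _, hσ.pullback_hasOrder hT, rfl⟩)
  · exact Or.inl (Or.inr ⟨h ∘ affineSubst T 0, d,
      hh.pullback hT fun U V τ g hτ hg hm => hτ.affineSubst hg hm, rfl⟩)
  · exact Or.inr ⟨_, hσ.pullback hT fun U V τ g hτ hg hm => hτ.affineSubst hg hm, rfl⟩

lemma smoothing_mul_mem {σ σ' : (Fin k → ℂ) → ℝ≥0 → ℂ} (hσ : Mero IsSmoothing σ)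
    {v : Fin k →₀ ℝ} {c : ℝ} (hσ' : Mero (HasOrder v c) σ') :
    toGerm σ * toGerm σ' ∈ admissibleSpan k := by
  refine Submodule.mem_sup_right (Submodule.subset_span ⟨σ * σ', ?_, (toGerm_mul σ σ').symm⟩)
  exact hσ.mul hσ' (fun _ _ _ hV h => h.mono_set hV) (fun _ _ _ hV h => h.mono_set hV)
    fun _ _ _ h h' => h.mul_hasOrder h'

/-- Products of generators whose orders involve complementary sets of linear forms: the order of
the product of two nonconstant simple germs is again nonconstant. -/
lemma mul_mem_admissibleSpan {A A' : Set (Fin k →₀ ℝ)} (hA : ∀ v ∈ A, v ≠ 0) (hA' : ∀ v ∈ A', v ≠ 0)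
    (hAA' : ∀ v ∈ A, ∀ w ∈ A', v + w ≠ 0) {g g' : SGerm (Fin k)} (hg : g ∈ admissibleGenerators A)
    (hg' : g' ∈ admissibleGenerators A') : g * g' ∈ admissibleSpan k := by
  have simple : ∀ {v : Fin k →₀ ℝ} {c σ}, v ≠ 0 → Mero (HasOrder v c) σ →
      toGerm σ ∈ admissibleSpan k := fun hv hσ =>
    Submodule.mem_sup_left (Submodule.mem_sup_left (Submodule.subset_span ⟨_, hv, _, _, hσ, rfl⟩))
  obtain ⟨u, e, ρ, hρ, hρg⟩ := exists_hasOrder_of_mem hg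
  obtain ⟨u', e', ρ', hρ', hρg'⟩ := exists_hasOrder_of_mem hg'
  rcases hg with (⟨v, hv, c, σ, hσ, rfl⟩ | ⟨h, d, hh, rfl⟩) | ⟨σ, hσ, rfl⟩
  · rcases hg' with (⟨v', hv', c', σ', hσ', rfl⟩ | ⟨h', d', hh', rfl⟩) | ⟨σ', hσ', rfl⟩
    · exact simple (hAA' v hv v' hv') (hσ.mul_hasOrder hσ')
    · exact simple (by simpa using hA v hv) (hσ.mul_hasOrder (hh'.mul_pow d'))
    · rw [mul_comm, hρg]; exact smoothing_mul_mem hσ' hρ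
  · rcases hg' with (⟨v', hv', c', σ', hσ', rfl⟩ | ⟨h', d', hh', rfl⟩) | ⟨σ', hσ', rfl⟩
    · exact simple (by simpa using hA' v' hv') ((hh.mul_pow d).mul_hasOrder hσ')
    · refine Submodule.mem_sup_left (Submodule.mem_sup_right (Submodule.subset_span
        ⟨fun z => h z * h' z, d + d', hh.mul hh' (fun _ _ _ hV h => h.mono_set hV)
          (fun _ _ _ hV h => h.mono_set hV) fun _ _ _ h h' => h.mul h', ?_⟩))
      rw [← toGerm_mul]
      congr 1
      funext z x
      simp only [Pi.mul_apply]; ring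
    · rw [mul_comm, hρg]; exact smoothing_mul_mem hσ' hρ
  · rw [hρg']; exact smoothing_mul_mem hσ hρ'

/-- Products of admissible germs in complementary sets of variables are admissible. -/
lemma pullback_mul_pullback_mem {T : (Fin k →₀ ℝ) →ₗ[ℝ] (Fin n →₀ ℝ)} (hT : Function.Injective T)
    {T' : (Fin m →₀ ℝ) →ₗ[ℝ] (Fin n →₀ ℝ)} (hT' : Function.Injective T')
    (hTT' : ∀ v w, T v + T' w = 0 → v = 0) {γ : SGerm (Fin k)} (hγ : γ ∈ admissibleSpan k)
    {γ' : SGerm (Fin m)} (hγ' : γ' ∈ admissibleSpan m) :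
    pullback hT γ * pullback hT' γ' ∈ admissibleSpan n := by
  have h1 : pullback hT γ ∈ Submodule.map (pullback hT) (admissibleSpan k) :=
    Submodule.mem_map_of_mem hγ
  have h2 : pullback hT' γ' ∈ Submodule.map (pullback hT') (admissibleSpan m) :=
    Submodule.mem_map_of_mem hγ'
  rw [admissibleSpan_eq, Submodule.map_span] at h1 h2
  refine mul_mem_of_span ?_ h1 h2
  rintro _ ⟨g, hg, rfl⟩ _ ⟨g', hg', rfl⟩
  refine mul_mem_admissibleSpan ?_ ?_ ?_ (pullback_mem_admissibleGenerators hT hg)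
    (pullback_mem_admissibleGenerators hT' hg')
  · rintro _ ⟨v, hv, rfl⟩
    exact (map_ne_zero_iff T hT).2 hv
  · rintro _ ⟨v, hv, rfl⟩
    exact (map_ne_zero_iff T' hT').2 hv
  · rintro _ ⟨v, hv, rfl⟩ _ ⟨w, -, rfl⟩ h0
    exact hv (hTT' v w h0)

lemma firstForms_eq (n : ℕ) :
    firstForms n = Finsupp.linearCombination ℝ fun i : Fin n => Finsupp.single (i : ℕ) (1 : ℝ) := by
  ext i : 2
  simp [firstForms, Finsupp.lmapDomain_apply, Finsupp.mapDomain_single]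

lemma pullback_firstForms (σ : (Fin n → ℂ) → ℝ≥0 → ℂ) :
    pullback (injective_firstForms n) (toGerm σ) = toGerm fun z => σ (firstCoords n z) := by
  rw [pullback_toGerm]
  congr 1
  funext z
  rw [Function.comp_apply, affineSubst_firstForms]

/-- Finitely many linear forms involve finitely many variables. -/
lemma exists_firstForms {L : Fin k → (ℕ →₀ ℝ)} (hL : LinearIndependent ℝ L) :
    ∃ (n : ℕ) (T : (Fin k →₀ ℝ) →ₗ[ℝ] (Fin n →₀ ℝ)), 0 < n ∧ Function.Injective T ∧
      firstForms n ∘ₗ T = Finsupp.linearCombination ℝ L := by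
  set n := (Finset.univ.biUnion fun i => (L i).support).sup id + 1 with hn
  have hM : LinearIndependent ℝ fun i : Fin n => Finsupp.single (i : ℕ) (1 : ℝ) := by
    have := injective_firstForms n
    rwa [firstForms_eq] at this
  have hle : Submodule.span ℝ (Set.range L) ≤
      Submodule.span ℝ (Set.range fun i : Fin n => Finsupp.single (i : ℕ) (1 : ℝ)) := by
    rw [Submodule.span_le]
    rintro _ ⟨i, rfl⟩
    rw [SetLike.mem_coe, ← Finsupp.sum_single (L i)]
    refine Submodule.sum_mem _ fun j hj => ?_
    have hjn : j < n := Nat.lt_succ_of_le (Finset.le_sup (f := id)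
      (Finset.mem_biUnion.2 ⟨i, Finset.mem_univ i, hj⟩))
    have h1 : Finsupp.single j (L i j) = L i j • Finsupp.single j (1 : ℝ) := by simp
    rw [h1]
    exact Submodule.smul_mem _ _ (Submodule.subset_span ⟨⟨j, hjn⟩, rfl⟩)
  obtain ⟨T, hT, h⟩ := exists_transition hL hM hle
  exact ⟨n, T, Nat.succ_pos _, hT, by rw [firstForms_eq, h]⟩

/-- Pull-backs of admissible germs are admissible. In at least one variable, a smoothing germ is a
simple germ of nonconstant order. -/
lemma formPullback_mem_Omega {L : Fin k → (ℕ →₀ ℝ)} (hL : LinearIndependent ℝ L)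
    {γ : SGerm (Fin k)} (hγ : γ ∈ admissibleSpan k) : formPullback hL γ ∈ Omega := by
  obtain ⟨n, T, hn, hT, hTL⟩ := exists_firstForms hL
  rw [formPullback, ← pullback_pullback hT (injective_firstForms n) _ hTL]
  suffices h : admissibleSpan k ≤ (Omega.comap (pullback (injective_firstForms n))).comap
    (pullback hT) from h hγ
  rw [admissibleSpan_eq, Submodule.span_le]
  intro g hg
  have h1 := pullback_mem_admissibleGenerators hT hg
  rw [SetLike.mem_coe, Submodule.mem_comap, Submodule.mem_comap]
  rcases h1 with (⟨_, ⟨v, hv, rfl⟩, c, σ, hσ, he⟩ | ⟨h, d, hh, he⟩) | ⟨σ, hσ, he⟩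
  · rw [he, pullback_firstForms]
    exact Submodule.subset_span (Or.inl ⟨n, T v, c, σ, (map_ne_zero_iff T hT).2 hv,
      isSimpleMeromorphic_iff.2 hσ, rfl⟩)
  · rw [he, pullback_firstForms]
    refine Submodule.subset_span (Or.inr ⟨n, h, Polynomial.X ^ d,
      isMeromorphicFunction_iff.2 hh, ?_⟩)
    simp
  · rw [he, pullback_firstForms]
    exact Submodule.subset_span (Or.inl ⟨n, Finsupp.single ⟨0, hn⟩ 1, 0, σ, by simp,
      isSimpleMeromorphic_iff.2 (hσ.imp fun U τ h => h.hasOrder _ _), rfl⟩)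

lemma dependsOn_firstForms {γ : SGerm (Fin n)} (hγ : γ ∈ meromorphicGerms n) :
    ∃ W, DependsOn (pullback (injective_firstForms n) γ) W := by
  have hM : LinearIndependent ℝ fun i : Fin n => Finsupp.single (i : ℕ) (1 : ℝ) := by
    have := injective_firstForms n
    rwa [firstForms_eq] at this
  refine ⟨_, dependsOn_iff.2 ⟨n, _, hM, rfl, γ, hγ, ?_⟩⟩
  simp only [formPullback, firstForms_eq]

/-- Germs in no variables depend on the zero subspace. -/
lemma dependsOn_bot {γ : SGerm (Fin 0)} (hγ : γ ∈ meromorphicGerms 0) :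
    DependsOn (pullback (injective_firstForms 0) γ) ⊥ := by
  obtain ⟨τ, rfl⟩ := toGerm_surjective γ
  rw [pullback_firstForms]
  refine ⟨0, Fin.elim0, τ, linearIndependent_empty_type, by simp, hγ, ?_⟩
  congr 1
  funext z
  congr 1
  exact Subsingleton.elim _ _

lemma exists_dependsOn {g : SGerm ℕ} (hg : g ∈ Omega) : ∃ W, DependsOn g W := by
  induction hg using Submodule.span_induction with
  | mem g hg =>
    rcases hg with ⟨n, L, c, σ, -, hσ, rfl⟩ | ⟨n, h, p, hh, rfl⟩
    · have := dependsOn_firstForms (mem_meromorphicGerms (isSimpleMeromorphic_iff.1 hσ))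
      rwa [pullback_firstForms] at this
    · have := dependsOn_firstForms (polySpan_le_meromorphicGerms
        (mem_polySpan (isMeromorphicFunction_iff.1 hh) p))
      rwa [pullback_firstForms] at this
  | zero => exact ⟨⊥, by simpa using dependsOn_bot (Submodule.zero_mem (meromorphicGerms 0))⟩
  | add x y _ _ hx hy =>
    obtain ⟨W, hW⟩ := hx
    obtain ⟨W', hW'⟩ := hy
    exact ⟨_, hW.add hW'⟩
  | smul c x _ hx =>
    obtain ⟨W, hW⟩ := hx
    exact ⟨_, hW.smul c⟩

lemma dependsOn_Dep {g : SGerm ℕ} (hg : g ∈ Omega) : DependsOn g (Dep g) :=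
  (isLeast_Dep (exists_dependsOn hg).choose_spec).1

/-- Products of admissible germs whose dependence subspaces are in direct sum are admissible: both
factors are pull-backs of admissible germs along bases of their dependence subspaces. -/
lemma mul_mem_Omega {g g' : SGerm ℕ} (hg : g ∈ Omega) (hg' : g' ∈ Omega)
    (h : Dep g ⊓ Dep g' = ⊥) : g * g' ∈ Omega := by
  obtain ⟨k, L, _, hL, hspan, -, -⟩ := dependsOn_Dep hg
  obtain ⟨m, L', _, hL', hspan', -, -⟩ := dependsOn_Dep hg'
  obtain ⟨γ, hγ, he⟩ := exists_formPullback_of_mem_Omega hL hg (hspan ▸ dependsOn_Dep hg)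
  obtain ⟨γ', hγ', he'⟩ := exists_formPullback_of_mem_Omega hL' hg' (hspan' ▸ dependsOn_Dep hg')
  have := (dependsOn_Dep hg).finiteDimensional
  have := (dependsOn_Dep hg').finiteDimensional
  obtain ⟨n, M, hM, hspanM⟩ := exists_linearIndependent_span (Dep g ⊔ Dep g')
  obtain ⟨T, hT, hTM⟩ := exists_transition hL hM (by rw [hspan, hspanM]; exact le_sup_left)
  obtain ⟨T', hT', hTM'⟩ := exists_transition hL' hM (by rw [hspan', hspanM]; exact le_sup_right)
  rw [he, he', formPullback, formPullback,
    ← pullback_pullback hT (injective_linearCombination hM) _ hTM,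
    ← pullback_pullback hT' (injective_linearCombination hM) _ hTM', ← pullback_mul]
  refine formPullback_mem_Omega hM (pullback_mul_pullback_mem hT hT' (fun v w h0 => ?_) hγ hγ')
  have h1 := congrArg (Finsupp.linearCombination ℝ M) h0
  rw [map_add, map_zero, ← LinearMap.comp_apply, ← LinearMap.comp_apply, hTM, hTM'] at h1
  have h2 : Finsupp.linearCombination ℝ L v ∈ Dep g ⊓ Dep g' := by
    refine ⟨hspan ▸ linearCombination_mem_span L v, ?_⟩
    rw [SetLike.mem_coe, eq_neg_of_add_eq_zero_left h1, ← hspan']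
    exact Submodule.neg_mem _ (linearCombination_mem_span L' w)
  rw [h, Submodule.mem_bot] at h2
  exact (map_eq_zero_iff _ (injective_linearCombination hL)).1 h2

end products

/-! ### The locality algebra of admissible germs -/

section algebra

variable {g h : SGerm ℕ}

lemma Dep_add_le (hg : g ∈ Omega) (hh : h ∈ Omega) : Dep (g + h) ≤ Dep g ⊔ Dep h :=
  Dep_le ((dependsOn_Dep hg).add (dependsOn_Dep hh))

lemma Dep_mul_le (hg : g ∈ Omega) (hh : h ∈ Omega) : Dep (g * h) ≤ Dep g ⊔ Dep h :=
  Dep_le ((dependsOn_Dep hg).mul (dependsOn_Dep hh))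

lemma Dep_smul_le (hg : g ∈ Omega) (c : ℂ) : Dep (c • g) ≤ Dep g :=
  Dep_le ((dependsOn_Dep hg).smul c)

lemma Dep_zero : Dep 0 = ⊥ :=
  le_bot_iff.1 (Dep_le (by simpa using dependsOn_bot (Submodule.zero_mem (meromorphicGerms 0))))

lemma isXConst_one {k : ℕ} : Mero IsXConst (fun (_ : Fin k → ℂ) _ => (1 : ℂ)) :=
  ⟨1, one_mem _, 1, one_pos, fun _ _ => 1, ⟨fun _ => 1, differentiableOn_const _, fun _ _ _ => rfl⟩,
    by simp⟩

lemma one_mem_Omega : toGerm (fun (_ : ℕ → ℂ) _ => (1 : ℂ)) ∈ Omega :=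
  Submodule.subset_span (Or.inr ⟨0, fun _ => 1, 1, isMeromorphicFunction_iff.2 isXConst_one,
    by simp⟩)

lemma Dep_one : Dep (toGerm fun (_ : ℕ → ℂ) _ => (1 : ℂ)) = ⊥ := by
  refine le_bot_iff.1 (Dep_le ?_)
  have h := dependsOn_bot (polySpan_le_meromorphicGerms (mem_polySpan (isXConst_one (k := 0)) 1))
  rw [pullback_firstForms] at h
  simpa using h

variable {Q : LinearMap.BilinForm ℝ (ℕ →₀ ℝ)}

lemma Indep.symm (hQ : ∀ u v, Q u v = Q v u) {x y : Omega} (hxy : Indep Q x y) : Indep Q y x :=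
  fun u hu v hv => (hQ u v).trans (hxy v hv u hu)

lemma Indep.of_le {x y z : Omega} (hxy : Indep Q x y) (hz : Dep z.1 ≤ Dep x.1) : Indep Q z y :=
  fun u hu => hxy u (hz hu)

lemma Indep.of_le_sup {x y z w : Omega} (hx : Indep Q x w) (hy : Indep Q y w)
    (hz : Dep z.1 ≤ Dep x.1 ⊔ Dep y.1) : Indep Q z w := by
  intro u hu v hv
  obtain ⟨a, ha, b, hb, rfl⟩ := Submodule.mem_sup.1 (hz hu)
  rw [map_add, LinearMap.add_apply, hx a ha v hv, hy b hb v hv, add_zero]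

lemma indep_of_Dep_eq_bot {x : Omega} (hx : Dep x.1 = ⊥) (y : Omega) : Indep Q x y := by
  intro u hu v _
  rw [hx, Submodule.mem_bot] at hu
  rw [hu, map_zero, LinearMap.zero_apply]

lemma Indep.inf_eq_bot (hQ : ∀ v, v ≠ 0 → 0 < Q v v) {x y : Omega} (hxy : Indep Q x y) :
    Dep x.1 ⊓ Dep y.1 = ⊥ := by
  rw [Submodule.eq_bot_iff]
  intro v hv
  by_contra h0
  exact (hQ v h0).ne' (hxy v hv.1 v hv.2)

/-- The polar set of `X`, as a linear subspace of the space of admissible germs. -/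
def polarSubmodule (Q : LinearMap.BilinForm ℝ (ℕ →₀ ℝ)) (X : Set Omega) : Submodule ℂ Omega where
  carrier := polar (Indep Q) X
  add_mem' {x y} hx hy u hu := (hx u hu).of_le_sup (hy u hu) (Dep_add_le x.2 y.2)
  zero_mem' u _ := indep_of_Dep_eq_bot Dep_zero u
  smul_mem' c {x} hx u hu := (hx u hu).of_le (Dep_smul_le x.2 c)

/-- The product of independent admissible germs. -/
def indepMul (hQ : ∀ v, v ≠ 0 → 0 < Q v v) (p : {p : Omega × Omega // Indep Q p.1 p.2}) : Omega :=
  ⟨p.1.1 * p.1.2, mul_mem_Omega p.1.1.2 p.1.2.2 (p.2.inf_eq_bot hQ)⟩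

lemma coe_indepMul (hQ : ∀ v, v ≠ 0 → 0 < Q v v) {x y : Omega} (h : Indep Q x y) :
    (indepMul hQ ⟨(x, y), h⟩ : SGerm ℕ) = x.1 * y.1 := rfl

lemma Indep.indepMul (hQ : ∀ v, v ≠ 0 → 0 < Q v v) {x y w : Omega} (h : Indep Q x y)
    (hx : Indep Q x w) (hy : Indep Q y w) :
    Indep Q (LocalitySymbols.indepMul hQ ⟨(x, y), h⟩) w :=
  hx.of_le_sup hy (Dep_mul_le x.2 y.2)

lemma isCommUnitalLocalityAlgebra_Omega (hQsymm : ∀ u v, Q u v = Q v u)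
    (hQpos : ∀ v, v ≠ 0 → 0 < Q v v) :
    IsCommUnitalLocalityAlgebra ℂ (Indep Q) (indepMul hQpos) ⟨_, one_mem_Omega⟩ where
  symm _ _ h := h.symm hQsymm
  polar_subspace X := ⟨polarSubmodule Q X, rfl⟩
  add_left v₁ v₂ w _ _ _ := Subtype.ext <| by
    simp only [coe_indepMul, Submodule.coe_add, add_mul]
  add_right v w₁ w₂ _ _ _ := Subtype.ext <| by
    simp only [coe_indepMul, Submodule.coe_add, mul_add]
  smul_left c v w _ _ := Subtype.ext <| by
    simp only [coe_indepMul, Submodule.coe_smul, SGerm.smul_mul]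
  smul_right c v w _ _ := Subtype.ext <| by
    simp only [coe_indepMul, Submodule.coe_smul]
    rw [mul_comm v.1, SGerm.smul_mul, mul_comm v.1]
  mul_mem_polar U x y h hx hy u hu := h.indepMul hQpos (hx u hu) (hy u hu)
  assoc x y z hxy hyz hxz := by
    refine ⟨hxy.indepMul hQpos hxz hyz,
      (hyz.indepMul hQpos (hxy.symm hQsymm) (hxz.symm hQsymm)).symm hQsymm, Subtype.ext ?_⟩
    rw [coe_indepMul, coe_indepMul, coe_indepMul, coe_indepMul, mul_assoc x.1]
  comm x y _ _ := Subtype.ext <| by rw [coe_indepMul, coe_indepMul, mul_comm x.1]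
  polar_unit := Set.eq_univ_of_forall fun x u hu => by
    rw [Set.mem_singleton_iff] at hu
    subst hu
    exact (indep_of_Dep_eq_bot Dep_one x).symm hQsymm
  mul_unit x _ := Subtype.ext <| by rw [coe_indepMul]; exact mul_one _
  unit_mul x _ := Subtype.ext <| by rw [coe_indepMul]; exact one_mul _

end algebra

end LocalitySymbols

end

theorem proposition4p15 (Q : LinearMap.BilinForm ℝ (ℕ →₀ ℝ))
    (hQsymm : ∀ u v, Q u v = Q v u) (hQpos : ∀ v, v ≠ 0 → 0 < Q v v) :
    (∀ g ∈ LocalitySymbols.Omega,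
      IsLeast {W | LocalitySymbols.DependsOn g W} (LocalitySymbols.Dep g)) ∧
    ∃ (m : {p : LocalitySymbols.Omega × LocalitySymbols.Omega //
          LocalitySymbols.Indep Q p.1 p.2} → LocalitySymbols.Omega)
      (e : LocalitySymbols.Omega),
      (∀ p, (m p : LocalitySymbols.SGerm ℕ) = p.1.1 * p.1.2) ∧
      (e : LocalitySymbols.SGerm ℕ) = LocalitySymbols.toGerm (fun _ _ => 1) ∧
      LocalitySymbols.IsCommUnitalLocalityAlgebra ℂ (LocalitySymbols.Indep Q) m e :=
  ⟨fun _ hg => LocalitySymbols.isLeast_Dep (LocalitySymbols.exists_dependsOn hg).choose_spec,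
    LocalitySymbols.indepMul hQpos, ⟨_, LocalitySymbols.one_mem_Omega⟩, fun _ => rfl, rfl,
    LocalitySymbols.isCommUnitalLocalityAlgebra_Omega hQsymm hQpos⟩
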